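/- All functions are complex-valued functions of $n\in\mathbb Z$ and $t\in\mathbb R$; $u^{(k)}(n,t):=u(n+k,t)$, a dot or subscript $t$ is the $t$-derivative, $(\Delta^{-1}u)(n)=\sum_{i=0}^{n-1}u(i)$ for $n\ge 0$ and $-\sum_{i=n}^{-1}u(i)$ for $n<0$, $(Eu)=u^{(1)}$. The Toda lattice with $N$ self-consistent sources (TLSCS) for $v,p,\phi_{j\pm}$ with constants $\lambda_j$ $(1\le j\le N)$ is $$v_t=v\Big(p^{(-1)}+\sum_j\phi_{j-}^{(-1)}\phi_{j+}^{(-1)}\Big)-v\Big(p+\sum_j\phi_{j-}\phi_{j+}\Big),\quad p_t=v\Big(1+\sum_j\phi_{j-}^{(-1)}\phi_{j+}\Big)-v^{(1)}\Big(1+\sum_j\phi_{j-}\phi_{j+}^{(1)}\Big),$$ $$L\phi_{j+}:=v^{(1)}\phi_{j+}^{(1)}+p\,\phi_{j+}+\phi_{j+}^{(-1)}=\lambda_j\phi_{j+},\qquad L^*\phi_{j-}:=v\phi_{j-}^{(-1)}+p\,\phi_{j-}+\phi_{j-}^{(1)}=\lambda_j\phi_{j-}.$$ With $v=\exp(x^{(-1)}-x)$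 and $p=x_t-\sum_j\phi_{j+}\phi_{j-}$ its second order form is $$x_{tt}=e^{x^{(-1)}-x}\Big(1+\sum_j\phi_{j+}\phi_{j-}^{(-1)}\Big)-e^{x-x^{(1)}}\Big(1+\sum_j\phi_{j+}^{(1)}\phi_{j-}\Big)+\sum_j(\phi_{j+}\phi_{j-})_t .$$ An eigenfunction w.r.t. $\lambda$ ($\lambda\ne\lambda_j$ for all $j$) is a solution $\psi$ of the Lax pair $$L\psi=\lambda\psi,\qquad -\psi_t=v^{(1)}\psi^{(1)}+\sum_j\frac{1}{\lambda-\lambda_j}v^{(1)}\phi_{j-}\big(\phi_{j+}^{(1)}\psi-\phi_{j+}\psi^{(1)}\big).$$ **Theorem (generalized forward Darboux transformation).** Let $v,p,x,\phi_{i\pm},\lambda_i$ $(1\le i\le N)$ solve the TLSCS and its second order form, with $\phi_{i\pm}$ differentiable in $t$. Let $l,I\ge0$, $l+I\ge1$. Let $F_j,G_j$ $(1\le j\le l)$ be pairs of independent eigenfunctions w.r.t. distinct $\lambda_{N+j}$. For $1\le r\le I$ let $f_r,g_r$ be pairs of eigenfunctions w.r.t. $\lambda_{N+l+r}(\omega)$,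 for $\omega$ in an open set $W_r\subset\mathbb C$, such that $\lambda_{N+l+r},f_r,g_r$ are analytic in $\omega$ and $f_r,g_r$ are continuous in $(t,\omega)$; fix $\omega_r\in W_r$ at which $f_r,g_r$ are independent; everything below is taken at $\omega=\omega_r$, and $\lambda_{N+l+r}:=\lambda_{N+l+r}(\omega_r)$. Let $\alpha_j(t),\beta_r(t)$ be arbitrary differentiable functions, $m_r\ge2$ integers, $|\mathbf m|=\sum_r m_r$, $M=l+|\mathbf m|$, and $c_j(t),d_j(t)$ functions with $c_jd_j=(-1)^j\dot\alpha_j/\alpha_j$, i.e. $c_jd_j\alpha_j=(-1)^j\dot\alpha_j$. Put $q_j=F_j+\alpha_jG_j$, $h_r=f_r+g_r$. Consider the list of $M$ functions $$\mathcal C:\quad q_1,\dots,q_l;\ h_1,\partial_{\omega_1}h_1,\dots,\partial_{\omega_1}^{m_1-1}h_1+(-1)^{m_1-1}\beta_1g_1;\ \dots;\ h_I,\partial_{\omega_I}h_I,\dots,\partial_{\omega_I}^{m_I-1}h_I+(-1)^{m_I-1}\beta_Ig_I .$$ For $u_1,\dots,u_k$ let $\mathrm{cas}(u_1,\dots,u_k)=\det(u_i^{(j)})_{1\le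 i\le k,\ j=0,\dots,k-1}$ and $\widetilde{\mathrm{cas}}(u_1,\dots,u_k)=\det(u_i^{(j)})_{1\le i\le k,\ j=0,2,\dots,k}$. Let $D=\mathrm{cas}(\mathcal C)$, $D(\psi)=\mathrm{cas}(\psi,\mathcal C)$, $\widetilde D=\widetilde{\mathrm{cas}}(\mathcal C)$; let $D^{j}$ $(1\le j\le l)$ be $\mathrm{cas}$ of $\mathcal C$ without $q_j$, and $D^{l+r}$ $(1\le r\le I)$ be $\mathrm{cas}$ of $\mathcal C$ without the last function $\partial_{\omega_r}^{m_r-1}h_r+(-1)^{m_r-1}\beta_rg_r$ of the $r$-th block. For $\psi$ with $L\psi=\lambda\psi$ put $$S_i(\psi)=\Delta^{-1}E(\phi_{i-}\psi)+\frac1{\lambda-\lambda_i}\big[v^{(1)}\psi^{(1)}\phi_{i-}-\psi\,\phi_{i-}^{(1)}\big]_{n=0},\qquad \mathbf w_i(\psi)=\big(S_i(\psi),\psi^{(1)},\dots,\psi^{(M-1)}\big)^T,$$ and let $\overline D(\phi_{i-})$ be the determinant of the $M$ columns obtained from $\mathcal C$ by replacing $q_j,h_r,g_r$ by $\mathbf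 w_i(q_j),\mathbf w_i(h_r),\mathbf w_i(g_r)$ (the $\omega$-derivatives act on the columns, so also on $\lambda(\omega)$). Define $$\psi[l,\mathbf m]=\frac{D(\psi)}{D^{(1)}},\quad v[l,\mathbf m]=v^{(M)}\frac{D^{(1)}D^{(-1)}}{D^2},\quad p[l,\mathbf m]=p+\frac{\widetilde D^{(-1)}}{D}-\frac{\widetilde D}{D^{(1)}},\quad x[l,\mathbf m]=x^{(M)}+\tfrac12\log\Big(\frac{D}{D^{(1)}}\Big)^2,$$ $$\phi_{i+}[l,\mathbf m]=\frac{D(\phi_{i+})}{D^{(1)}},\quad \phi_{i-}[l,\mathbf m]=\frac{\overline D(\phi_{i-})}{D}\quad(1\le i\le N),$$ $$\phi_{N+j,+}[l,\mathbf m]=c_j\frac{D(F_j)}{D^{(1)}},\quad \phi_{N+j,-}[l,\mathbf m]=d_j\frac{(D^{j})^{(1)}}{D}\quad(1\le j\le l),$$ $$\phi_{N+l+r,+}[l,\mathbf m]=-\frac{D(f_r)}{D^{(1)}},\quad \phi_{N+l+r,-}[l,\mathbf m]=(-1)^{\,l+m_1+\cdots+m_{r-1}}\,\dot\beta_r\,\frac{(D^{l+r})^{(1)}}{D}\quad(1\le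 r\le I).$$ Then, at every $(n,t)$ with $D(k,t)\neq0$ for $n-1\le k\le n+2$: 1. $v[l,\mathbf m],p[l,\mathbf m],\phi_{i\pm}[l,\mathbf m],\lambda_i$ $(1\le i\le N+l+I)$ satisfy the TLSCS with $N+l+I$ sources; 2. for every eigenfunction $\psi$ of the given system w.r.t. some $\lambda\ne\lambda_i$ $(1\le i\le N+l+I)$, $\psi[l,\mathbf m]$ satisfies the Lax pair w.r.t. $\lambda$ of the new system; 3. $v[l,\mathbf m]=\exp(x[l,\mathbf m]^{(-1)}-x[l,\mathbf m])$ and $p[l,\mathbf m]=x[l,\mathbf m]_t-\sum_{i\le N+l+I}\phi_{i+}[l,\mathbf m]\phi_{i-}[l,\mathbf m]$ and, if all $\alpha_j,\beta_r$ are twice differentiable, $x[l,\mathbf m]$ satisfies the second order form with $N+l+I$ sources. Here $\frac12\log(D/D^{(1)})^2$ stands for any determination which, near $t$ and at the sites $n-1,n,n+1$, is a continuous in $t$ logarithm of $\sigma D/D^{(1)}$ with one common sign $\sigma=\pm1$ (for real $D$ such that $D/D^{(1)}$ has the same sign at these sites, this includes the real function $\frac12\log(D/D^{(1)})^2$); there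 is one function on $\mathbb Z\times\mathbb R$ that is such a determination at all these $(n,t)$. -/

import Mathlib

open Filter Topology

noncomputable section

/-- Complex-valued functions `u (n, t)` of a lattice site `n ∈ ℤ` and a time `t ∈ ℝ`. -/
abbrev LatticeFn : Type := ℤ → ℝ → ℂ

/-- The fields of the Toda lattice with self-consistent sources: the potentials `v`, `p`, the sources
`φ_{j+}`, `φ_{j-}` and their eigenvalues `λ_j`, where `j` runs through `ι`.
Only the functions; the equations are stated below. -/
structure TodaFields (ι : Type) where
  v : LatticeFn
  p : LatticeFn
  φp : ι → LatticeFn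
  φm : ι → LatticeFn
  ev : ι → ℂ

namespace TodaFields

variable {ι : Type} (S : TodaFields ι)

/-- `(L u)(n, t) = v(n+1, t) u(n+1, t) + p(n, t) u(n, t) + u(n-1, t)`. -/
def L (u : LatticeFn) : LatticeFn := fun n t =>
  S.v (n + 1) t * u (n + 1) t + S.p n t * u n t + u (n - 1) t

/-- `(L* u)(n, t) = v(n, t) u(n-1, t) + p(n, t) u(n, t) + u(n+1, t)`. -/
def Lstar (u : LatticeFn) : LatticeFn := fun n t =>
  S.v n t * u (n - 1) t + S.p n t * u n t + u (n + 1) t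

/-- The source `φ_{j-}(a, t) φ_{j+}(b, t)` summed over `j`. -/
def src [Fintype ι] (a b : ℤ) (t : ℝ) : ℂ := ∑ j, S.φm j a t * S.φp j b t

/-- The Toda lattice equation with self-consistent sources (index set `ι`), at `(n, t)`. -/
structure TLSCSAt [Fintype ι] (n : ℤ) (t : ℝ) : Prop where
  v_eq : HasDerivAt (S.v n)
    (S.v n t * (S.p (n - 1) t + S.src (n - 1) (n - 1) t)
      - S.v n t * (S.p n t + S.src n n t)) t
  p_eq : HasDerivAt (S.p n)
    (S.v n t * (1 + S.src (n - 1) n t) - S.v (n + 1) t * (1 + S.src n (n + 1) t)) t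
  eigen : ∀ j, S.L (S.φp j) n t = S.ev j * S.φp j n t
  adjoint_eigen : ∀ j, S.Lstar (S.φm j) n t = S.ev j * S.φm j n t

/-- The relations between `v`, `p` and `x` at `(n, t)`:
`v = exp (x(n-1) - x(n))` and `p = x_t - ∑ j, φ_{j+} φ_{j-}`. -/
structure PotentialAt [Fintype ι] (x : LatticeFn) (n : ℤ) (t : ℝ) : Prop where
  v_eq : S.v n t = Complex.exp (x (n - 1) t - x n t)
  x_deriv : HasDerivAt (x n) (S.p n t + S.src n n t) t

/-- The second order equation for `x` at `(n, t)`; all the derivatives in it are required to exist. -/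
structure SecondOrderAt [Fintype ι] (x : LatticeFn) (n : ℤ) (t : ℝ) : Prop where
  x_diff : ∀ᶠ s in 𝓝 t, DifferentiableAt ℝ (x n) s
  src_diff : DifferentiableAt ℝ (S.src n n) t
  eq : HasDerivAt (deriv (x n))
    (Complex.exp (x (n - 1) t - x n t) * (1 + S.src (n - 1) n t)
      - Complex.exp (x n t - x (n + 1) t) * (1 + S.src n (n + 1) t)
      + deriv (S.src n n) t) t

/-- The scalar Lax pair with spectral parameter `lam`, for the function `ψ`, at `(n, t)`. -/
structure LaxAt [Fintype ι] (lam : ℂ) (ψ : LatticeFn) (n : ℤ) (t : ℝ) : Prop where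
  space : S.L ψ n t = lam * ψ n t
  time : HasDerivAt (ψ n)
    (-(S.v (n + 1) t * ψ (n + 1) t
      + ∑ j, 1 / (lam - S.ev j) * S.v (n + 1) t * S.φm j n t *
          (S.φp j (n + 1) t * ψ n t - S.φp j n t * ψ (n + 1) t))) t

/-- `ψ` is an eigenfunction of the Lax pair w.r.t. `lam`
(the time part requires `lam` to be different from all `λ_j`). -/
structure IsEigenfunction [Fintype ι] (lam : ℂ) (ψ : LatticeFn) : Prop where
  ne : ∀ j, lam ≠ S.ev j
  lax : ∀ n t, S.LaxAt lam ψ n t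

/-- `v, p, x, φ_{j±}, λ_j` solve both forms of the system, on the whole of `ℤ × ℝ`. -/
structure IsSolution [Fintype ι] (x : LatticeFn) : Prop where
  tlscs : ∀ n t, S.TLSCSAt n t
  potential : ∀ n t, S.PotentialAt x n t
  secondOrder : ∀ n t, S.SecondOrderAt x n t

end TodaFields

/-- Two lattice functions are independent as functions of `n`, at every time. -/
def IndependentPair (a b : LatticeFn) : Prop :=
  ∀ t, LinearIndependent ℂ ![fun n => a n t, fun n => b n t]

/-- `Δ⁻¹` : the sum over `0 ≤ i < n` for `n ≥ 0`, minus the sum over `n ≤ i < 0` for `n < 0`. -/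
def deltaInv (u : LatticeFn) : LatticeFn := fun n t =>
  ∑ i ∈ Finset.Ico 0 n, u i t - ∑ i ∈ Finset.Ico n 0, u i t

/-- The Casorati determinant of a list of lattice functions: `det (u_i(n + j))`, `j = 0, …, k-1`. -/
def cas (us : List LatticeFn) : LatticeFn := fun n t =>
  Matrix.det (Matrix.of fun j i : Fin us.length => us.get i (n + ((j : ℕ) : ℤ)) t)

/-- The modified Casorati determinant: `det (u_i(n + j))`, `j = 0, 2, …, k`. -/
def wcas (us : List LatticeFn) : LatticeFn := fun n t =>
  Matrix.det (Matrix.of fun j i : Fin us.length =>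
    us.get i (n + (if (j : ℕ) = 0 then 0 else ((j : ℕ) : ℤ) + 1)) t)

/-- The data of a generalized forward Darboux transformation with `l` ordinary and `I` generalized
steps: `F_j, G_j` (with eigenvalue `Λ_j`), `α_j, c_j, d_j` for the ordinary steps; for the generalized
steps the families `f_r(ω), g_r(ω)` with eigenvalue `lam_r(ω)`, the value `ω_r` of the parameter, the
multiplicity `m_r` and the time function `β_r`.  Only the functions; no properties are assumed. -/
structure GFDTData (l I : ℕ) where
  F : Fin l → LatticeFn
  G : Fin l → LatticeFn
  Λ : Fin l → ℂ
  α : Fin l → ℝ → ℂ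
  c : Fin l → ℝ → ℂ
  d : Fin l → ℝ → ℂ
  f : Fin I → ℂ → LatticeFn
  g : Fin I → ℂ → LatticeFn
  lam : Fin I → ℂ → ℂ
  ω : Fin I → ℂ
  m : Fin I → ℕ
  β : Fin I → ℝ → ℂ

namespace GFDTData

variable {l I : ℕ} (D : GFDTData l I)

/-- `q_j = F_j + α_j(t) G_j`. -/
def q (j : Fin l) : LatticeFn := fun n t => D.F j n t + D.α j t * D.G j n t

/-- `h_r = f_r + g_r`, as a function of the parameter. -/
def h (r : Fin I) (w : ℂ) : LatticeFn := fun n t => D.f r w n t + D.g r w n t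

/-- `l + |m|`, the order of the transformation. -/
def order : ℕ := l + ∑ r, D.m r

/-- The number of columns in front of the block of `h_r`: `l + m_1 + … + m_{r-1}`. -/
def offset (r : Fin I) : ℕ := l + ∑ s ∈ Finset.Iio r, D.m s

/-- From functions `a_j` (for `q_j`) and families `b_r(ω)`, `e_r(ω)` (for `h_r`, `g_r`), the list
`a_1, …, a_l; b_1, ∂b_1, …, ∂^{m_1-1} b_1 + (-1)^{m_1-1} β_1(t) e_1; …;`
`b_I, ∂b_I, …, ∂^{m_I-1} b_I + (-1)^{m_I-1} β_I(t) e_I`,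
where `∂` is the derivative in `ω`, taken at `ω = ω_r`. -/
def columns {Z : Type} (a : Fin l → Z → ℝ → ℂ) (b e : Fin I → ℂ → Z → ℝ → ℂ) :
    List (Z → ℝ → ℂ) :=
  List.ofFn a ++ (List.ofFn fun r : Fin I => List.ofFn fun k : Fin (D.m r) => fun z t =>
    iteratedDeriv (k : ℕ) (fun w => b r w z t) (D.ω r)
      + (if (k : ℕ) + 1 = D.m r then (-1) ^ (D.m r - 1) * D.β r t * e r (D.ω r) z t
          else 0)).flatten

/-- The lattice functions whose Casorati determinants are used. -/
def cols : List LatticeFn := D.columns D.q D.h D.g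

/-- `Δ_{l,m}`. -/
def Del : LatticeFn := cas D.cols

/-- `Δ_{l,m}(ψ)`: the function `ψ` is put in front. -/
def DelOf (ψ : LatticeFn) : LatticeFn := cas (ψ :: D.cols)

/-- `Δ~_{l,m}`. -/
def DelTilde : LatticeFn := wcas D.cols

/-- `Δ_{l,m}^j`: the column `q_j` is removed. -/
def DelHat (j : Fin l) : LatticeFn := cas (D.cols.eraseIdx (j : ℕ))

/-- `Δ_{l,m}^{l+r}`: the last column of the block of `h_r` is removed. -/
def DelHatGen (r : Fin I) : LatticeFn := cas (D.cols.eraseIdx (D.offset r + (D.m r - 1)))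

variable {ι : Type} (S : TodaFields ι)

/-- `S_i(ψ) = Δ⁻¹ E (φ_{i-} ψ) + (μ - λ_i)⁻¹ [v(n+1) ψ(n+1) φ_{i-}(n) - ψ(n) φ_{i-}(n+1)]_{n=0}`
for a function `ψ` with eigenvalue `μ`. -/
def Sfun (i : ι) (μ : ℂ) (ψ : LatticeFn) : LatticeFn := fun n t =>
  deltaInv (fun k s => S.φm i (k + 1) s * ψ (k + 1) s) n t
    + (μ - S.ev i)⁻¹ * (S.v 1 t * ψ 1 t * S.φm i 0 t - ψ 0 t * S.φm i 1 t)

/-- The entries of the column `w_i(ψ) = (S_i(ψ), ψ(n+1), ψ(n+2), …)ᵀ`;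
the entry in row `k` at the site `n` is the value at `(k, n)`. -/
def wvec (i : ι) (μ : ℂ) (ψ : LatticeFn) : ℕ × ℤ → ℝ → ℂ := fun z t =>
  if z.1 = 0 then Sfun S i μ ψ z.2 t else ψ (z.2 + (z.1 : ℤ)) t

/-- The columns of the determinant that transforms `φ_{i-}`. -/
def wcols (i : ι) : List (ℕ × ℤ → ℝ → ℂ) :=
  D.columns (fun j => wvec S i (D.Λ j) (D.q j))
    (fun r w => wvec S i (D.lam r w) (D.h r w))
    (fun r w => wvec S i (D.lam r w) (D.g r w))

/-- The determinant of the columns `w_i`, that transforms `φ_{i-}`. -/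
def DelBar (i : ι) : LatticeFn := fun n t =>
  Matrix.det (Matrix.of fun k a : Fin (D.wcols S i).length =>
    (D.wcols S i).get a ((k : ℕ), n) t)

/-- `Δ_{l,m}(ψ)(n) / Δ_{l,m}(n+1)`, the transform of an eigenfunction `ψ`. -/
def transform (ψ : LatticeFn) : LatticeFn := fun n t => D.DelOf ψ n t / D.Del (n + 1) t

/-- The transformed fields.  The sources are indexed by the `ι` old ones, the `l` sources of the
ordinary steps and the `I` sources of the generalized steps. -/
def apply : TodaFields (ι ⊕ (Fin l ⊕ Fin I)) where
  v := fun n t => S.v (n + (D.order : ℤ)) t * (D.Del (n + 1) t * D.Del (n - 1) t) / D.Del n t ^ 2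
  p := fun n t => S.p n t + D.DelTilde (n - 1) t / D.Del n t - D.DelTilde n t / D.Del (n + 1) t
  φp := Sum.elim (fun i => D.transform (S.φp i))
    (Sum.elim (fun j n t => D.c j t * D.transform (D.F j) n t)
      (fun r n t => -D.transform (D.f r (D.ω r)) n t))
  φm := Sum.elim (fun i n t => D.DelBar S i n t / D.Del n t)
    (Sum.elim (fun j n t => D.d j t * (D.DelHat j (n + 1) t / D.Del n t))
      (fun r n t => (-1) ^ D.offset r * deriv (D.β r) t *
        (D.DelHatGen r (n + 1) t / D.Del n t)))
  ev := Sum.elim S.ev (Sum.elim D.Λ (fun r => D.lam r (D.ω r)))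

/-- No determinant `Δ_{l,m}` in the denominators of the equations at `(n, t)` vanishes. -/
def RegularAt (n : ℤ) (t : ℝ) : Prop := ∀ k ∈ Finset.Icc (n - 1) (n + 2), D.Del k t ≠ 0

/-- `X` is, around `(n, t)`, a determination of `(1/2) log (Δ_{l,m}(k) / Δ_{l,m}(k+1))²`,
continuous in time: near `t`, at the sites `n-1, n, n+1` that enter the equations at `(n, t)`, it is a
continuous logarithm of `σ Δ_{l,m}(k) / Δ_{l,m}(k+1)`, with a common sign `σ = ±1`.
(For real determinants of one sign pattern this is the real function with the same formula.) -/
def IsHalfLogSqAt (X : LatticeFn) (n : ℤ) (t : ℝ) : Prop :=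
  ∃ σ : ℂ, (σ = 1 ∨ σ = -1) ∧ ∀ k ∈ Finset.Icc (n - 1) (n + 1), ∀ᶠ s in 𝓝 t,
    ContinuousAt (X k) s ∧ Complex.exp (X k s) = σ * (D.Del k s / D.Del (k + 1) s)

/-- `x[l, m]`, for the determination `X` of the logarithm. -/
def newX (x X : LatticeFn) : LatticeFn := fun n t => x (n + (D.order : ℤ)) t + X n t

end GFDTData

end

/-! Fix a time. The Casorati determinants define a monic difference operator `T`, `(Tψ)(n) = ψ(n) +
∑ a_k(n) ψ(n+1+k)` (`darboux`), that kills the columns of `𝒞`, and `D(ψ)/D^{(1)}` is `Tψ`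
(`casorati_cons_eq`). The identities needed are linear in a sequence `ψ` and local in `n`. Where the
Casoratian does not vanish, a combination of the `M = m + 1` columns can be subtracted from `ψ` so
that the rest is zero on a window of `M` consecutive sites. It is therefore enough to check an
identity on the columns, where `T` gives zero, and on sequences vanishing on the window, where only
a few terms at its ends survive (`eq_zero_of_window`). The formulas for the new `v` and `p` are
those for which the two sides of `T L = L' T` agree at these ends (`darboux_jacobiOp`).

The sources `φ_-` are reached by duality. A sequence `ψ` is paired with a sum `σ`, where `σ(n+1) =
σ(n) + φ(n+1) ψ(n+1)`, and `rowOp` continues `σ(n)` by values of `ψ` to a functional that kills the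
columns together with their sums. It turns sums for `φ` and `ψ` into sums for the transformed `φ`
and `Tψ` (`rowOp_step`), and it carries the bilinear concomitant of `L` and `L*` to that of the new
operators (`concomitant_darboux`). The adjoint equation follows (`rowTransform_adjoint`).

In terms of concomitants, the time part of the Lax pair reads `ψ_t = -v^{(1)} ψ^{(1)} + ∑ φ_{j+}
S_j(ψ) - K(λ) ψ` with `K` independent of `n`. Differentiating `T u = 0` gives the action of `T_t` on
the columns, and the window argument extends it to all sequences (`evolution_identity`). On unit
sequences this yields the derivatives of the first and last coefficients of `T`, hence `p_t`, `v_t`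
and `x_t`; on eigenfunctions it yields the new Lax pair.

The new sources need no separate argument. They are added to the given system beforehand with `φ_- =
0` (`GFDTData.extend`), so their sums are arbitrary constants. These constants (`newRow`) are chosen
so that the source terms produce, up to combinations of the columns, exactly the terms in `α̇ G` and
`β̇ g` by which the columns fail to follow the Lax pair. The same statements
(`IsDarbouxTransformAt.tlscsAt`, `IsDarbouxTransformAt.laxAt`) then cover old and new sources.

In a generalized block, multiplication by a function of `ω` acts through a triangular Leibniz matrix
(`blockEntry_mul`), so the block is stable under `L` and under the gauge term `K`. Derivatives in
`t` and `ω` commute by Cauchy's integral formula (`hasDerivAt_iteratedDeriv`). -/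

noncomputable section

/-! ### Casorati determinants and the Darboux operator at a fixed time. -/

/-- The Casorati determinant of a finite family of sequences. -/
def casorati {m : ℕ} (u : Fin m → ℤ → ℂ) (n : ℤ) : ℂ :=
  Matrix.det (Matrix.of fun j i : Fin m => u i (n + ((j : ℕ) : ℤ)))

/-- The Casorati minor in which the row of the shift `k + 1` is left out of `m + 2` rows. -/
def casoratiMinor {m : ℕ} (u : Fin (m + 1) → ℤ → ℂ) (n : ℤ) (k : Fin (m + 2)) : ℂ :=
  Matrix.det (Matrix.of fun j i : Fin (m + 1) => u i (n + ((k.succAbove j : ℕ) : ℤ)))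

/-- The coefficients of the Darboux operator with kernel spanned by `u`. -/
def darbouxCoeff {m : ℕ} (u : Fin (m + 1) → ℤ → ℂ) (n : ℤ) (k : Fin (m + 1)) : ℂ :=
  (-1) ^ ((k : ℕ) + 1) * casoratiMinor u n k.succ / casorati u (n + 1)

/-- The Darboux operator `ψ ↦ ψ(n) + ∑ a_k ψ(n + 1 + k)` with kernel spanned by `u`. -/
def darboux {m : ℕ} (u : Fin (m + 1) → ℤ → ℂ) : (ℤ → ℂ) →ₗ[ℂ] (ℤ → ℂ) where
  toFun ψ n := ψ n + ∑ k : Fin (m + 1), darbouxCoeff u n k * ψ (n + 1 + ((k : ℕ) : ℤ))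
  map_add' ψ χ := by
    funext n
    simp only [Pi.add_apply, mul_add, Finset.sum_add_distrib]
    ring
  map_smul' c ψ := by
    funext n
    simp only [Pi.smul_apply, smul_eq_mul, RingHom.id_apply, mul_add, Finset.mul_sum]
    congr 1
    exact Finset.sum_congr rfl fun k _ => by ring

theorem darboux_apply {m : ℕ} (u : Fin (m + 1) → ℤ → ℂ) (ψ : ℤ → ℂ) (n : ℤ) :
    darboux u ψ n = ψ n + ∑ k : Fin (m + 1), darbouxCoeff u n k * ψ (n + 1 + ((k : ℕ) : ℤ)) := rfl

/-- The second order difference operator `v(n+1) ψ(n+1) + p(n) ψ(n) + ψ(n-1)`. -/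
def jacobiOp (v p : ℤ → ℂ) : (ℤ → ℂ) →ₗ[ℂ] (ℤ → ℂ) where
  toFun ψ n := v (n + 1) * ψ (n + 1) + p n * ψ n + ψ (n - 1)
  map_add' ψ χ := by funext n; simp only [Pi.add_apply]; ring
  map_smul' c ψ := by funext n; simp only [Pi.smul_apply, smul_eq_mul, RingHom.id_apply]; ring

theorem jacobiOp_apply (v p ψ : ℤ → ℂ) (n : ℤ) :
    jacobiOp v p ψ n = v (n + 1) * ψ (n + 1) + p n * ψ n + ψ (n - 1) := rfl

section Determinants

variable {m : ℕ} (u : Fin (m + 1) → ℤ → ℂ)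

theorem casoratiMinor_zero (n : ℤ) : casoratiMinor u n 0 = casorati u (n + 1) := by
  unfold casoratiMinor casorati
  congr 1
  ext j i
  simp only [Matrix.of_apply, Fin.zero_succAbove, Fin.val_succ]
  congr 1
  push_cast
  ring

theorem casoratiMinor_last (n : ℤ) : casoratiMinor u n (Fin.last (m + 1)) = casorati u n := by
  unfold casoratiMinor casorati
  congr 1
  ext j i
  simp only [Matrix.of_apply, Fin.succAbove_last, Fin.val_castSucc]

theorem casorati_cons (ψ : ℤ → ℂ) (n : ℤ) :
    casorati (Fin.cons ψ u : Fin (m + 2) → ℤ → ℂ) n =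
      ∑ k : Fin (m + 2), (-1) ^ (k : ℕ) * ψ (n + ((k : ℕ) : ℤ)) * casoratiMinor u n k := by
  unfold casorati
  rw [Matrix.det_succ_column_zero]
  refine Finset.sum_congr rfl fun k _ => ?_
  simp only [Matrix.of_apply, Fin.cons_zero, casoratiMinor]
  congr 1

/-- Expansion along the column of `ψ`. The minor without the first row is the Casoratian at `n + 1`,
and dividing by it makes the operator monic. -/
theorem casorati_cons_eq {n : ℤ} (h : casorati u (n + 1) ≠ 0) (ψ : ℤ → ℂ) :
    casorati (Fin.cons ψ u : Fin (m + 2) → ℤ → ℂ) n = darboux u ψ n * casorati u (n + 1) := by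
  rw [casorati_cons, Fin.sum_univ_succ, casoratiMinor_zero, darboux_apply, add_mul,
    Finset.sum_mul]
  congr 1
  · simp
  · refine Finset.sum_congr rfl fun k _ => ?_
    rw [darbouxCoeff, Fin.val_succ]
    field_simp
    push_cast
    rw [show n + ((k : ℕ) + 1 : ℤ) = n + 1 + (k : ℕ) by ring, mul_comm]

theorem darboux_self {n : ℤ} (h : casorati u (n + 1) ≠ 0) (i : Fin (m + 1)) :
    darboux u (u i) n = 0 := by
  have h1 := casorati_cons_eq u h (u i)
  have h2 : casorati (Fin.cons (u i) u : Fin (m + 2) → ℤ → ℂ) n = 0 := by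
    refine Matrix.det_zero_of_column_eq (i := 0) (j := i.succ) (Fin.succ_ne_zero i).symm ?_
    intro j
    simp
  rw [h2] at h1
  exact (mul_eq_zero.mp h1.symm).resolve_right h

theorem darbouxCoeff_last (n : ℤ) :
    darbouxCoeff u n (Fin.last m) = (-1) ^ (m + 1) * casorati u n / casorati u (n + 1) := by
  rw [darbouxCoeff, Fin.succ_last, casoratiMinor_last, Fin.val_last]

theorem darbouxCoeff_zero (n : ℤ) :
    darbouxCoeff u n 0 = -casoratiMinor u n 1 / casorati u (n + 1) := by
  simp [darbouxCoeff]

/-- The Casoratian is the determinant of the linear system for a combination of the columns that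
interpolates `ψ` at `m + 1` consecutive sites. -/
theorem exists_window {n : ℤ} (h : casorati u n ≠ 0) (ψ : ℤ → ℂ) :
    ∃ c : Fin (m + 1) → ℂ, ∀ k : ℤ, n ≤ k → k ≤ n + m → (ψ - ∑ i, c i • u i) k = 0 := by
  set A : Matrix (Fin (m + 1)) (Fin (m + 1)) ℂ := Matrix.of fun j i => u i (n + ((j : ℕ) : ℤ))
    with hA
  have hu : IsUnit A.det := isUnit_iff_ne_zero.mpr h
  refine ⟨A⁻¹.mulVec fun j => ψ (n + ((j : ℕ) : ℤ)), fun k h1 h2 => ?_⟩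
  obtain ⟨j, hj⟩ := Int.eq_ofNat_of_zero_le (sub_nonneg.mpr h1)
  have hk : k = n + (j : ℤ) := by omega
  subst hk
  have hjm : j < m + 1 := by omega
  have := congrFun (show A.mulVec (A⁻¹.mulVec fun j => ψ (n + ((j : ℕ) : ℤ))) = _ by
    rw [Matrix.mulVec_mulVec, Matrix.mul_nonsing_inv _ hu, Matrix.one_mulVec]) ⟨j, hjm⟩
  simp only [Matrix.mulVec, dotProduct] at this
  simp only [hA, Matrix.of_apply] at this
  simp only [Pi.sub_apply, Finset.sum_apply, Pi.smul_apply, smul_eq_mul, Matrix.mulVec, dotProduct]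
  rw [sub_eq_zero, ← this]
  exact Finset.sum_congr rfl fun i _ => mul_comm _ _

/-- The coefficients of the operator that continues a row `s` to a functional vanishing on the
columns `u`. -/
def rowCoeff (s : Fin (m + 1) → ℂ) (n : ℤ) (k : Fin (m + 1)) : ℂ :=
  ((Matrix.of fun j i : Fin (m + 1) => u i (n + 1 + ((j : ℕ) : ℤ))).updateRow k
    (fun a => -s a)).det / casorati u (n + 1)

/-- Cramer's rule for the transposed Casorati matrix with right-hand side `-s`. -/
theorem rowCoeff_sum (s : Fin (m + 1) → ℂ) {n : ℤ} (h : casorati u (n + 1) ≠ 0)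
    (a : Fin (m + 1)) :
    s a + ∑ k : Fin (m + 1), rowCoeff u s n k * u a (n + 1 + ((k : ℕ) : ℤ)) = 0 := by
  set A : Matrix (Fin (m + 1)) (Fin (m + 1)) ℂ :=
    Matrix.of fun j i => u i (n + 1 + ((j : ℕ) : ℤ)) with hA
  have hdet : A.det = casorati u (n + 1) := rfl
  have h1 := congrFun (Matrix.mulVec_cramer A.transpose (fun a => -s a)) a
  simp only [Matrix.mulVec, dotProduct, Matrix.cramer_transpose_apply, Matrix.det_transpose,
    Pi.smul_apply, smul_eq_mul, Matrix.transpose_apply, hdet] at h1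
  have h2 : ∑ k : Fin (m + 1), rowCoeff u s n k * u a (n + 1 + ((k : ℕ) : ℤ)) = -s a := by
    have h3 : casorati u (n + 1) *
        ∑ k : Fin (m + 1), rowCoeff u s n k * u a (n + 1 + ((k : ℕ) : ℤ)) =
        casorati u (n + 1) * -s a := by
      rw [← h1, Finset.mul_sum]
      refine Finset.sum_congr rfl fun k _ => ?_
      rw [rowCoeff, ← hA]
      have : A k a = u a (n + 1 + ((k : ℕ) : ℤ)) := rfl
      rw [this]
      field_simp
    exact mul_left_cancel₀ h h3
  rw [h2]
  ring

/-- The determinant with first row `s` and further rows `u(n+1), …, u(n+m)`. -/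
def rowDet (s : Fin (m + 1) → ℂ) (n : ℤ) : ℂ :=
  Matrix.det (Matrix.of fun k a : Fin (m + 1) =>
    if (k : ℕ) = 0 then s a else u a (n + ((k : ℕ) : ℤ)))

theorem rowDet_eq (s : Fin (m + 1) → ℂ) (n : ℤ) :
    rowDet u s n = ∑ a : Fin (m + 1), (-1) ^ (a : ℕ) * s a *
      casorati (fun i => u (a.succAbove i)) (n + 1) := by
  unfold rowDet
  rw [Matrix.det_succ_row_zero]
  refine Finset.sum_congr rfl fun a _ => ?_
  simp only [Matrix.of_apply, Fin.val_zero, if_true]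
  congr 1
  unfold casorati
  congr 1
  ext j i
  simp only [Matrix.submatrix_apply, Matrix.of_apply, Fin.val_succ, Nat.add_eq_zero_iff,
    one_ne_zero, and_false, if_false]
  congr 1
  push_cast
  ring

/-- Both determinants are expanded along the row `s`, which is last in one and first in the other.
The minors agree; the sign is `(-1)^m` from the position and `-1` from `-s`. -/
theorem rowCoeff_last (s : Fin (m + 1) → ℂ) (n : ℤ) :
    rowCoeff u s n (Fin.last m) = (-1) ^ (m + 1) * rowDet u s n / casorati u (n + 1) := by
  rw [rowCoeff, rowDet_eq]
  congr 1
  rw [Matrix.det_succ_row _ (Fin.last m), Finset.mul_sum]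
  refine Finset.sum_congr rfl fun a _ => ?_
  rw [Matrix.updateRow_self]
  have : (Matrix.submatrix ((Matrix.of fun j i : Fin (m + 1) =>
      u i (n + 1 + ((j : ℕ) : ℤ))).updateRow (Fin.last m) fun a => -s a)
      (Fin.last m).succAbove a.succAbove).det = casorati (fun i => u (a.succAbove i)) (n + 1) := by
    unfold casorati
    congr 1
    ext j i
    rw [Matrix.submatrix_apply, Matrix.updateRow_ne (Fin.succAbove_ne _ _)]
    simp
  rw [this, Fin.val_last, pow_add, pow_succ]
  ring

end Determinants

/-! ### Reduction to sequences that vanish on a window. -/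

section Window

variable {m : ℕ} (u : Fin (m + 1) → ℤ → ℂ)

theorem sum_window_eq_last (c : Fin (m + 1) → ℂ) {ρ : ℤ → ℂ} {w : ℤ}
    (h : ∀ k, w + 1 ≤ k → k ≤ w + m → ρ k = 0) :
    ∑ k : Fin (m + 1), c k * ρ (w + 1 + ((k : ℕ) : ℤ)) = c (Fin.last m) * ρ (w + 1 + m) := by
  rw [Fin.sum_univ_castSucc, Finset.sum_eq_zero, zero_add, Fin.val_last]
  intro k _
  rw [h _ (by simp) (by simp; omega), mul_zero]

theorem sum_window_eq_first (c : Fin (m + 1) → ℂ) {ρ : ℤ → ℂ} {w : ℤ}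
    (h : ∀ k, w + 1 ≤ k → k ≤ w + m → ρ k = 0) :
    ∑ k : Fin (m + 1), c k * ρ (w + ((k : ℕ) : ℤ)) = c 0 * ρ w := by
  rw [Fin.sum_univ_succ, Finset.sum_eq_zero, add_zero, Fin.val_zero, Nat.cast_zero, add_zero]
  intro k _
  rw [h _ (by simp) (by simp), mul_zero]

theorem sum_window_eq_zero (c : Fin (m + 1) → ℂ) {ρ : ℤ → ℂ} {w : ℤ}
    (h : ∀ k, w ≤ k → k ≤ w + m → ρ k = 0) :
    ∑ k : Fin (m + 1), c k * ρ (w + ((k : ℕ) : ℤ)) = 0 := by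
  refine Finset.sum_eq_zero fun k _ => ?_
  rw [h _ (by simp) (by simp; omega), mul_zero]

/-- `T` at `w` reads the `m + 2` sites from `w` to `w + m + 1`, one more than a window of `m + 1`
sites covers. The position of the window decides which end survives. -/
theorem darboux_window_start {ρ : ℤ → ℂ} {w : ℤ} (h : ∀ k, w ≤ k → k ≤ w + m → ρ k = 0) :
    darboux u ρ w = darbouxCoeff u w (Fin.last m) * ρ (w + 1 + m) := by
  rw [darboux_apply, h w le_rfl (by omega), zero_add]
  exact sum_window_eq_last _ fun k h1 h2 => h k (by omega) (by omega)

theorem darboux_before_window {ρ : ℤ → ℂ} {w : ℤ}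
    (h : ∀ k, w + 1 ≤ k → k ≤ w + 1 + m → ρ k = 0) : darboux u ρ w = ρ w := by
  rw [darboux_apply, sum_window_eq_zero _ h, add_zero]

theorem darboux_two_before_window {ρ : ℤ → ℂ} {w : ℤ}
    (h : ∀ k, w + 2 ≤ k → k ≤ w + 1 + m → ρ k = 0) :
    darboux u ρ w = ρ w + darbouxCoeff u w 0 * ρ (w + 1) := by
  rw [darboux_apply, sum_window_eq_first]
  intro k h1 h2
  exact h k (by omega) (by omega)

/-- A linear functional on a subspace vanishes if it vanishes on elements lying over `u` and on
the elements over sequences that are zero on a window of length `m + 1`. -/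
theorem eq_zero_of_window {E : Type*} [AddCommGroup E] [Module ℂ E] (P : Submodule ℂ E)
    (π : E →ₗ[ℂ] (ℤ → ℂ)) (R : E →ₗ[ℂ] ℂ) (w : ℤ) (hw : casorati u w ≠ 0)
    (U : Fin (m + 1) → E) (hUP : ∀ i, U i ∈ P) (hU : ∀ i, π (U i) = u i) (hRU : ∀ i, R (U i) = 0)
    (hR : ∀ e ∈ P, (∀ k, w ≤ k → k ≤ w + m → π e k = 0) → R e = 0) (e : E) (he : e ∈ P) :
    R e = 0 := by
  obtain ⟨c, hc⟩ := exists_window u hw (π e)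
  have h1 : R (e - ∑ i, c i • U i) = 0 := by
    refine hR _ (P.sub_mem he (P.sum_mem fun i _ => P.smul_mem _ (hUP i))) fun k h1 h2 => ?_
    rw [map_sub, map_sum]
    simp only [map_smul, hU]
    exact hc k h1 h2
  rw [map_sub, map_sum] at h1
  simpa [hRU] using h1

end Window

/-! ### Intertwining of `L` and of its adjoint at a fixed time. -/

section FixedTime

variable {m : ℕ} (u : Fin (m + 1) → ℤ → ℂ)

theorem darboux_finset_sum_self {n : ℤ} (h : casorati u (n + 1) ≠ 0) (c : Fin (m + 1) → ℂ) :
    darboux u (∑ b, c b • u b) n = 0 := by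
  rw [map_sum, Finset.sum_apply]
  refine Finset.sum_eq_zero fun b _ => ?_
  rw [map_smul, Pi.smul_apply, darboux_self u h, smul_zero]

/-- This is what determines the new `v`: at the farthest site `n + m + 2` the coefficients of `L' T`
and `T L` agree. -/
theorem coeff_last_mul {v v' : ℤ → ℂ} {n : ℤ} (h1 : casorati u (n + 1) ≠ 0)
    (h2 : casorati u (n + 2) ≠ 0)
    (hv' : v' (n + 1) = v (n + 1 + (m + 1)) * (casorati u (n + 2) * casorati u n) /
      casorati u (n + 1) ^ 2) :
    v' (n + 1) * darbouxCoeff u (n + 1) (Fin.last m) =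
      darbouxCoeff u n (Fin.last m) * v (n + 1 + (m + 1)) := by
  rw [hv', darbouxCoeff_last, darbouxCoeff_last, show n + 1 + 1 = n + 2 by ring]
  field_simp

/-- Both sides read the sites `n - 1, …, n + m + 2`, and the window starting at `n + 1` leaves three
of them. At `n - 1` both coefficients are 1, at `n` they agree by the choice of `p'`, at `n + m + 2`
by that of `v'`. -/
theorem darboux_jacobiOp {v p v' p' : ℤ → ℂ} {n : ℤ} (h0 : casorati u n ≠ 0)
    (h1 : casorati u (n + 1) ≠ 0) (h2 : casorati u (n + 2) ≠ 0)
    (hL : ∀ a, ∃ c : Fin (m + 1) → ℂ, jacobiOp v p (u a) = ∑ b, c b • u b)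
    (hv' : v' (n + 1) = v (n + 1 + (m + 1)) * (casorati u (n + 2) * casorati u n) /
      casorati u (n + 1) ^ 2)
    (hp' : p' n = p n + darbouxCoeff u n 0 - darbouxCoeff u (n - 1) 0) (ψ : ℤ → ℂ) :
    darboux u (jacobiOp v p ψ) n = jacobiOp v' p' (darboux u ψ) n := by
  have key := eq_zero_of_window u (⊤ : Submodule ℂ (ℤ → ℂ)) LinearMap.id
    (LinearMap.proj n ∘ₗ (darboux u ∘ₗ jacobiOp v p - jacobiOp v' p' ∘ₗ darboux u)) (n + 1) h1 u
    (fun _ => trivial) (fun _ => rfl) (fun a => ?_) (fun ρ _ hρ => ?_) ψ trivial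
  · simpa [sub_eq_zero] using key
  · obtain ⟨c, hc⟩ := hL a
    have e0 : darboux u (u a) (n - 1) = 0 := darboux_self u (by simpa using h0) a
    have e1 : darboux u (u a) n = 0 := darboux_self u h1 a
    have e2 : darboux u (u a) (n + 1) = 0 :=
      darboux_self u (by rwa [show n + 1 + 1 = n + 2 by ring]) a
    simp only [LinearMap.comp_apply, LinearMap.proj_apply, LinearMap.sub_apply, Pi.sub_apply]
    rw [hc, darboux_finset_sum_self u h1, jacobiOp_apply, e0, e1, e2]
    ring
  · replace hρ : ∀ k, n + 1 ≤ k → k ≤ n + 1 + m → ρ k = 0 := hρ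
    have hsplit : jacobiOp v p ρ = (fun k => v (k + 1) * ρ (k + 1)) + (fun k => p k * ρ k) +
        fun k => ρ (k - 1) := rfl
    have e1 : darboux u (fun k => v (k + 1) * ρ (k + 1)) n =
        darbouxCoeff u n (Fin.last m) * (v (n + 1 + m + 1) * ρ (n + 1 + m + 1)) :=
      darboux_window_start u fun k hk hk' => by
        rw [hρ _ (by omega) (by omega), mul_zero]
    have e2 : darboux u (fun k => p k * ρ k) n = p n * ρ n :=
      darboux_before_window u fun k hk hk' => by
        rw [hρ _ (by omega) (by omega), mul_zero]
    have e3 : darboux u (fun k => ρ (k - 1)) n =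
        ρ (n - 1) + darbouxCoeff u n 0 * ρ (n + 1 - 1) :=
      darboux_two_before_window u fun k hk hk' => hρ _ (by omega) (by omega)
    have e4 : darboux u ρ (n + 1) =
        darbouxCoeff u (n + 1) (Fin.last m) * ρ (n + 1 + 1 + m) := darboux_window_start u hρ
    have e5 : darboux u ρ n = ρ n := darboux_before_window u hρ
    have e6 : darboux u ρ (n - 1) =
        ρ (n - 1) + darbouxCoeff u (n - 1) 0 * ρ (n - 1 + 1) :=
      darboux_two_before_window u fun k hk hk' => hρ _ (by omega) (by omega)
    have hlast := coeff_last_mul u h1 h2 hv'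
    simp only [LinearMap.comp_apply, LinearMap.proj_apply, LinearMap.sub_apply, Pi.sub_apply]
    rw [hsplit, map_add, map_add, Pi.add_apply, Pi.add_apply, e1, e2, e3, jacobiOp_apply, e4, e5,
      e6, hp']
    rw [show n + 1 + 1 + (m : ℤ) = n + 1 + m + 1 by ring, add_sub_cancel_right, sub_add_cancel]
    rw [show n + 1 + ((m : ℤ) + 1) = n + 1 + m + 1 by ring] at hlast
    linear_combination -ρ (n + 1 + m + 1) * hlast

/-- The pairs of a sequence `ψ` and a sum of `φ ψ`. -/
def sumPairs (φ : ℤ → ℂ) : Submodule ℂ ((ℤ → ℂ) × (ℤ → ℂ)) where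
  carrier := {e | ∀ n, e.2 (n + 1) = e.2 n + φ (n + 1) * e.1 (n + 1)}
  add_mem' {a b} ha hb n := by
    simp only [Prod.fst_add, Prod.snd_add, Pi.add_apply, ha n, hb n]
    ring
  zero_mem' n := by simp
  smul_mem' c a ha n := by
    simp only [Prod.smul_fst, Prod.smul_snd, Pi.smul_apply, ha n, smul_eq_mul]
    ring

theorem sumPairs_const {φ : ℤ → ℂ} {e : (ℤ → ℂ) × (ℤ → ℂ)} (he : e ∈ sumPairs φ) {w : ℤ} {m : ℕ}
    (h : ∀ k, w + 1 ≤ k → k ≤ w + m → e.1 k = 0) (k : ℤ) (hk : w ≤ k) (hk' : k ≤ w + m) :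
    e.2 k = e.2 w := by
  obtain ⟨j, hj⟩ := Int.eq_ofNat_of_zero_le (sub_nonneg.mpr hk)
  obtain rfl : k = w + (j : ℤ) := by omega
  induction j with
  | zero => simp
  | succ j ih =>
    have h1 := he (w + j)
    push_cast at hk' ⊢
    rw [← add_assoc, h1, h _ (by omega) (by omega), ih (by omega) (by omega) (by omega)]
    ring

/-- The functional `s(n) + ∑ b_k ψ(n + 1 + k)` that continues the row `s` and vanishes on the
columns. -/
def rowOp (s : Fin (m + 1) → ℤ → ℂ) (n : ℤ) : ((ℤ → ℂ) × (ℤ → ℂ)) →ₗ[ℂ] ℂ where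
  toFun e := e.2 n + ∑ k : Fin (m + 1), rowCoeff u (fun a => s a n) n k *
    e.1 (n + 1 + ((k : ℕ) : ℤ))
  map_add' a b := by
    simp only [Prod.fst_add, Prod.snd_add, Pi.add_apply, mul_add, Finset.sum_add_distrib]
    ring
  map_smul' c a := by
    simp only [Prod.smul_fst, Prod.smul_snd, Pi.smul_apply, smul_eq_mul, RingHom.id_apply, mul_add,
      Finset.mul_sum]
    congr 1
    exact Finset.sum_congr rfl fun k _ => by ring

theorem rowOp_apply (s : Fin (m + 1) → ℤ → ℂ) (n : ℤ) (e : (ℤ → ℂ) × (ℤ → ℂ)) :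
    rowOp u s n e = e.2 n + ∑ k : Fin (m + 1), rowCoeff u (fun a => s a n) n k *
      e.1 (n + 1 + ((k : ℕ) : ℤ)) := rfl

theorem rowOp_self (s : Fin (m + 1) → ℤ → ℂ) {n : ℤ} (h : casorati u (n + 1) ≠ 0)
    (a : Fin (m + 1)) : rowOp u s n (u a, s a) = 0 :=
  rowCoeff_sum u (fun a => s a n) h a

/-- The transformed source is the ratio of the top coefficients of the row functional and of `T`; in
this form it enters the window computations. -/
theorem rowCoeff_last_eq (s : Fin (m + 1) → ℤ → ℂ) {n : ℤ} (h0 : casorati u n ≠ 0) :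
    rowCoeff u (fun a => s a n) n (Fin.last m) =
      darbouxCoeff u n (Fin.last m) * (rowDet u (fun a => s a n) n / casorati u n) := by
  rw [rowCoeff_last, darbouxCoeff_last]
  field_simp

/-- So `(Tψ, rowOp)` is again a sequence with a sum, now for the transformed source. On the window
only the jump-free sum and the farthest site remain, and the latter is matched by
`rowCoeff_last_eq`. -/
theorem rowOp_step {φ : ℤ → ℂ} {s : Fin (m + 1) → ℤ → ℂ} (hs : ∀ a, (u a, s a) ∈ sumPairs φ)
    {n : ℤ} (h1 : casorati u (n + 1) ≠ 0) (h2 : casorati u (n + 2) ≠ 0)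
    {e : (ℤ → ℂ) × (ℤ → ℂ)} (he : e ∈ sumPairs φ) :
    rowOp u s (n + 1) e - rowOp u s n e =
      rowDet u (fun a => s a (n + 1)) (n + 1) / casorati u (n + 1) * darboux u e.1 (n + 1) := by
  have h2' : casorati u (n + 1 + 1) ≠ 0 := by rwa [show n + 1 + 1 = n + 2 by ring]
  set c := rowDet u (fun a => s a (n + 1)) (n + 1) / casorati u (n + 1) with hc
  have key := eq_zero_of_window u (sumPairs φ) (LinearMap.fst ℂ _ _)
    (rowOp u s (n + 1) - rowOp u s n -
      c • (LinearMap.proj (n + 1) ∘ₗ darboux u ∘ₗ LinearMap.fst ℂ _ _))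
    (n + 1) h1 (fun a => (u a, s a)) hs (fun _ => rfl) (fun a => ?_) (fun e he hρ => ?_) e he
  · simpa [sub_eq_zero] using key
  · simp only [LinearMap.sub_apply, LinearMap.smul_apply, LinearMap.comp_apply,
      LinearMap.proj_apply, LinearMap.fst_apply]
    rw [rowOp_self u s h1, rowOp_self u s h2', darboux_self u h2']
    simp
  · simp only [LinearMap.fst_apply] at hρ
    have e1 : rowOp u s (n + 1) e = e.2 (n + 1) +
        rowCoeff u (fun a => s a (n + 1)) (n + 1) (Fin.last m) * e.1 (n + 1 + 1 + m) := by
      rw [rowOp_apply, sum_window_eq_last]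
      exact fun k hk hk' => hρ k (by omega) (by omega)
    have e2 : rowOp u s n e = e.2 n := by
      rw [rowOp_apply, sum_window_eq_zero _ hρ, add_zero]
    have e3 : darboux u e.1 (n + 1) =
        darbouxCoeff u (n + 1) (Fin.last m) * e.1 (n + 1 + 1 + m) := darboux_window_start u hρ
    simp only [LinearMap.sub_apply, LinearMap.smul_apply, LinearMap.comp_apply,
      LinearMap.proj_apply, LinearMap.fst_apply, smul_eq_mul]
    rw [e1, e2, e3, he n, hρ (n + 1) le_rfl (by omega), rowCoeff_last_eq u s h1, ← hc]
    ring

/-- The unit sequence at `k`, together with its sum against `φ`. -/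
def unitPair (φ : ℤ → ℂ) (k : ℤ) : (ℤ → ℂ) × (ℤ → ℂ) :=
  (Pi.single k 1, fun n => if k ≤ n then φ k else 0)

theorem unitPair_mem (φ : ℤ → ℂ) (k : ℤ) : unitPair φ k ∈ sumPairs φ := by
  intro n
  simp only [unitPair, Pi.single_apply]
  rcases lt_trichotomy k (n + 1) with h | h | h
  · rw [if_pos h.le, if_pos (by omega : k ≤ n), if_neg h.ne']
    ring
  · rw [if_pos h.le, if_neg (by omega : ¬ k ≤ n), if_pos h.symm, h]
    ring
  · rw [if_neg (by omega), if_neg (by omega : ¬ k ≤ n), if_neg (by omega)]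
    ring

theorem darboux_single_same (n : ℤ) : darboux u (Pi.single n 1) n = 1 := by
  rw [darboux_before_window]
  · simp
  · intro k h1 h2
    rw [Pi.single_eq_of_ne (by omega)]

theorem darboux_single_last (n : ℤ) :
    darboux u (Pi.single (n + 1 + m) 1) n = darbouxCoeff u n (Fin.last m) := by
  rw [darboux_window_start]
  · simp
  · intro k h1 h2
    rw [Pi.single_eq_of_ne (by omega)]

/-- This is `rowOp_step` for the unit sequence at `n + 1`, whose sum jumps by `φ(n+1)` there. -/
theorem rowCoeff_zero_eq {φ : ℤ → ℂ} {s : Fin (m + 1) → ℤ → ℂ}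
    (hs : ∀ a, (u a, s a) ∈ sumPairs φ)
    {n : ℤ} (h1 : casorati u (n + 1) ≠ 0) (h2 : casorati u (n + 2) ≠ 0) :
    rowCoeff u (fun a => s a n) n 0 =
      φ (n + 1) - rowDet u (fun a => s a (n + 1)) (n + 1) / casorati u (n + 1) := by
  have h := rowOp_step u hs h1 h2 (unitPair_mem φ (n + 1))
  have e1 : rowOp u s (n + 1) (unitPair φ (n + 1)) = φ (n + 1) := by
    rw [rowOp_apply, sum_window_eq_zero]
    · simp [unitPair]
    · intro k h1 h2
      simp only [unitPair]
      rw [Pi.single_eq_of_ne (by omega)]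
  have e2 : rowOp u s n (unitPair φ (n + 1)) = rowCoeff u (fun a => s a n) n 0 := by
    rw [rowOp_apply, sum_window_eq_first]
    · simp [unitPair]
    · intro k h1 h2
      simp only [unitPair]
      rw [Pi.single_eq_of_ne (by omega)]
  rw [e1, e2, show (unitPair φ (n + 1)).1 = Pi.single (n + 1) 1 from rfl,
    darboux_single_same] at h
  linear_combination -h

/-- The bilinear concomitant of `L` and its adjoint. -/
def concomitant (v φ : ℤ → ℂ) (n : ℤ) : (ℤ → ℂ) →ₗ[ℂ] ℂ where
  toFun ψ := v (n + 1) * ψ (n + 1) * φ n - ψ n * φ (n + 1)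
  map_add' ψ χ := by simp only [Pi.add_apply]; ring
  map_smul' c ψ := by simp only [Pi.smul_apply, smul_eq_mul, RingHom.id_apply]; ring

theorem concomitant_apply (v φ : ℤ → ℂ) (n : ℤ) (ψ : ℤ → ℂ) :
    concomitant v φ n ψ = v (n + 1) * ψ (n + 1) * φ n - ψ n * φ (n + 1) := rfl

/-- The columns are invariant under `L`, and the rows `s` are compatible with this. -/
def RowCompatible (v p φ : ℤ → ℂ) (lam : ℂ) (s : Fin (m + 1) → ℤ → ℂ) : Prop :=
  ∀ a, ∃ c : Fin (m + 1) → ℂ, jacobiOp v p (u a) = ∑ b, c b • u b ∧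
    ∀ n, ∑ b, c b * s b n - lam * s a n = concomitant v φ n (u a)

/-- The transform of the adjoint solution with rows `s`. -/
def rowTransform (s : Fin (m + 1) → ℤ → ℂ) (n : ℤ) : ℂ :=
  rowDet u (fun a => s a n) n / casorati u n

/-- On a column the right side vanishes because `RowCompatible` makes its argument a combination of
the pairs `(u, s)`. For sequences vanishing on the window, the remaining terms at `n` and `n + m +
2` agree by the formulas for the first and the last row coefficient. -/
theorem concomitant_darboux {v p v' φ : ℤ → ℂ} {lam : ℂ} {s : Fin (m + 1) → ℤ → ℂ} {n : ℤ}
    (h0 : casorati u n ≠ 0) (h1 : casorati u (n + 1) ≠ 0) (h2 : casorati u (n + 2) ≠ 0)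
    (hs : ∀ a, (u a, s a) ∈ sumPairs φ) (hc : RowCompatible u v p φ lam s)
    (hv' : v' (n + 1) = v (n + 1 + (m + 1)) * (casorati u (n + 2) * casorati u n) /
      casorati u (n + 1) ^ 2) (ψ : ℤ → ℂ) :
    concomitant v' (rowTransform u s) n (darboux u ψ) =
      rowOp u s n (jacobiOp v p ψ - lam • ψ, fun k => concomitant v φ k ψ) := by
  have h2' : casorati u (n + 1 + 1) ≠ 0 := by rwa [show n + 1 + 1 = n + 2 by ring]
  set Q : (ℤ → ℂ) →ₗ[ℂ] ((ℤ → ℂ) × (ℤ → ℂ)) :=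
    (jacobiOp v p - lam • LinearMap.id).prod (LinearMap.pi fun k => concomitant v φ k) with hQ
  have hQe : ∀ ψ, Q ψ = (jacobiOp v p ψ - lam • ψ, fun k => concomitant v φ k ψ) := fun ψ => rfl
  have key := eq_zero_of_window u (⊤ : Submodule ℂ (ℤ → ℂ)) LinearMap.id
    (concomitant v' (rowTransform u s) n ∘ₗ darboux u - rowOp u s n ∘ₗ Q) (n + 1) h1 u
    (fun _ => trivial) (fun _ => rfl) (fun a => ?_) (fun ρ _ hρ => ?_) ψ trivial
  · rw [← hQe]
    simpa [sub_eq_zero] using key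
  · obtain ⟨c, hc1, hc2⟩ := hc a
    have hq : Q (u a) = ∑ b, c b • (u b, s b) - lam • (u a, s a) := by
      rw [hQe, hc1]
      refine Prod.ext ?_ ?_
      · simp [Prod.fst_sum]
      · funext k
        simp [Prod.snd_sum, hc2]
    rw [LinearMap.sub_apply, LinearMap.comp_apply, LinearMap.comp_apply, hq, concomitant_apply,
      darboux_self u h1, darboux_self u h2', map_sub, map_sum]
    simp only [map_smul, rowOp_self u s h1]
    simp
  · replace hρ : ∀ k, n + 1 ≤ k → k ≤ n + 1 + m → ρ k = 0 := hρ
    have e4 : darboux u ρ (n + 1) =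
        darbouxCoeff u (n + 1) (Fin.last m) * ρ (n + 1 + 1 + m) := darboux_window_start u hρ
    have e5 : darboux u ρ n = ρ n := darboux_before_window u hρ
    have hlast := coeff_last_mul u h1 h2 hv'
    rw [show n + 1 + ((m : ℤ) + 1) = n + 1 + m + 1 by ring] at hlast
    have hr0 := rowCoeff_zero_eq u hs h1 h2
    have hrl := rowCoeff_last_eq u s h0
    have hsplit : Q ρ = ((fun k => v (k + 1) * ρ (k + 1)) + (fun k => p k * ρ k) +
        (fun k => ρ (k - 1)) - lam • ρ, fun k => concomitant v φ k ρ) := rfl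
    rw [LinearMap.sub_apply, LinearMap.comp_apply, LinearMap.comp_apply, concomitant_apply, e4, e5,
      hsplit, rowOp_apply]
    set b := rowCoeff u (fun a => s a n) n
    have f1 : ∑ k : Fin (m + 1), b k * (v (n + 1 + ((k : ℕ) : ℤ) + 1) *
        ρ (n + 1 + ((k : ℕ) : ℤ) + 1)) =
        b (Fin.last m) * (v (n + 1 + m + 1) * ρ (n + 1 + m + 1)) :=
      sum_window_eq_last (ρ := fun k => v (k + 1) * ρ (k + 1)) (w := n) b fun k hk hk' => by
        rw [hρ _ (by omega) (by omega), mul_zero]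
    have f2 : ∑ k : Fin (m + 1), b k * (p (n + 1 + ((k : ℕ) : ℤ)) *
        ρ (n + 1 + ((k : ℕ) : ℤ))) = 0 :=
      sum_window_eq_zero (ρ := fun k => p k * ρ k) (w := n + 1) b fun k hk hk' => by
        rw [hρ _ (by omega) (by omega), mul_zero]
    have f3 : ∑ k : Fin (m + 1), b k * ρ (n + 1 + ((k : ℕ) : ℤ) - 1) = b 0 * ρ (n + 1 - 1) :=
      sum_window_eq_first (ρ := fun k => ρ (k - 1)) (w := n + 1) b fun k hk hk' =>
        hρ _ (by omega) (by omega)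
    have f4 : ∑ k : Fin (m + 1), b k * (lam * ρ (n + 1 + ((k : ℕ) : ℤ))) = 0 :=
      sum_window_eq_zero (ρ := fun k => lam * ρ k) (w := n + 1) b fun k hk hk' => by
        rw [hρ _ (by omega) (by omega), mul_zero]
    simp only [Pi.add_apply, Pi.sub_apply, Pi.smul_apply, smul_eq_mul, mul_add, mul_sub,
      Finset.sum_add_distrib, Finset.sum_sub_distrib]
    rw [f1, f2, f3, f4, hr0, hrl, concomitant_apply, hρ (n + 1) le_rfl (by omega)]
    rw [show n + 1 + 1 + (m : ℤ) = n + 1 + m + 1 by ring, add_sub_cancel_right]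
    simp only [rowTransform]
    linear_combination ρ (n + 1 + m + 1) * (rowDet u (fun a => s a n) n / casorati u n) * hlast

/-- Lagrange's identity for `L` and its adjoint. -/
theorem concomitant_sub (v p φ ψ : ℤ → ℂ) (lam : ℂ) (n : ℤ)
    (hφ : v (n + 1) * φ n + p (n + 1) * φ (n + 1) + φ (n + 2) = lam * φ (n + 1)) :
    concomitant v φ (n + 1) ψ - concomitant v φ n ψ =
      φ (n + 1) * (jacobiOp v p ψ (n + 1) - lam * ψ (n + 1)) := by
  rw [concomitant_apply, concomitant_apply, jacobiOp_apply, add_sub_cancel_right,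
    show n + 1 + 1 = n + 2 by ring]
  linear_combination -ψ (n + 1) * hφ

theorem rowTransform_adjoint {v p v' p' φ : ℤ → ℂ} {lam : ℂ} {s : Fin (m + 1) → ℤ → ℂ} {n : ℤ}
    (h0 : casorati u n ≠ 0) (h1 : casorati u (n + 1) ≠ 0) (h2 : casorati u (n + 2) ≠ 0)
    (h3 : casorati u (n + 3) ≠ 0)
    (hφ : ∀ n, v (n + 1) * φ n + p (n + 1) * φ (n + 1) + φ (n + 2) = lam * φ (n + 1))
    (hs : ∀ a, (u a, s a) ∈ sumPairs φ) (hc : RowCompatible u v p φ lam s)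
    (hv1 : v' (n + 1) = v (n + 1 + (m + 1)) * (casorati u (n + 2) * casorati u n) /
      casorati u (n + 1) ^ 2)
    (hv2 : v' (n + 1 + 1) = v (n + 1 + 1 + (m + 1)) *
      (casorati u (n + 1 + 2) * casorati u (n + 1)) / casorati u (n + 1 + 1) ^ 2)
    (hp' : p' (n + 1) = p (n + 1) + darbouxCoeff u (n + 1) 0 - darbouxCoeff u (n + 1 - 1) 0) :
    v' (n + 1) * rowTransform u s n + p' (n + 1) * rowTransform u s (n + 1) +
      rowTransform u s (n + 2) = lam * rowTransform u s (n + 1) := by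
  have h2' : casorati u (n + 1 + 1) ≠ 0 := by rwa [show n + 1 + 1 = n + 2 by ring]
  have h3' : casorati u (n + 1 + 2) ≠ 0 := by rwa [show n + 1 + 2 = n + 3 by ring]
  -- Since `Tψ(n+1) = 1`, comparing the increment of the new concomitant with `rowOp_step` leaves
  -- the defect of the adjoint equation with coefficient 1.
  set ψ : ℤ → ℂ := Pi.single (n + 1) 1 with hψ
  have a0 := concomitant_darboux u h0 h1 h2 hs hc hv1 ψ
  have a1 := concomitant_darboux u h1 h2' h3' hs hc hv2 ψ
  have hmem : (jacobiOp v p ψ - lam • ψ, fun k => concomitant v φ k ψ) ∈ sumPairs φ := by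
    intro k
    have := concomitant_sub v p φ ψ lam k (hφ k)
    simp only [Pi.sub_apply, Pi.smul_apply, smul_eq_mul]
    linear_combination this
  have hst := rowOp_step u hs h1 h2 hmem
  have hint := darboux_jacobiOp u h1 h2' h3' (fun a => (hc a).imp fun c h => h.1) hv2 hp' ψ
  have hone : darboux u ψ (n + 1) = 1 := darboux_single_same u (n + 1)
  simp only [map_sub, map_smul, Pi.sub_apply, Pi.smul_apply, smul_eq_mul] at hst
  rw [← a0, ← a1, hint, ← rowTransform, concomitant_apply, concomitant_apply, jacobiOp_apply,
    hone, add_sub_cancel_right] at hst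
  rw [show n + 1 + 1 = n + 2 by ring] at hst
  linear_combination -hst

end FixedTime

/-! ### The time derivative of the Darboux operator as linear algebra. -/

section FixedTimeEvolution

variable {m : ℕ} (u : Fin (m + 1) → ℤ → ℂ)

/-- Multiplication of a sequence by `f`. -/
def mulSeq (f : ℤ → ℂ) : (ℤ → ℂ) →ₗ[ℂ] (ℤ → ℂ) where
  toFun ψ n := f n * ψ n
  map_add' ψ χ := by funext n; simp only [Pi.add_apply]; ring
  map_smul' c ψ := by funext n; simp only [Pi.smul_apply, smul_eq_mul, RingHom.id_apply]; ring

/-- The operator `ψ ↦ v(n+1) ψ(n+1)`. -/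
def mulShift (v : ℤ → ℂ) : (ℤ → ℂ) →ₗ[ℂ] (ℤ → ℂ) where
  toFun ψ n := v (n + 1) * ψ (n + 1)
  map_add' ψ χ := by funext n; simp only [Pi.add_apply]; ring
  map_smul' c ψ := by funext n; simp only [Pi.smul_apply, smul_eq_mul, RingHom.id_apply]; ring

theorem mulSeq_apply (f ψ : ℤ → ℂ) (n : ℤ) : mulSeq f ψ n = f n * ψ n := rfl

theorem mulShift_apply (v ψ : ℤ → ℂ) (n : ℤ) : mulShift v ψ n = v (n + 1) * ψ (n + 1) := rfl

/-- The functional `ψ ↦ ∑ c_k ψ(w + k)`. -/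
def windowSum (c : Fin (m + 1) → ℂ) (w : ℤ) : (ℤ → ℂ) →ₗ[ℂ] ℂ where
  toFun ψ := ∑ k : Fin (m + 1), c k * ψ (w + ((k : ℕ) : ℤ))
  map_add' ψ χ := by simp only [Pi.add_apply, mul_add, Finset.sum_add_distrib]
  map_smul' c ψ := by
    simp only [Pi.smul_apply, smul_eq_mul, RingHom.id_apply, Finset.mul_sum]
    exact Finset.sum_congr rfl fun k _ => by ring

theorem windowSum_apply (c : Fin (m + 1) → ℂ) (w : ℤ) (ψ : ℤ → ℂ) :
    windowSum c w ψ = ∑ k : Fin (m + 1), c k * ψ (w + ((k : ℕ) : ℤ)) := rfl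

variable {κ : Type} [Fintype κ]

/-- The sequences together with one sum for each source. -/
def multiSumPairs (φm : κ → ℤ → ℂ) : Submodule ℂ ((ℤ → ℂ) × (κ → ℤ → ℂ)) where
  carrier := {e | ∀ j, (e.1, e.2 j) ∈ sumPairs (φm j)}
  add_mem' ha hb j := (sumPairs (φm j)).add_mem (ha j) (hb j)
  zero_mem' j := (sumPairs (φm j)).zero_mem
  smul_mem' c _ ha j := (sumPairs (φm j)).smul_mem c (ha j)

/-- The projection of a sequence with its sums to the `j`-th sum. -/
def pairProj (j : κ) : ((ℤ → ℂ) × (κ → ℤ → ℂ)) →ₗ[ℂ] ((ℤ → ℂ) × (ℤ → ℂ)) :=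
  (LinearMap.fst ℂ _ _).prod (LinearMap.proj j ∘ₗ LinearMap.snd ℂ _ _)

/-- Here `da` stands for the derivatives of the coefficients of `T`, known through their action on
the columns. On a sequence vanishing on the window the left side is zero, the source terms cancel
because the sums are constant there, and `coeff_last_mul` cancels the rest. -/
theorem evolution_identity {v v' : ℤ → ℂ} {φp φm : κ → ℤ → ℂ}
    {s : κ → Fin (m + 1) → ℤ → ℂ} {n : ℤ}
    (h1 : casorati u (n + 1) ≠ 0) (h2 : casorati u (n + 2) ≠ 0)
    (hs : ∀ j a, (u a, s j a) ∈ sumPairs (φm j))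
    (hv' : v' (n + 1) = v (n + 1 + (m + 1)) * (casorati u (n + 2) * casorati u n) /
      casorati u (n + 1) ^ 2)
    {da : Fin (m + 1) → ℂ}
    (hda : ∀ i, windowSum da (n + 1) (u i) =
      darboux u (mulShift v (u i)) n - ∑ j, darboux u (mulSeq (φp j) (s j i)) n)
    {ψ : ℤ → ℂ} {σ : κ → ℤ → ℂ} (hψ : ∀ j, (ψ, σ j) ∈ sumPairs (φm j)) :
    windowSum da (n + 1) ψ =
      darboux u (mulShift v ψ) n - ∑ j, darboux u (mulSeq (φp j) (σ j)) n
        - v' (n + 1) * darboux u ψ (n + 1)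
        + ∑ j, darboux u (φp j) n * rowOp u (s j) n (ψ, σ j) := by
  have h2' : casorati u (n + 1 + 1) ≠ 0 := by rwa [show n + 1 + 1 = n + 2 by ring]
  set R : ((ℤ → ℂ) × (κ → ℤ → ℂ)) →ₗ[ℂ] ℂ :=
    windowSum da (n + 1) ∘ₗ LinearMap.fst ℂ _ _
    - LinearMap.proj n ∘ₗ darboux u ∘ₗ mulShift v ∘ₗ LinearMap.fst ℂ _ _
    + ∑ j, LinearMap.proj n ∘ₗ darboux u ∘ₗ mulSeq (φp j) ∘ₗ LinearMap.proj j ∘ₗ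
        LinearMap.snd ℂ _ _
    + v' (n + 1) • (LinearMap.proj (n + 1) ∘ₗ darboux u ∘ₗ LinearMap.fst ℂ _ _)
    - ∑ j, darboux u (φp j) n • (rowOp u (s j) n ∘ₗ pairProj j) with hR
  have hRe : ∀ e, R e = windowSum da (n + 1) e.1 - darboux u (mulShift v e.1) n
      + ∑ j, darboux u (mulSeq (φp j) (e.2 j)) n + v' (n + 1) * darboux u e.1 (n + 1)
      - ∑ j, darboux u (φp j) n * rowOp u (s j) n (e.1, e.2 j) := by
    intro e
    simp only [hR, LinearMap.sub_apply, LinearMap.add_apply, LinearMap.comp_apply,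
      LinearMap.sum_apply, LinearMap.smul_apply, LinearMap.proj_apply, LinearMap.fst_apply,
      LinearMap.snd_apply, smul_eq_mul]
    rfl
  have key := eq_zero_of_window u (multiSumPairs φm) (LinearMap.fst ℂ _ _) R (n + 1) h1
    (fun a => (u a, fun j => s j a)) (fun a j => hs j a) (fun _ => rfl) (fun a => ?_)
    (fun e he hρ => ?_) (ψ, σ) hψ
  · rw [hRe] at key
    linear_combination key
  · rw [hRe, darboux_self u h2']
    simp only [rowOp_self u (s _) h1]
    rw [hda]
    simp
  · simp only [LinearMap.fst_apply] at hρ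
    obtain ⟨ρ, σ⟩ := e
    simp only at hρ
    have e1 : windowSum da (n + 1) ρ = 0 := sum_window_eq_zero _ hρ
    have e2 : darboux u (mulShift v ρ) n =
        darbouxCoeff u n (Fin.last m) * (v (n + 1 + m + 1) * ρ (n + 1 + m + 1)) :=
      darboux_window_start u fun k hk hk' => by
        rw [mulShift_apply, hρ _ (by omega) (by omega), mul_zero]
    have e3 : darboux u ρ (n + 1) =
        darbouxCoeff u (n + 1) (Fin.last m) * ρ (n + 1 + 1 + m) := darboux_window_start u hρ
    have e4 : ∀ j, rowOp u (s j) n (ρ, σ j) = σ j n := fun j => by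
      rw [rowOp_apply, sum_window_eq_zero _ hρ, add_zero]
    have e5 : ∀ j, darboux u (mulSeq (φp j) (σ j)) n = darboux u (φp j) n * σ j n := fun j => by
      -- The sum does not jump on the window, so it is constant on `n, …, n + 1 + m`, which are all
      -- the sites read by `T` at `n`.
      have hconst := sumPairs_const (w := n) (m := m + 1) (he j) fun k hk hk' =>
        hρ k hk (by push_cast at hk'; omega)
      simp only at hconst
      rw [darboux_apply, darboux_apply, mulSeq_apply, add_mul, Finset.sum_mul]
      congr 1
      refine Finset.sum_congr rfl fun k _ => ?_
      rw [mulSeq_apply, hconst _ (by omega) (by have := k.2; push_cast; omega)]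
      ring
    have hlast := coeff_last_mul u h1 h2 hv'
    rw [show n + 1 + ((m : ℤ) + 1) = n + 1 + m + 1 by ring] at hlast
    rw [hRe]
    simp only [e4, e5]
    rw [e1, e2, e3, show n + 1 + 1 + (m : ℤ) = n + 1 + m + 1 by ring]
    linear_combination ρ (n + 1 + m + 1) * hlast

/-- Evaluation on the unit sequence at `n + 1`, which meets only the first of the coefficients `da`.
-/
theorem evolution_coeff_zero {v v' : ℤ → ℂ} {φp φm : κ → ℤ → ℂ}
    {s : κ → Fin (m + 1) → ℤ → ℂ} {n : ℤ}
    (h1 : casorati u (n + 1) ≠ 0) (h2 : casorati u (n + 2) ≠ 0)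
    (hs : ∀ j a, (u a, s j a) ∈ sumPairs (φm j))
    (hv' : v' (n + 1) = v (n + 1 + (m + 1)) * (casorati u (n + 2) * casorati u n) /
      casorati u (n + 1) ^ 2)
    {da : Fin (m + 1) → ℂ}
    (hda : ∀ i, windowSum da (n + 1) (u i) =
      darboux u (mulShift v (u i)) n - ∑ j, darboux u (mulSeq (φp j) (s j i)) n) :
    da 0 = v (n + 1) + ∑ j, φm j (n + 1) * φp j n - v' (n + 1)
      - ∑ j, rowTransform u (s j) (n + 1) * darboux u (φp j) n := by
  have h := evolution_identity u h1 h2 hs hv' hda (ψ := Pi.single (n + 1) 1)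
    (σ := fun j => (unitPair (φm j) (n + 1)).2) fun j => unitPair_mem (φm j) (n + 1)
  have hz : ∀ k : ℤ, n + 1 + 1 ≤ k → k ≤ n + 1 + m → (Pi.single (n + 1) 1 : ℤ → ℂ) k = 0 :=
    fun k hk _ => Pi.single_eq_of_ne (by omega) _
  have e1 : windowSum da (n + 1) (Pi.single (n + 1) 1) = da 0 := by
    rw [windowSum_apply, sum_window_eq_first _ hz]
    simp
  have e2 : darboux u (mulShift v (Pi.single (n + 1) 1)) n = v (n + 1) := by
    rw [darboux_before_window]
    · simp [mulShift_apply]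
    · intro k hk hk'
      rw [mulShift_apply, Pi.single_eq_of_ne (by omega), mul_zero]
  have e3 : ∀ j, darboux u (mulSeq (φp j) (unitPair (φm j) (n + 1)).2) n =
      φm j (n + 1) * (darboux u (φp j) n - φp j n) := fun j => by
    rw [darboux_apply, darboux_apply, mulSeq_apply]
    simp only [unitPair]
    rw [if_neg (by omega), mul_zero, zero_add, add_sub_cancel_left, Finset.mul_sum]
    refine Finset.sum_congr rfl fun k _ => ?_
    rw [mulSeq_apply, if_pos (by omega)]
    ring
  have e4 : ∀ j, rowOp u (s j) n (Pi.single (n + 1) 1, (unitPair (φm j) (n + 1)).2) =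
      φm j (n + 1) - rowTransform u (s j) (n + 1) := fun j => by
    rw [rowOp_apply, sum_window_eq_first _ hz, rowCoeff_zero_eq u (hs j) h1 h2, rowTransform]
    simp [unitPair]
  simp only [e1, e2, e3, e4, darboux_single_same] at h
  rw [h]
  simp only [mul_sub, Finset.sum_sub_distrib]
  have c1 : ∑ j, darboux u (φp j) n * φm j (n + 1) = ∑ j, φm j (n + 1) * darboux u (φp j) n :=
    Finset.sum_congr rfl fun j _ => mul_comm _ _
  have c2 : ∑ j, darboux u (φp j) n * rowTransform u (s j) (n + 1) =
      ∑ j, rowTransform u (s j) (n + 1) * darboux u (φp j) n :=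
    Finset.sum_congr rfl fun j _ => mul_comm _ _
  rw [c1, c2]
  ring

/-- Evaluation on the unit sequence at `n + 1 + m`, the last site read by `T` at `n`. The
intertwining relation for the same sequence eliminates the two terms with `v` and `v'` in favour of
`p` and `p'`. -/
theorem evolution_coeff_last {v p v' p' : ℤ → ℂ} {φp φm : κ → ℤ → ℂ}
    {s : κ → Fin (m + 1) → ℤ → ℂ} {n : ℤ}
    (h0 : casorati u n ≠ 0) (h1 : casorati u (n + 1) ≠ 0) (h2 : casorati u (n + 2) ≠ 0)
    (hL : ∀ a, ∃ c : Fin (m + 1) → ℂ, jacobiOp v p (u a) = ∑ b, c b • u b)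
    (hs : ∀ j a, (u a, s j a) ∈ sumPairs (φm j))
    (hv' : v' (n + 1) = v (n + 1 + (m + 1)) * (casorati u (n + 2) * casorati u n) /
      casorati u (n + 1) ^ 2)
    (hp' : p' n = p n + darbouxCoeff u n 0 - darbouxCoeff u (n - 1) 0)
    {da : Fin (m + 1) → ℂ}
    (hda : ∀ i, windowSum da (n + 1) (u i) =
      darboux u (mulShift v (u i)) n - ∑ j, darboux u (mulSeq (φp j) (s j i)) n) :
    da (Fin.last m) = darbouxCoeff u n (Fin.last m) *
      ((p' n + ∑ j, rowTransform u (s j) n * darboux u (φp j) n)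
        - (p (n + 1 + m) + ∑ j, φm j (n + 1 + m) * φp j (n + 1 + m))) := by
  set w := n + 1 + (m : ℤ) with hw
  set ψ : ℤ → ℂ := Pi.single w 1 with hψ
  have h := evolution_identity u h1 h2 hs hv' hda (ψ := ψ)
    (σ := fun j => (unitPair (φm j) w).2) fun j => unitPair_mem (φm j) w
  have hz : ∀ k : ℤ, k ≠ w → ψ k = 0 := fun k hk => Pi.single_eq_of_ne hk _
  have hw1 : ψ w = 1 := Pi.single_eq_same _ _
  have hT : darboux u ψ n = darbouxCoeff u n (Fin.last m) := darboux_single_last u n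
  have e1 : windowSum da (n + 1) ψ = da (Fin.last m) := by
    rw [windowSum_apply, sum_window_eq_last (w := n) _ fun k _ _ => hz k (by omega), ← hw, hw1,
      mul_one]
  have e3 : ∀ j, darboux u (mulSeq (φp j) (unitPair (φm j) w).2) n =
      darbouxCoeff u n (Fin.last m) * (φm j w * φp j w) := fun j => by
    rw [darboux_window_start]
    · rw [mulSeq_apply, ← hw]
      simp only [unitPair, le_refl, if_true]
      ring
    · intro k hk hk'
      rw [mulSeq_apply]
      simp only [unitPair]
      rw [if_neg (by omega), mul_zero]
  have e4 : ∀ j, rowOp u (s j) n (ψ, (unitPair (φm j) w).2) =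
      darbouxCoeff u n (Fin.last m) * rowTransform u (s j) n := fun j => by
    rw [rowOp_apply, sum_window_eq_last (w := n) _ fun k _ _ => hz k (by omega),
      rowCoeff_last_eq u (s j) h0, rowTransform]
    simp only [unitPair]
    rw [if_neg (by omega), ← hw, hw1]
    ring
  have hint := darboux_jacobiOp u h0 h1 h2 hL hv' hp' ψ
  have hsplit : jacobiOp v p ψ = mulShift v ψ + mulSeq p ψ + fun k => ψ (k - 1) := rfl
  have f2 : darboux u (mulSeq p ψ) n = darbouxCoeff u n (Fin.last m) * p w := by
    rw [darboux_window_start]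
    · rw [mulSeq_apply, ← hw, hw1, mul_one]
    · intro k hk hk'
      rw [mulSeq_apply, hz k (by omega), mul_zero]
  have f3 : darboux u (fun k => ψ (k - 1)) n = 0 := by
    rw [darboux_before_window] <;> intros <;> exact hz _ (by omega)
  have f4 : darboux u ψ (n - 1) = 0 := by
    rw [darboux_before_window] <;> intros <;> exact hz _ (by omega)
  rw [hsplit, map_add, map_add, Pi.add_apply, Pi.add_apply, f2, f3, jacobiOp_apply, f4, hT] at hint
  simp only [e1, e3, e4] at h
  rw [h]
  have g1 : ∑ j, darboux u (φp j) n * (darbouxCoeff u n (Fin.last m) * rowTransform u (s j) n) =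
      darbouxCoeff u n (Fin.last m) * ∑ j, rowTransform u (s j) n * darboux u (φp j) n := by
    rw [Finset.mul_sum]
    exact Finset.sum_congr rfl fun j _ => by ring
  rw [g1, ← Finset.mul_sum]
  linear_combination hint

end FixedTimeEvolution

/-! ### Columns depending on time and the transformed fields. -/

/-- The values of a lattice function at a fixed time. -/
def slice (ψ : LatticeFn) (t : ℝ) : ℤ → ℂ := fun n => ψ n t

theorem slice_apply (ψ : LatticeFn) (t : ℝ) (n : ℤ) : slice ψ t n = ψ n t := rfl

/-- The values of a family of lattice functions at a fixed time. -/
def slices {α : Type*} (u : α → LatticeFn) (t : ℝ) : α → ℤ → ℂ := fun a => slice (u a) t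

theorem slices_apply {α : Type*} (u : α → LatticeFn) (t : ℝ) (a : α) (n : ℤ) :
    slices u t a n = u a n t := rfl

theorem TodaFields.L_eq {κ : Type} (S : TodaFields κ) (ψ : LatticeFn) (n : ℤ) (t : ℝ) :
    S.L ψ n t = jacobiOp (slice S.v t) (slice S.p t) (slice ψ t) n := rfl

theorem differentiableAt_det {M : ℕ} {A : ℝ → Matrix (Fin M) (Fin M) ℂ} {t : ℝ}
    (h : ∀ i j, DifferentiableAt ℝ (fun τ => A τ i j) t) :
    DifferentiableAt ℝ (fun τ => (A τ).det) t := by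
  simp only [Matrix.det_apply']
  exact DifferentiableAt.fun_sum fun σ _ => (DifferentiableAt.fun_finsetProd fun i _ => h _ _).const_mul _

section

variable {m : ℕ} {u : Fin (m + 1) → LatticeFn} {t : ℝ}

theorem differentiableAt_casorati {M : ℕ} {u : Fin M → LatticeFn} {t : ℝ}
    (hu : ∀ a n, DifferentiableAt ℝ (u a n) t) (n : ℤ) :
    DifferentiableAt ℝ (fun τ => casorati (slices u τ) n) t :=
  differentiableAt_det fun _ _ => hu _ _

theorem differentiableAt_darbouxCoeff (hu : ∀ a n, DifferentiableAt ℝ (u a n) t) {n : ℤ}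
    (h : casorati (slices u t) (n + 1) ≠ 0) (k : Fin (m + 1)) :
    DifferentiableAt ℝ (fun τ => darbouxCoeff (slices u τ) n k) t := by
  have h1 : DifferentiableAt ℝ (fun τ => casoratiMinor (slices u τ) n k.succ) t :=
    differentiableAt_det fun _ _ => hu _ _
  exact (h1.const_mul _).fun_div (differentiableAt_casorati hu (n + 1)) h

/-- The time derivatives of the coefficients of the Darboux operator. -/
def darbouxCoeffDeriv (u : Fin (m + 1) → LatticeFn) (n : ℤ) (t : ℝ) (k : Fin (m + 1)) : ℂ :=
  deriv (fun τ => darbouxCoeff (slices u τ) n k) t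

theorem hasDerivAt_darboux (hu : ∀ a n, DifferentiableAt ℝ (u a n) t) {n : ℤ}
    (h : casorati (slices u t) (n + 1) ≠ 0) {ψ : LatticeFn} {dψ : ℤ → ℂ}
    (hψ : ∀ n, HasDerivAt (ψ n) (dψ n) t) :
    HasDerivAt (fun τ => darboux (slices u τ) (slice ψ τ) n)
      (darboux (slices u t) dψ n + windowSum (darbouxCoeffDeriv u n t) (n + 1) (slice ψ t)) t := by
  simp only [darboux_apply, slice_apply, windowSum_apply]
  have h1 : HasDerivAt (fun τ => ∑ k : Fin (m + 1),
      darbouxCoeff (slices u τ) n k * ψ (n + 1 + ((k : ℕ) : ℤ)) τ)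
      (∑ k : Fin (m + 1), (darbouxCoeffDeriv u n t k * ψ (n + 1 + ((k : ℕ) : ℤ)) t
        + darbouxCoeff (slices u t) n k * dψ (n + 1 + ((k : ℕ) : ℤ)))) t :=
    HasDerivAt.fun_sum fun k _ =>
      (differentiableAt_darbouxCoeff hu h k).hasDerivAt.fun_mul (hψ _)
  refine ((hψ n).fun_add h1).congr_deriv ?_
  rw [Finset.sum_add_distrib]
  ring

variable {κ : Type} [Fintype κ]

/-- A family of columns at time `t`, with rows `s` for the sources, from which a Darboux
transformation can be made: it is invariant under `L` and evolves by the Lax pair up to linear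
combinations. -/
structure DarbouxColumnsAt (S : TodaFields κ) (u : Fin (m + 1) → LatticeFn)
    (s : κ → Fin (m + 1) → ℤ → ℂ) (t : ℝ) : Prop where
  sum : ∀ j a, (slice (u a) t, s j a) ∈ sumPairs (slice (S.φm j) t)
  row : ∀ a, ∃ c : Fin (m + 1) → ℂ,
    (∀ n, S.L (u a) n t = ∑ b, c b * u b n t) ∧
    ∀ j n, ∑ b, c b * s j b n - S.ev j * s j a n =
      concomitant (slice S.v t) (slice (S.φm j) t) n (slice (u a) t)
  time : ∀ a, ∃ c : Fin (m + 1) → ℂ, ∀ n, HasDerivAt (u a n)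
    (-(S.v (n + 1) t * u a (n + 1) t) + ∑ j, S.φp j n t * s j a n - ∑ b, c b * u b n t) t

namespace DarbouxColumnsAt

variable {S : TodaFields κ} {s : κ → Fin (m + 1) → ℤ → ℂ}

theorem differentiableAt (hu : DarbouxColumnsAt S u s t) (a : Fin (m + 1)) (n : ℤ) :
    DifferentiableAt ℝ (u a n) t := by
  obtain ⟨c, hc⟩ := hu.time a
  exact (hc n).differentiableAt

theorem rowCompatible (hu : DarbouxColumnsAt S u s t) (j : κ) :
    RowCompatible (slices u t) (slice S.v t) (slice S.p t) (slice (S.φm j) t) (S.ev j) (s j) := by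
  intro a
  obtain ⟨c, h1, h2⟩ := hu.row a
  refine ⟨c, ?_, h2 j⟩
  funext n
  have := h1 n
  simpa [slices_apply] using! this

theorem invariant (hu : DarbouxColumnsAt S u s t) (a : Fin (m + 1)) :
    ∃ c : Fin (m + 1) → ℂ, jacobiOp (slice S.v t) (slice S.p t) (slices u t a) =
      ∑ b, c b • slices u t b := by
  obtain ⟨c, h1, h2⟩ := hu.row a
  refine ⟨c, ?_⟩
  funext n
  have := h1 n
  simpa [slices_apply] using! this

/-- The derivative of `T u_i = 0`, which holds at all times near `t` because the Casoratian stays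
nonzero. The combination of columns in the evolution of `u_i` drops out, since `T` kills it. -/
theorem windowSum_deriv (hu : DarbouxColumnsAt S u s t) {n : ℤ}
    (h : casorati (slices u t) (n + 1) ≠ 0) (i : Fin (m + 1)) :
    windowSum (darbouxCoeffDeriv u n t) (n + 1) (slices u t i) =
      darboux (slices u t) (mulShift (slice S.v t) (slices u t i)) n
        - ∑ j, darboux (slices u t) (mulSeq (slice (S.φp j) t) (s j i)) n := by
  obtain ⟨c, hc⟩ := hu.time i
  have h1 := hasDerivAt_darboux hu.differentiableAt h hc
  have h2 : (fun τ => darboux (slices u τ) (slice (u i) τ) n) =ᶠ[𝓝 t] fun _ => 0 := by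
    have := (differentiableAt_casorati hu.differentiableAt (n + 1)).continuousAt.eventually_ne h
    filter_upwards [this] with τ hτ
    exact darboux_self (slices u τ) hτ i
  have h3 := h1.unique ((hasDerivAt_const t (0 : ℂ)).congr_of_eventuallyEq h2)
  have h4 : (fun n => -(S.v (n + 1) t * u i (n + 1) t) + ∑ j, S.φp j n t * s j i n
      - ∑ b, c b * u b n t) = -mulShift (slice S.v t) (slices u t i)
      + ∑ j, mulSeq (slice (S.φp j) t) (s j i) - ∑ b, c b • slices u t b := by
    funext k
    simp [mulShift_apply, mulSeq_apply, slice_apply, slices_apply]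
  rw [h4, map_sub, map_add, map_neg, map_sum] at h3
  simp only [Pi.sub_apply, Pi.add_apply, Pi.neg_apply, Finset.sum_apply,
    darboux_finset_sum_self (slices u t) h c] at h3
  change windowSum _ _ (slice (u i) t) = _
  linear_combination h3

end DarbouxColumnsAt

/-- `S'` is the Darboux transform of `S` around `(n, t)`, with non-vanishing determinants at the
sites from `n - 1` to `n + 2`. -/
structure IsDarbouxTransformAt (S S' : TodaFields κ) (u : Fin (m + 1) → LatticeFn)
    (s : κ → Fin (m + 1) → ℤ → ℂ) (n : ℤ) (t : ℝ) : Prop where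
  ne : ∀ k, n - 1 ≤ k → k ≤ n + 2 → casorati (slices u t) k ≠ 0
  ev : ∀ j, S'.ev j = S.ev j
  v : ∀ k τ, S'.v k τ = S.v (k + (m + 1)) τ *
    (casorati (slices u τ) (k + 1) * casorati (slices u τ) (k - 1)) / casorati (slices u τ) k ^ 2
  p : ∀ k τ, S'.p k τ = S.p k τ + darbouxCoeff (slices u τ) k 0
    - darbouxCoeff (slices u τ) (k - 1) 0
  φp : ∀ j k, n - 1 ≤ k → k ≤ n + 1 → S'.φp j k t = darboux (slices u t) (slice (S.φp j) t) k
  φm : ∀ j k, S'.φm j k t = rowTransform (slices u t) (s j) k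

namespace IsDarbouxTransformAt

variable {S S' : TodaFields κ} {s : κ → Fin (m + 1) → ℤ → ℂ} {n : ℤ}

omit [Fintype κ] in
theorem v_succ (h : IsDarbouxTransformAt S S' u s n t) (k : ℤ) :
    slice S'.v t (k + 1) = slice S.v t (k + 1 + (m + 1)) *
      (casorati (slices u t) (k + 2) * casorati (slices u t) k) /
        casorati (slices u t) (k + 1) ^ 2 := by
  rw [slice_apply, h.v, slice_apply, show k + 1 + 1 = k + 2 by ring, add_sub_cancel_right]

theorem jacobiOp_darboux (h : IsDarbouxTransformAt S S' u s n t) (hu : DarbouxColumnsAt S u s t)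
    (ψ : ℤ → ℂ) :
    darboux (slices u t) (jacobiOp (slice S.v t) (slice S.p t) ψ) n =
      jacobiOp (slice S'.v t) (slice S'.p t) (darboux (slices u t) ψ) n :=
  darboux_jacobiOp (slices u t) (h.ne _ (by omega) (by omega)) (h.ne _ (by omega) (by omega))
    (h.ne _ (by omega) (by omega)) hu.invariant (h.v_succ n) (h.p n t) ψ

theorem L_transform (h : IsDarbouxTransformAt S S' u s n t) (hu : DarbouxColumnsAt S u s t)
    {lam : ℂ} {ψ ψ' : LatticeFn} (hψ : ∀ k, S.L ψ k t = lam * ψ k t)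
    (hψ' : ∀ k, n - 1 ≤ k → k ≤ n + 1 → ψ' k t = darboux (slices u t) (slice ψ t) k) :
    S'.L ψ' n t = lam * ψ' n t := by
  have h1 := h.jacobiOp_darboux hu (slice ψ t)
  have h2 : jacobiOp (slice S.v t) (slice S.p t) (slice ψ t) = lam • slice ψ t := by
    funext k
    exact hψ k
  rw [h2, map_smul, Pi.smul_apply, smul_eq_mul, jacobiOp_apply] at h1
  rw [TodaFields.L_eq, jacobiOp_apply, slice_apply ψ', slice_apply ψ', slice_apply ψ',
    hψ' _ (by omega) (by omega), hψ' _ (by omega) (by omega), hψ' _ (by omega) (by omega)]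
  exact h1.symm

theorem Lstar_transform (h : IsDarbouxTransformAt S S' u s n t) (hu : DarbouxColumnsAt S u s t)
    (j : κ) (hφ : ∀ k, S.Lstar (S.φm j) k t = S.ev j * S.φm j k t) :
    S'.Lstar (S'.φm j) n t = S'.ev j * S'.φm j n t := by
  have h1 := rowTransform_adjoint (slices u t) (v' := slice S'.v t) (p' := slice S'.p t)
    (n := n - 1) (h.ne _ (by omega) (by omega))
    (h.ne _ (by omega) (by omega)) (h.ne _ (by omega) (by omega)) (h.ne _ (by omega) (by omega))
    (fun k => by
      have := hφ (k + 1)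
      unfold TodaFields.Lstar at this
      rw [add_sub_cancel_right, show k + 1 + 1 = k + 2 by ring] at this
      exact this)
    (hu.sum j) (hu.rowCompatible j) (h.v_succ _) (h.v_succ _) (h.p _ t)
  rw [sub_add_cancel, show n - 1 + 2 = n + 1 by ring] at h1
  unfold TodaFields.Lstar
  rw [h.φm, h.φm, h.φm, h.ev]
  exact h1

theorem concomitant_transform (h : IsDarbouxTransformAt S S' u s n t)
    (hu : DarbouxColumnsAt S u s t) (j : κ) {lam : ℂ} {ψ ψ' : LatticeFn}
    (hψ : ∀ k, S.L ψ k t = lam * ψ k t)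
    (hψ' : ∀ k, n - 1 ≤ k → k ≤ n + 1 → ψ' k t = darboux (slices u t) (slice ψ t) k)
    {i : ℤ} (hi : n - 1 ≤ i) (hi' : i ≤ n) :
    concomitant (slice S'.v t) (slice (S'.φm j) t) i (slice ψ' t) =
      rowOp (slices u t) (s j) i ((lam - S.ev j) • slice ψ t,
        fun k => concomitant (slice S.v t) (slice (S.φm j) t) k (slice ψ t)) := by
  have h1 := concomitant_darboux (slices u t) (h.ne _ (by omega) (by omega))
    (h.ne _ (by omega) (by omega)) (h.ne _ (by omega) (by omega)) (hu.sum j) (hu.rowCompatible j)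
    (h.v_succ i) (slice ψ t)
  have h2 : jacobiOp (slice S.v t) (slice S.p t) (slice ψ t) = lam • slice ψ t := by
    funext k
    exact hψ k
  rw [h2, ← sub_smul] at h1
  rw [← h1, concomitant_apply, concomitant_apply, slice_apply (S'.φm j), slice_apply (S'.φm j),
    h.φm, h.φm, slice_apply ψ', slice_apply ψ', hψ' _ (by omega) (by omega),
    hψ' _ (by omega) (by omega)]

/-- For the source itself `lam - S.ev j` is zero, so the row functional is applied to the zero
sequence and returns the old concomitant. -/
theorem concomitant_source (h : IsDarbouxTransformAt S S' u s n t)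
    (hu : DarbouxColumnsAt S u s t) (j : κ) (hφ : ∀ k, S.L (S.φp j) k t = S.ev j * S.φp j k t)
    {i : ℤ} (hi : n - 1 ≤ i) (hi' : i ≤ n) :
    concomitant (slice S'.v t) (slice (S'.φm j) t) i (slice (S'.φp j) t) =
      concomitant (slice S.v t) (slice (S.φm j) t) i (slice (S.φp j) t) := by
  rw [h.concomitant_transform hu j hφ (h.φp j) hi hi', sub_self, zero_smul, rowOp_apply]
  simp

theorem coeff_zero_deriv (h : IsDarbouxTransformAt S S' u s n t) (hu : DarbouxColumnsAt S u s t)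
    {i : ℤ} (hi : n - 1 ≤ i) (hi' : i ≤ n) :
    HasDerivAt (fun τ => darbouxCoeff (slices u τ) i 0)
      (S.v (i + 1) t + S.src (i + 1) i t - S'.v (i + 1) t - S'.src (i + 1) i t) t := by
  have h1 := evolution_coeff_zero (slices u t) (v' := slice S'.v t)
    (h.ne _ (by omega) (by omega)) (h.ne _ (by omega) (by omega))
    hu.sum (h.v_succ i) (hu.windowSum_deriv (h.ne _ (by omega) (by omega)))
  refine (differentiableAt_darbouxCoeff hu.differentiableAt
    (h.ne _ (by omega) (by omega)) 0).hasDerivAt.congr_deriv (h1.trans ?_)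
  simp only [TodaFields.src, h.φm, h.φp _ i (by omega) (by omega)]
  rfl

theorem coeff_last_deriv (h : IsDarbouxTransformAt S S' u s n t) (hu : DarbouxColumnsAt S u s t)
    {i : ℤ} (hi : n - 1 ≤ i) (hi' : i ≤ n) :
    HasDerivAt (fun τ => darbouxCoeff (slices u τ) i (Fin.last m))
      (darbouxCoeff (slices u t) i (Fin.last m) * ((S'.p i t + S'.src i i t)
        - (S.p (i + 1 + m) t + S.src (i + 1 + m) (i + 1 + m) t))) t := by
  have h1 := evolution_coeff_last (slices u t) (v' := slice S'.v t) (p' := slice S'.p t)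
    (h.ne _ (by omega) (by omega)) (h.ne _ (by omega) (by omega)) (h.ne _ (by omega) (by omega))
    hu.invariant hu.sum (h.v_succ i) (h.p i t)
    (hu.windowSum_deriv (h.ne _ (by omega) (by omega)))
  refine (differentiableAt_darbouxCoeff hu.differentiableAt
    (h.ne _ (by omega) (by omega)) _).hasDerivAt.congr_deriv (h1.trans ?_)
  simp only [TodaFields.src, h.φm, h.φp _ i (by omega) (by omega)]
  rfl

end IsDarbouxTransformAt

end

/-! ### The transformed Toda equations and Lax pair. -/

section

variable {m : ℕ} {u : Fin (m + 1) → LatticeFn} {t : ℝ} {κ : Type} [Fintype κ]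

theorem TodaFields.sum_concomitant (S : TodaFields κ) (n : ℤ) (t : ℝ) :
    ∑ j, concomitant (slice S.v t) (slice (S.φm j) t) n (slice (S.φp j) t) =
      S.v (n + 1) t * S.src n (n + 1) t - S.src (n + 1) n t := by
  simp only [concomitant_apply, slice_apply, TodaFields.src, Finset.mul_sum,
    Finset.sum_sub_distrib]
  congr 1 <;> exact Finset.sum_congr rfl fun j _ => by ring

omit [Fintype κ] in
theorem TodaFields.concomitant_step (S : TodaFields κ) {lam : ℂ} {φ ψ : LatticeFn} {μ : ℂ}
    (hφ : ∀ n, S.Lstar φ n t = lam * φ n t)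
    (hψ : ∀ n, S.L ψ n t = μ * ψ n t) (n : ℤ) :
    concomitant (slice S.v t) (slice φ t) (n + 1) (slice ψ t) =
      concomitant (slice S.v t) (slice φ t) n (slice ψ t) +
        (μ - lam) * (φ (n + 1) t * ψ (n + 1) t) := by
  have h1 := hφ (n + 1)
  unfold TodaFields.Lstar at h1
  rw [add_sub_cancel_right, show n + 1 + 1 = n + 2 by ring] at h1
  have h2 := concomitant_sub (slice S.v t) (slice S.p t) (slice φ t) (slice ψ t) lam n h1
  rw [← TodaFields.L_eq, hψ] at h2
  simp only [slice_apply] at h2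
  linear_combination h2

-- With a common eigenvalue nothing is left in Lagrange's identity, as for a Wronskian. For `φ_{j+}`
-- and `φ_{j-}` this makes the gauge term of the Lax pair independent of `n`.
omit [Fintype κ] in
theorem TodaFields.concomitant_const (S : TodaFields κ) {lam : ℂ} {φ ψ : LatticeFn}
    (hφ : ∀ n, S.Lstar φ n t = lam * φ n t)
    (hψ : ∀ n, S.L ψ n t = lam * ψ n t) (n : ℤ) :
    concomitant (slice S.v t) (slice φ t) n (slice ψ t) =
      concomitant (slice S.v t) (slice φ t) 0 (slice ψ t) := by
  have hstep : ∀ k, concomitant (slice S.v t) (slice φ t) (k + 1) (slice ψ t) =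
      concomitant (slice S.v t) (slice φ t) k (slice ψ t) := fun k => by
    rw [S.concomitant_step hφ hψ]
    ring
  induction n using Int.induction_on with
  | zero => rfl
  | succ k ih => rw [hstep, ih]
  | pred k ih => rw [← ih, ← hstep, sub_add_cancel]

/-- The time part of the Lax pair in terms of the concomitants. -/
theorem TodaFields.lax_time_eq (S : TodaFields κ) (lam : ℂ) (ψ : LatticeFn) (n : ℤ) (t : ℝ) :
    -(S.v (n + 1) t * ψ (n + 1) t
      + ∑ j, 1 / (lam - S.ev j) * S.v (n + 1) t * S.φm j n t *
          (S.φp j (n + 1) t * ψ n t - S.φp j n t * ψ (n + 1) t)) =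
    -(S.v (n + 1) t * ψ (n + 1) t)
      + ∑ j, S.φp j n t * ((lam - S.ev j)⁻¹ *
        concomitant (slice S.v t) (slice (S.φm j) t) n (slice ψ t))
      - (∑ j, (lam - S.ev j)⁻¹ *
        concomitant (slice S.v t) (slice (S.φm j) t) n (slice (S.φp j) t)) * ψ n t := by
  rw [neg_add, add_sub_assoc, Finset.sum_mul, ← Finset.sum_sub_distrib, ← Finset.sum_neg_distrib]
  congr 1
  refine Finset.sum_congr rfl fun j _ => ?_
  simp only [concomitant_apply, slice_apply]
  rw [one_div]
  ring

namespace IsDarbouxTransformAt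

variable {S S' : TodaFields κ} {s : κ → Fin (m + 1) → ℤ → ℂ} {n : ℤ}

/-- Near `t` the new `v` is the shifted old one times the ratio of two neighbouring last
coefficients of `T`, whose logarithmic derivatives are known. -/
theorem v_deriv (h : IsDarbouxTransformAt S S' u s n t) (hu : DarbouxColumnsAt S u s t)
    (hS : ∀ k, S.TLSCSAt k t) :
    HasDerivAt (S'.v n) (S'.v n t * (S'.p (n - 1) t + S'.src (n - 1) (n - 1) t)
      - S'.v n t * (S'.p n t + S'.src n n t)) t := by
  have d0 := h.coeff_last_deriv hu (i := n) (by omega) le_rfl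
  have d1 := h.coeff_last_deriv hu (i := n - 1) le_rfl (by omega)
  have dv := (hS (n + (m + 1))).v_eq
  have hne0 : casorati (slices u t) n ≠ 0 := h.ne _ (by omega) (by omega)
  have hne1 : casorati (slices u t) (n + 1) ≠ 0 := h.ne _ (by omega) (by omega)
  have heq : S'.v n =ᶠ[𝓝 t] fun τ => S.v (n + (m + 1)) τ *
      darbouxCoeff (slices u τ) (n - 1) (Fin.last m) /
        darbouxCoeff (slices u τ) n (Fin.last m) := by
    have c0 := (differentiableAt_casorati hu.differentiableAt n).continuousAt.eventually_ne hne0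
    have c1 := (differentiableAt_casorati hu.differentiableAt
      (n + 1)).continuousAt.eventually_ne hne1
    filter_upwards [c0, c1] with τ h0 h1
    have h2 : ((-1 : ℂ) ^ (m + 1)) ≠ 0 := pow_ne_zero _ (by norm_num)
    rw [h.v, darbouxCoeff_last, darbouxCoeff_last, sub_add_cancel]
    field_simp
  have hlast : darbouxCoeff (slices u t) n (Fin.last m) ≠ 0 := by
    rw [darbouxCoeff_last]
    exact div_ne_zero (mul_ne_zero (pow_ne_zero _ (by norm_num)) hne0) hne1
  rw [show n - 1 + 1 + (m : ℤ) = n + m by ring] at d1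
  rw [show n + 1 + (m : ℤ) = n + (m + 1) by ring] at d0
  rw [show n + ((m : ℤ) + 1) - 1 = n + m by ring] at dv
  refine (((dv.fun_mul d1).fun_div d0 hlast).congr_of_eventuallyEq heq).congr_deriv ?_
  rw [heq.eq_of_nhds]
  field_simp
  ring

theorem sum_concomitant_transform (h : IsDarbouxTransformAt S S' u s n t)
    (hu : DarbouxColumnsAt S u s t) (hS : ∀ k, S.TLSCSAt k t) {i : ℤ} (hi : n - 1 ≤ i)
    (hi' : i ≤ n) :
    S'.v (i + 1) t * S'.src i (i + 1) t - S'.src (i + 1) i t =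
      S.v (i + 1) t * S.src i (i + 1) t - S.src (i + 1) i t := by
  rw [← TodaFields.sum_concomitant, ← TodaFields.sum_concomitant]
  exact Finset.sum_congr rfl fun j _ =>
    h.concomitant_source hu j (fun k => (hS k).eigen j) hi hi'

/-- The derivatives of the first coefficients contain the products `φ_-(n+1) φ_+(n)`, while the
equation has `φ_-(n) φ_+(n+1)`. The invariance of the source concomitants exchanges one for the
other. -/
theorem p_deriv (h : IsDarbouxTransformAt S S' u s n t) (hu : DarbouxColumnsAt S u s t)
    (hS : ∀ k, S.TLSCSAt k t) :
    HasDerivAt (S'.p n) (S'.v n t * (1 + S'.src (n - 1) n t)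
      - S'.v (n + 1) t * (1 + S'.src n (n + 1) t)) t := by
  have d0 := h.coeff_zero_deriv hu (i := n) (by omega) le_rfl
  have d1 := h.coeff_zero_deriv hu (i := n - 1) le_rfl (by omega)
  have k0 := h.sum_concomitant_transform hu hS (i := n) (by omega) le_rfl
  have k1 := h.sum_concomitant_transform hu hS (i := n - 1) le_rfl (by omega)
  have dp := (hS n).p_eq
  have hfun : S'.p n = fun τ => S.p n τ + darbouxCoeff (slices u τ) n 0
      - darbouxCoeff (slices u τ) (n - 1) 0 := funext fun τ => h.p n τ
  rw [hfun]
  rw [sub_add_cancel] at d1 k1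
  refine ((dp.fun_add d0).fun_sub d1).congr_deriv ?_
  have hS1 : S.v n t * S.src (n - 1) n t - S.src n (n - 1) t =
      S.v (n + 1) t * S.src n (n + 1) t - S.src (n + 1) n t := by
    have e1 := S.sum_concomitant n t
    have e2 := S.sum_concomitant (n - 1) t
    rw [sub_add_cancel] at e2
    rw [← e1, ← e2]
    refine Finset.sum_congr rfl fun j _ => ?_
    rw [S.concomitant_const (fun k => (hS k).adjoint_eigen j) (fun k => (hS k).eigen j),
      S.concomitant_const (fun k => (hS k).adjoint_eigen j) (fun k => (hS k).eigen j) n]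
  linear_combination k0 - k1

theorem tlscsAt (h : IsDarbouxTransformAt S S' u s n t) (hu : DarbouxColumnsAt S u s t)
    (hS : ∀ k, S.TLSCSAt k t) : S'.TLSCSAt n t where
  v_eq := h.v_deriv hu hS
  p_eq := h.p_deriv hu hS
  eigen j := by
    rw [h.ev]
    exact h.L_transform hu (fun k => (hS k).eigen j) (h.φp j)
  adjoint_eigen j := h.Lstar_transform hu j fun k => (hS k).adjoint_eigen j

theorem laxAt (h : IsDarbouxTransformAt S S' u s n t) (hu : DarbouxColumnsAt S u s t)
    (hS : ∀ k, S.TLSCSAt k t) {lam : ℂ} (hlam : ∀ j, lam ≠ S.ev j) {ψ ψ' : LatticeFn}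
    (hψ : ∀ k, S.LaxAt lam ψ k t)
    (hψ' : ∀ k τ, casorati (slices u τ) (k + 1) ≠ 0 →
      ψ' k τ = darboux (slices u τ) (slice ψ τ) k) :
    S'.LaxAt lam ψ' n t := by
  have hψt : ∀ k, n - 1 ≤ k → k ≤ n + 1 → ψ' k t = darboux (slices u t) (slice ψ t) k :=
    fun k hk hk' => hψ' k t (h.ne _ (by omega) (by omega))
  refine ⟨h.L_transform hu (fun k => (hψ k).space) hψt, ?_⟩
  have hne1 : casorati (slices u t) (n + 1) ≠ 0 := h.ne _ (by omega) (by omega)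
  have hne2 : casorati (slices u t) (n + 2) ≠ 0 := h.ne _ (by omega) (by omega)
  have hev : ψ' n =ᶠ[𝓝 t] fun τ => darboux (slices u τ) (slice ψ τ) n := by
    filter_upwards [(differentiableAt_casorati hu.differentiableAt
      (n + 1)).continuousAt.eventually_ne hne1] with τ hτ
    exact hψ' n τ hτ
  -- By Lagrange's identity this is a sum of `φ_{j-} ψ`, and it is the one that occurs in the time
  -- part of the Lax pair.
  set σ : κ → ℤ → ℂ := fun j k => (lam - S.ev j)⁻¹ *
    concomitant (slice S.v t) (slice (S.φm j) t) k (slice ψ t) with hσ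
  -- The site 0 is arbitrary: these concomitants do not depend on `n`.
  set K : ℂ := ∑ j, (lam - S.ev j)⁻¹ *
    concomitant (slice S.v t) (slice (S.φm j) t) 0 (slice (S.φp j) t) with hK
  have hsub : ∀ j, lam - S.ev j ≠ 0 := fun j => sub_ne_zero.mpr (hlam j)
  have hpair : ∀ j, (slice ψ t, σ j) ∈ sumPairs (slice (S.φm j) t) := fun j k => by
    simp only [hσ]
    rw [S.concomitant_step (fun k => (hS k).adjoint_eigen j) (fun k => (hψ k).space)]
    have := hsub j
    simp only [slice_apply]
    field_simp
  have hd : ∀ k, HasDerivAt (ψ k) (-(S.v (k + 1) t * ψ (k + 1) t) + ∑ j, S.φp j k t * σ j k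
      - K * ψ k t) t := fun k => by
    refine (hψ k).time.congr_deriv ?_
    rw [S.lax_time_eq, hK]
    congr 2
    refine Finset.sum_congr rfl fun j _ => ?_
    rw [S.concomitant_const (fun k => (hS k).adjoint_eigen j) (fun k => (hS k).eigen j)]
  have h1 := hasDerivAt_darboux hu.differentiableAt hne1 hd
  rw [evolution_identity (slices u t) (v' := slice S'.v t) hne1 hne2
    hu.sum (h.v_succ n) (hu.windowSum_deriv hne1) hpair] at h1
  refine (h1.congr_of_eventuallyEq hev).congr_deriv ?_
  have h4 : (fun k => -(S.v (k + 1) t * ψ (k + 1) t) + ∑ j, S.φp j k t * σ j k - K * ψ k t) =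
      -mulShift (slice S.v t) (slice ψ t) + ∑ j, mulSeq (slice (S.φp j) t) (σ j)
        - K • slice ψ t := by
    funext k
    simp [mulShift_apply, mulSeq_apply, slice_apply]
  have hrow : ∀ j, (lam - S.ev j)⁻¹ *
      concomitant (slice S'.v t) (slice (S'.φm j) t) n (slice ψ' t) =
      rowOp (slices u t) (s j) n (slice ψ t, σ j) := fun j => by
    rw [h.concomitant_transform hu j (fun k => (hψ k).space) hψt (by omega) le_rfl]
    have : ((lam - S.ev j) • slice ψ t,
        fun k => concomitant (slice S.v t) (slice (S.φm j) t) k (slice ψ t)) =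
        (lam - S.ev j) • (slice ψ t, σ j) := by
      refine Prod.ext rfl ?_
      funext k
      have := hsub j
      simp only [hσ, Prod.smul_mk, Pi.smul_apply, smul_eq_mul]
      field_simp
    rw [this, map_smul, smul_eq_mul, inv_mul_cancel_left₀ (hsub j)]
  have hKK : ∑ j, (lam - S'.ev j)⁻¹ *
      concomitant (slice S'.v t) (slice (S'.φm j) t) n (slice (S'.φp j) t) = K :=
    Finset.sum_congr rfl fun j _ => by
      rw [h.ev, h.concomitant_source hu j (fun k => (hS k).eigen j) (by omega) le_rfl,
        S.concomitant_const (fun k => (hS k).adjoint_eigen j) (fun k => (hS k).eigen j)]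
  rw [S'.lax_time_eq, h4, hKK, map_sub, map_add, map_neg, map_sum, map_smul]
  simp only [Pi.sub_apply, Pi.add_apply, Pi.neg_apply, Finset.sum_apply, Pi.smul_apply,
    smul_eq_mul, h.ev, hrow]
  rw [hψt n (by omega) (by omega), hψt (n + 1) (by omega) le_rfl]
  simp only [h.φp _ n (by omega) (by omega), slice_apply]
  ring

end IsDarbouxTransformAt

end

/-! ### From lists of columns to indexed families. -/

section ListDeterminants

variable {M : ℕ}

theorem cas_ofFn (u : Fin M → LatticeFn) (n : ℤ) (t : ℝ) :
    cas (List.ofFn u) n t = casorati (slices u t) n := by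
  unfold cas casorati
  rw [← Matrix.det_submatrix_equiv_self (finCongr (List.length_ofFn (f := u)).symm)]
  congr 1
  ext j i
  simp [slices_apply]

theorem cas_cons_ofFn (ψ : LatticeFn) (u : Fin M → LatticeFn) (n : ℤ) (t : ℝ) :
    cas (ψ :: List.ofFn u) n t =
      casorati (Fin.cons (slice ψ t) (slices u t) : Fin (M + 1) → ℤ → ℂ) n := by
  rw [← List.ofFn_cons, cas_ofFn]
  congr 1
  funext i
  refine Fin.cases ?_ (fun i => ?_) i <;> rfl

theorem wcas_ofFn (u : Fin (M + 1) → LatticeFn) (n : ℤ) (t : ℝ) :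
    wcas (List.ofFn u) n t = casoratiMinor (slices u t) n 1 := by
  unfold wcas casoratiMinor
  rw [← Matrix.det_submatrix_equiv_self (finCongr (List.length_ofFn (f := u)).symm)]
  congr 1
  ext j i
  simp only [Matrix.submatrix_apply, Matrix.of_apply, finCongr_apply, List.get_eq_getElem,
    Fin.val_cast, List.getElem_ofFn, Fin.eta, slices_apply]
  congr 2
  refine Fin.cases ?_ (fun j => ?_) j
  · simp
  · rw [if_neg (by simp), ← Fin.succ_zero_eq_one, Fin.succ_succAbove_succ, Fin.zero_succAbove]
    simp

theorem List.eraseIdx_ofFn_succ {α : Type*} (u : Fin (M + 1) → α) (i : Fin (M + 1)) :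
    (List.ofFn u).eraseIdx (i : ℕ) = List.ofFn fun k => u (i.succAbove k) := by
  refine List.ext_getElem? fun k => ?_
  rw [List.getElem?_eraseIdx]
  by_cases hk : k < M
  · rw [List.getElem?_ofFn (i := k) (f := fun k => u (i.succAbove k)), dif_pos hk]
    split_ifs with h
    · rw [List.getElem?_ofFn, dif_pos (by omega)]
      congr 2
      rw [Fin.succAbove_of_castSucc_lt _ _ (by simpa [Fin.lt_def] using h)]
      rfl
    · rw [List.getElem?_ofFn, dif_pos (by omega)]
      congr 2
      rw [Fin.succAbove_of_le_castSucc _ _ (by simpa [Fin.le_def] using h)]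
      rfl
  · rw [List.getElem?_eq_none (l := List.ofFn fun k => u (i.succAbove k)) (by simpa using hk)]
    split_ifs with h
    · omega
    · rw [List.getElem?_eq_none (by simp; omega)]

theorem List.getElem?_flatten_ofFn {α : Type*} :
    ∀ {I : ℕ} {m : Fin I → ℕ} (f : (r : Fin I) → Fin (m r) → α) (r : Fin I) (k : Fin (m r)),
      (List.ofFn fun r => List.ofFn (f r)).flatten[(∑ s ∈ Finset.Iio r, m s) + (k : ℕ)]? =
        some (f r k)
  | 0, _, _, r, _ => r.elim0
  | I + 1, m, f, r, k => by
    have hIio : ∀ r : Fin (I + 1), ∑ s ∈ Finset.Iio r, m s = ∑ s, if s < r then m s else 0 := by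
      intro r
      rw [← Finset.sum_filter]
      congr 1
      ext s
      simp
    rw [List.ofFn_succ, List.flatten_cons]
    revert k
    refine Fin.cases (fun k => ?_) (fun r k => ?_) r
    · rw [hIio, List.getElem?_append_left (by simp)]
      simp
    · have hs : ∑ s ∈ Finset.Iio r.succ, m s = m 0 + ∑ s ∈ Finset.Iio r, m s.succ := by
        rw [hIio, Fin.sum_univ_succ, if_pos (Fin.succ_pos r)]
        congr 1
        rw [← Finset.sum_filter]
        refine Finset.sum_congr ?_ fun _ _ => rfl
        ext s
        simp
      rw [hs, List.getElem?_append_right (by simp; omega), List.length_ofFn,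
        show m 0 + ∑ s ∈ Finset.Iio r, m s.succ + (k : ℕ) - m 0 =
          ∑ s ∈ Finset.Iio r, m s.succ + (k : ℕ) by omega]
      exact List.getElem?_flatten_ofFn (fun r => f r.succ) r k

end ListDeterminants

/-- The `k`-th entry of a block of `M` columns made from a family `Y` with its values `y` of the
second family at `ω`. -/
def blockEntry (M : ℕ) (β ω : ℂ) (k : ℕ) (Y : ℂ → ℂ) (y : ℂ) : ℂ :=
  iteratedDeriv k Y ω + (if k + 1 = M then (-1) ^ (M - 1) * β * y else 0)

namespace GFDTData

variable {l I : ℕ} (D : GFDTData l I)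

/-- The index type of the columns. -/
abbrev Idx : Type := Fin l ⊕ (Σ r : Fin I, Fin (D.m r))

/-- The column with a given index. -/
def column {Z : Type} (a : Fin l → Z → ℝ → ℂ) (b e : Fin I → ℂ → Z → ℝ → ℂ) :
    D.Idx → Z → ℝ → ℂ
  | Sum.inl j => a j
  | Sum.inr x => fun z t => blockEntry (D.m x.1) (D.β x.1 t) (D.ω x.1) (x.2 : ℕ)
      (fun w => b x.1 w z t) (e x.1 (D.ω x.1) z t)

/-- The position of a column in the list of the columns. -/
def position : D.Idx → ℕ
  | Sum.inl j => j
  | Sum.inr x => D.offset x.1 + (x.2 : ℕ)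

/-- The numbering of the columns. -/
def idxEquiv : D.Idx ≃ Fin D.order :=
  ((Equiv.refl _).sumCongr finSigmaFinEquiv).trans finSumFinEquiv

theorem idxEquiv_val (x : D.Idx) : (D.idxEquiv x : ℕ) = D.position x := by
  rcases x with j | ⟨r, k⟩
  · rfl
  · change l + ((finSigmaFinEquiv ⟨r, k⟩ : Fin (∑ r, D.m r)) : ℕ) = D.offset r + (k : ℕ)
    rw [finSigmaFinEquiv_apply, offset, add_assoc]
    congr 2
    refine Finset.sum_bij (fun i _ => Fin.castLE r.2.le i) ?_ ?_ ?_ ?_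
    · intro i _
      exact Finset.mem_Iio.mpr i.2
    · intro i _ i' _ h
      exact Fin.castLE_injective _ h
    · intro s hs
      exact ⟨⟨s, Fin.lt_def.mp (Finset.mem_Iio.mp hs)⟩, Finset.mem_univ _, rfl⟩
    · intro i _
      rfl

theorem columns_length {Z : Type} (a : Fin l → Z → ℝ → ℂ) (b e : Fin I → ℂ → Z → ℝ → ℂ) :
    (D.columns a b e).length = D.order := by
  simp [columns, order, List.length_flatten, List.map_ofFn, Function.comp_def, List.sum_ofFn]

theorem columns_getElem? {Z : Type} (a : Fin l → Z → ℝ → ℂ) (b e : Fin I → ℂ → Z → ℝ → ℂ)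
    (x : D.Idx) : (D.columns a b e)[D.position x]? = some (D.column a b e x) := by
  rcases x with j | ⟨r, k⟩
  · rw [columns, position, List.getElem?_append_left (by simp), List.getElem?_ofFn, dif_pos j.2]
    rfl
  · rw [columns, position, offset, List.getElem?_append_right (by simp; omega), List.length_ofFn,
      show l + ∑ s ∈ Finset.Iio r, D.m s + (k : ℕ) - l = ∑ s ∈ Finset.Iio r, D.m s + (k : ℕ) by
        omega]
    exact List.getElem?_flatten_ofFn _ r k

variable {m : ℕ} (hm : D.order = m + 1)

/-- The numbering of the columns by `Fin (m + 1)`. -/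
def idx : D.Idx ≃ Fin (m + 1) := D.idxEquiv.trans (finCongr hm)

theorem idx_val (x : D.Idx) : (D.idx hm x : ℕ) = D.position x := by
  rw [← idxEquiv_val]
  simp [idx]

/-- The columns as a family. -/
def family {Z : Type} (a : Fin l → Z → ℝ → ℂ) (b e : Fin I → ℂ → Z → ℝ → ℂ) :
    Fin (m + 1) → Z → ℝ → ℂ := fun i => D.column a b e ((D.idx hm).symm i)

theorem columns_eq_ofFn {Z : Type} (a : Fin l → Z → ℝ → ℂ) (b e : Fin I → ℂ → Z → ℝ → ℂ) :
    D.columns a b e = List.ofFn (D.family hm a b e) := by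
  refine List.ext_getElem? fun i => ?_
  by_cases hi : i < m + 1
  · rw [List.getElem?_ofFn, dif_pos hi]
    have h := D.columns_getElem? a b e ((D.idx hm).symm ⟨i, hi⟩)
    rw [← D.idx_val hm, Equiv.apply_symm_apply] at h
    exact h
  · rw [List.getElem?_eq_none (by rw [columns_length, hm]; omega),
      List.getElem?_eq_none (by simpa using hi)]

/-- The family of the columns `q_j`, `∂^k h_r`. -/
def colFamily : Fin (m + 1) → LatticeFn := D.family hm D.q D.h D.g

theorem cols_eq : D.cols = List.ofFn (D.colFamily hm) := D.columns_eq_ofFn hm _ _ _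

theorem Del_eq (n : ℤ) (t : ℝ) : D.Del n t = casorati (slices (D.colFamily hm) t) n := by
  rw [Del, D.cols_eq hm, cas_ofFn]

theorem DelOf_eq (ψ : LatticeFn) (n : ℤ) (t : ℝ) :
    D.DelOf ψ n t =
      casorati (Fin.cons (slice ψ t) (slices (D.colFamily hm) t) : Fin (m + 2) → ℤ → ℂ) n := by
  rw [DelOf, D.cols_eq hm, cas_cons_ofFn]

theorem DelTilde_eq (n : ℤ) (t : ℝ) :
    D.DelTilde n t = casoratiMinor (slices (D.colFamily hm) t) n 1 := by
  rw [DelTilde, D.cols_eq hm, wcas_ofFn]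

theorem DelHat_eq (j : Fin l) (n : ℤ) (t : ℝ) :
    D.DelHat j n t = casorati
      (fun i => slices (D.colFamily hm) t ((D.idx hm (Sum.inl j)).succAbove i)) n := by
  have h : (j : ℕ) = (D.idx hm (Sum.inl j) : ℕ) := by rw [idx_val]; rfl
  rw [DelHat, D.cols_eq hm, h, List.eraseIdx_ofFn_succ, cas_ofFn]
  rfl

theorem DelHatGen_eq (r : Fin I) (k : Fin (D.m r)) (hk : (k : ℕ) + 1 = D.m r) (n : ℤ) (t : ℝ) :
    D.DelHatGen r n t = casorati
      (fun i => slices (D.colFamily hm) t ((D.idx hm (Sum.inr ⟨r, k⟩)).succAbove i)) n := by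
  have h : D.offset r + (D.m r - 1) = (D.idx hm (Sum.inr ⟨r, k⟩) : ℕ) := by
    rw [idx_val, position]
    simp only
    omega
  rw [DelHatGen, D.cols_eq hm, h, List.eraseIdx_ofFn_succ, cas_ofFn]
  rfl

theorem transform_eq (ψ : LatticeFn) {n : ℤ} {t : ℝ}
    (h : casorati (slices (D.colFamily hm) t) (n + 1) ≠ 0) :
    D.transform ψ n t = darboux (slices (D.colFamily hm) t) (slice ψ t) n := by
  rw [transform, D.DelOf_eq hm, D.Del_eq hm, casorati_cons_eq _ h, mul_div_cancel_right₀ _ h]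

variable {ι : Type} (S : TodaFields ι)

/-- The first rows of the columns that transform `φ_{i-}`. -/
def rowFamily (i : ι) : Fin (m + 1) → LatticeFn :=
  D.family hm (fun j => Sfun S i (D.Λ j) (D.q j))
    (fun r w => Sfun S i (D.lam r w) (D.h r w)) (fun r w => Sfun S i (D.lam r w) (D.g r w))

theorem DelBar_eq (i : ι) (n : ℤ) (t : ℝ) :
    D.DelBar S i n t =
      rowDet (slices (D.colFamily hm) t) (fun a => D.rowFamily hm S i a n t) n := by
  unfold DelBar rowDet
  have hlen : m + 1 = (D.wcols S i).length := by rw [wcols, columns_length, hm]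
  rw [← Matrix.det_submatrix_equiv_self (finCongr hlen)]
  congr 1
  ext k a
  simp only [Matrix.submatrix_apply, Matrix.of_apply, finCongr_apply, Fin.val_cast,
    List.get_eq_getElem]
  -- Stated for an arbitrary list, so that the equality of lists can be substituted under the
  -- dependent index bound.
  have h : ∀ (L : List (ℕ × ℤ → ℝ → ℂ)) (f : Fin (m + 1) → ℕ × ℤ → ℝ → ℂ) (hL : L = List.ofFn f)
      (hlen : (a : ℕ) < L.length), L[(a : ℕ)]'hlen = f a := by
    rintro L f rfl hlen
    rw [List.getElem_ofFn]
  rw [h (D.wcols S i) _ (D.columns_eq_ofFn hm _ _ _), rowFamily, colFamily, slices_apply, family, family,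
    family]
  generalize (D.idx hm).symm a = x
  rcases x with j | ⟨r, k'⟩
  · simp only [column, wvec]
  · simp only [column, wvec]
    split_ifs <;> rfl

end GFDTData

/-! ### Derivatives in the spectral parameter and blocks of columns. -/

/-- Differentiation in a real parameter commutes with the derivatives of a holomorphic function. -/
theorem hasDerivAt_iteratedDeriv {H H' : ℝ → ℂ → ℂ} {W : Set ℂ} (hW : IsOpen W) {ω : ℂ}
    (hω : ω ∈ W) {t : ℝ} (hH : ∀ τ, DifferentiableOn ℂ (H τ) W)
    (hH' : DifferentiableOn ℂ (H' t) W)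
    (hcont : ContinuousOn (fun z : ℝ × ℂ => H' z.1 z.2) (Set.univ ×ˢ W))
    (hd : ∀ τ, ∀ w ∈ W, HasDerivAt (fun τ => H τ w) (H' τ w) τ) (k : ℕ) :
    HasDerivAt (fun τ => iteratedDeriv k (H τ) ω) (iteratedDeriv k (H' t) ω) t := by
  -- Cauchy's formula on a fixed circle around `ω` inside `W` turns the `k`-th derivative into an
  -- integral, and the time derivative is taken under the integral sign.
  obtain ⟨R, hR, hball⟩ := Metric.nhds_basis_closedBall.mem_iff.mp (hW.mem_nhds hω)
  have hne : (2 * (Real.pi : ℂ) * Complex.I / (k.factorial : ℂ)) ≠ 0 :=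
    div_ne_zero Complex.two_pi_I_ne_zero (mod_cast k.factorial_ne_zero)
  set G : ℝ → ℂ := fun θ => deriv (circleMap ω R) θ * (1 / (circleMap ω R θ - ω) ^ (k + 1))
    with hG
  have hGc : Continuous G := by
    refine Continuous.mul ?_ ?_
    · have : deriv (circleMap ω R) = fun θ => circleMap 0 R θ * Complex.I :=
        funext fun θ => deriv_circleMap ω R θ
      rw [this]
      exact (continuous_circleMap 0 R).mul continuous_const
    · refine continuous_const.div (((continuous_circleMap ω R).sub continuous_const).pow _) ?_
      intro θ
      exact pow_ne_zero _ (sub_ne_zero.mpr (circleMap_ne_center hR.ne'))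
  have hmem : ∀ θ, circleMap ω R θ ∈ W := fun θ =>
    hball (circleMap_mem_closedBall ω hR.le θ)
  have hint : ∀ f : ℂ → ℂ, DifferentiableOn ℂ f W → iteratedDeriv k f ω =
      (2 * (Real.pi : ℂ) * Complex.I / (k.factorial : ℂ))⁻¹ *
        ∫ θ : ℝ in (0 : ℝ)..2 * Real.pi, G θ * f (circleMap ω R θ) := fun f hf => by
    have h := (hf.mono hball).circleIntegral_one_div_sub_center_pow_smul hR k
    rw [smul_eq_mul] at h
    rw [eq_inv_mul_iff_mul_eq₀ hne, ← h, circleIntegral]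
    refine intervalIntegral.integral_congr fun θ _ => ?_
    simp only [hG, smul_eq_mul]
    ring
  have hHc : ∀ τ, Continuous fun θ => G θ * H τ (circleMap ω R θ) := fun τ =>
    hGc.mul ((hH τ).continuousOn.comp_continuous (continuous_circleMap ω R) hmem)
  have hjoint : Continuous fun z : ℝ × ℝ => G z.2 * H' z.1 (circleMap ω R z.2) :=
    (hGc.comp continuous_snd).mul (hcont.comp_continuous
      (continuous_fst.prodMk ((continuous_circleMap ω R).comp continuous_snd))
      fun z => ⟨trivial, hmem _⟩)
  -- Joint continuity on a compact set supplies the constant bound for differentiation under the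
  -- integral.
  obtain ⟨C, hC⟩ := ((isCompact_closedBall t 1).prod
    (isCompact_uIcc (a := (0 : ℝ)) (b := 2 * Real.pi))).exists_bound_of_continuousOn
      hjoint.continuousOn
  have key := (intervalIntegral.hasDerivAt_integral_of_dominated_loc_of_deriv_le
    (μ := MeasureTheory.volume) (a := 0) (b := 2 * Real.pi) (x₀ := t)
    (F := fun τ θ => G θ * H τ (circleMap ω R θ))
    (F' := fun τ θ => G θ * H' τ (circleMap ω R θ)) (bound := fun _ => C)
    (s := Metric.closedBall t 1) (Metric.closedBall_mem_nhds t one_pos)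
    (Eventually.of_forall fun τ => (hHc τ).aestronglyMeasurable)
    ((hHc t).intervalIntegrable _ _)
    (hjoint.comp (Continuous.prodMk_right t)).aestronglyMeasurable
    (MeasureTheory.ae_of_all _ fun θ hθ τ hτ => hC (τ, θ) ⟨hτ, Set.uIoc_subset_uIcc hθ⟩)
    intervalIntegrable_const
    (MeasureTheory.ae_of_all _ fun θ _ τ _ => (hd τ _ (hmem θ)).const_mul (G θ))).2
  have hfun : (fun τ => iteratedDeriv k (H τ) ω) = fun τ =>
      (2 * (Real.pi : ℂ) * Complex.I / (k.factorial : ℂ))⁻¹ *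
        ∫ θ : ℝ in (0 : ℝ)..2 * Real.pi, G θ * H τ (circleMap ω R θ) :=
    funext fun τ => hint _ (hH τ)
  rw [hfun, hint _ hH']
  exact key.const_mul _

section BlockEntry

variable {M : ℕ} {β ω : ℂ} {k : ℕ} {Y Z : ℂ → ℂ} {y z : ℂ}

theorem blockEntry_congr (h : Y =ᶠ[𝓝 ω] Z) (h' : y = z) :
    blockEntry M β ω k Y y = blockEntry M β ω k Z z := by
  rw [blockEntry, blockEntry, h.iteratedDeriv_eq k, h']

theorem blockEntry_add (hY : AnalyticAt ℂ Y ω) (hZ : AnalyticAt ℂ Z ω) :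
    blockEntry M β ω k (fun w => Y w + Z w) (y + z) =
      blockEntry M β ω k Y y + blockEntry M β ω k Z z := by
  rw [blockEntry, blockEntry, blockEntry, iteratedDeriv_fun_add hY.contDiffAt hZ.contDiffAt]
  split_ifs <;> ring

theorem blockEntry_const_mul (c : ℂ) :
    blockEntry M β ω k (fun w => c * Y w) (c * y) = c * blockEntry M β ω k Y y := by
  rw [blockEntry, blockEntry, iteratedDeriv_const_mul_field]
  split_ifs <;> ring

theorem blockEntry_sub (hY : AnalyticAt ℂ Y ω) (hZ : AnalyticAt ℂ Z ω) :
    blockEntry M β ω k (fun w => Y w - Z w) (y - z) =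
      blockEntry M β ω k Y y - blockEntry M β ω k Z z := by
  rw [blockEntry, blockEntry, blockEntry, iteratedDeriv_fun_sub hY.contDiffAt hZ.contDiffAt]
  split_ifs <;> ring

theorem blockEntry_sum {α : Type*} (s : Finset α) {Y : α → ℂ → ℂ} {y : α → ℂ}
    (hY : ∀ i, AnalyticAt ℂ (Y i) ω) :
    blockEntry M β ω k (fun w => ∑ i ∈ s, Y i w) (∑ i ∈ s, y i) =
      ∑ i ∈ s, blockEntry M β ω k (Y i) (y i) := by
  simp only [blockEntry]
  rw [iteratedDeriv_fun_sum fun i _ => (hY i).contDiffAt, Finset.sum_add_distrib]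
  split_ifs
  · rw [Finset.mul_sum]
  · simp

/-- The coefficients of the Leibniz rule in a block. -/
def leibnizCoeff (θ : ℂ → ℂ) (ω : ℂ) (k i : ℕ) : ℂ :=
  (k.choose i : ℂ) * iteratedDeriv (k - i) θ ω

/-- The Leibniz matrix is lower triangular. The extra term with `β` sits only in the last entry,
which is reached only from itself, with coefficient `θ ω`; this is why the correction behaves like a
derivative column. -/
theorem blockEntry_mul {θ : ℂ → ℂ} (hθ : AnalyticAt ℂ θ ω) (hY : AnalyticAt ℂ Y ω) (hk : k < M) :
    blockEntry M β ω k (fun w => θ w * Y w) (θ ω * y) =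
      ∑ i : Fin M, leibnizCoeff θ ω k i * blockEntry M β ω i Y y := by
  have h1 : iteratedDeriv k (fun w => θ w * Y w) ω =
      ∑ i : Fin M, leibnizCoeff θ ω k i * iteratedDeriv i Y ω := by
    rw [Fin.sum_univ_eq_sum_range (fun i => leibnizCoeff θ ω k i * iteratedDeriv i Y ω) M]
    have : (fun w => θ w * Y w) = fun w => Y w * θ w := funext fun w => mul_comm _ _
    rw [this, iteratedDeriv_fun_mul hY.contDiffAt hθ.contDiffAt]
    have hsub : Finset.range (k + 1) ⊆ Finset.range M := Finset.range_subset_range.mpr hk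
    refine (Finset.sum_congr rfl fun i _ => ?_).trans (Finset.sum_subset hsub fun i _ hi => ?_)
    · rw [leibnizCoeff]
      ring
    · rw [leibnizCoeff, Nat.choose_eq_zero_of_lt (by simpa using hi)]
      simp
  simp only [blockEntry, mul_add, Finset.sum_add_distrib]
  rw [h1]
  congr 1
  split_ifs with h
  · rw [Finset.sum_eq_single ⟨k, hk⟩]
    · simp only [h, if_true, leibnizCoeff, Nat.choose_self, Nat.sub_self, iteratedDeriv_zero]
      push_cast
      ring
    · intro i _ hi
      rw [if_neg, mul_zero]
      intro hi'
      exact hi (Fin.ext (by simp only; omega))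
    · simp
  · symm
    refine Finset.sum_eq_zero fun i _ => ?_
    split_ifs with hi
    · rw [leibnizCoeff, Nat.choose_eq_zero_of_lt (by omega)]
      simp
    · rw [mul_zero]

theorem leibnizCoeff_self (θ : ℂ → ℂ) (ω : ℂ) (k : ℕ) : leibnizCoeff θ ω k k = θ ω := by
  simp [leibnizCoeff]

theorem leibnizCoeff_of_lt (θ : ℂ → ℂ) (ω : ℂ) {k i : ℕ} (h : k < i) :
    leibnizCoeff θ ω k i = 0 := by
  simp [leibnizCoeff, Nat.choose_eq_zero_of_lt h]

end BlockEntry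

/-! ### The sums `S_i` and the time part of the Lax pair as a linear operator. -/

theorem deltaInv_succ (u : LatticeFn) (n : ℤ) (t : ℝ) :
    deltaInv u (n + 1) t = deltaInv u n t + u n t := by
  unfold deltaInv
  rcases le_or_gt 0 n with h | h
  · have h1 : Finset.Ico 0 (n + 1) = insert n (Finset.Ico 0 n) := by
      ext k
      simp only [Finset.mem_Ico, Finset.mem_insert]
      omega
    rw [h1, Finset.sum_insert (by simp), Finset.Ico_eq_empty (by omega : ¬ n + 1 < 0),
      Finset.Ico_eq_empty (by omega : ¬ n < 0)]
    simp only [Finset.sum_empty]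
    ring
  · have h1 : Finset.Ico n 0 = insert n (Finset.Ico (n + 1) 0) := by
      ext k
      simp only [Finset.mem_Ico, Finset.mem_insert]
      omega
    rw [h1, Finset.sum_insert (by simp), Finset.Ico_eq_empty (by omega : ¬ 0 < n + 1),
      Finset.Ico_eq_empty (by omega : ¬ 0 < n)]
    simp only [Finset.sum_empty]
    ring

theorem deltaInv_zero (u : LatticeFn) (t : ℝ) : deltaInv u 0 t = 0 := by
  simp [deltaInv]

namespace GFDTData

theorem Sfun_succ {ι : Type} (S : TodaFields ι) (i : ι) (μ : ℂ) (ψ : LatticeFn) (n : ℤ) (t : ℝ) :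
    Sfun S i μ ψ (n + 1) t = Sfun S i μ ψ n t + S.φm i (n + 1) t * ψ (n + 1) t := by
  rw [Sfun, Sfun, deltaInv_succ]
  ring

/-- Both sides have the same increments by Lagrange's identity, and the boundary term in `S_i` is
the constant that makes them equal at `n = 0`. -/
theorem Sfun_eq {ι : Type} [Fintype ι] (S : TodaFields ι) {t : ℝ} (i : ι)
    (hi : ∀ n, S.Lstar (S.φm i) n t = S.ev i * S.φm i n t) {μ : ℂ} (hμ : μ ≠ S.ev i)
    {ψ : LatticeFn} (hψ : ∀ n, S.L ψ n t = μ * ψ n t) (n : ℤ) :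
    Sfun S i μ ψ n t =
      (μ - S.ev i)⁻¹ * concomitant (slice S.v t) (slice (S.φm i) t) n (slice ψ t) := by
  have hne : μ - S.ev i ≠ 0 := sub_ne_zero.mpr hμ
  have hstep : ∀ k, Sfun S i μ ψ (k + 1) t -
      (μ - S.ev i)⁻¹ * concomitant (slice S.v t) (slice (S.φm i) t) (k + 1) (slice ψ t) =
      Sfun S i μ ψ k t -
      (μ - S.ev i)⁻¹ * concomitant (slice S.v t) (slice (S.φm i) t) k (slice ψ t) := fun k => by
    rw [Sfun_succ, S.concomitant_step hi hψ]
    field_simp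
    ring
  have h0 : Sfun S i μ ψ 0 t -
      (μ - S.ev i)⁻¹ * concomitant (slice S.v t) (slice (S.φm i) t) 0 (slice ψ t) = 0 := by
    rw [Sfun, deltaInv_zero, concomitant_apply]
    simp only [slice_apply, zero_add]
    ring
  suffices h : Sfun S i μ ψ n t -
      (μ - S.ev i)⁻¹ * concomitant (slice S.v t) (slice (S.φm i) t) n (slice ψ t) = 0 from
    sub_eq_zero.mp h
  induction n using Int.induction_on with
  | zero => exact h0
  | succ k ih => rw [hstep, ih]
  | pred k ih => rw [← ih, ← hstep, sub_add_cancel]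

end GFDTData

namespace TodaFields

variable {ι : Type} [Fintype ι] (S : TodaFields ι)

/-- The right hand side of the time part of the Lax pair. -/
def laxRhs (lam : ℂ) (ψ : LatticeFn) : LatticeFn := fun n t =>
  -(S.v (n + 1) t * ψ (n + 1) t
      + ∑ j, 1 / (lam - S.ev j) * S.v (n + 1) t * S.φm j n t *
          (S.φp j (n + 1) t * ψ n t - S.φp j n t * ψ (n + 1) t))

/-- The gauge term by which the time part of the Lax pair differs from a linear operator. -/
def gaugeTerm (t : ℝ) (lam : ℂ) : ℂ :=
  ∑ j, (lam - S.ev j)⁻¹ * concomitant (slice S.v t) (slice (S.φm j) t) 0 (slice (S.φp j) t)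

/-- This is the shape required of columns in `DarbouxColumnsAt`: the spectral parameter enters only
through the sums and a scalar that does not depend on `n`. -/
theorem laxRhs_eq {t : ℝ} (hS : ∀ n, S.TLSCSAt n t) {lam : ℂ} (hlam : ∀ j, lam ≠ S.ev j)
    {ψ : LatticeFn} (hψ : ∀ n, S.L ψ n t = lam * ψ n t) (n : ℤ) :
    S.laxRhs lam ψ n t = -(S.v (n + 1) t * ψ (n + 1) t)
      + ∑ j, S.φp j n t * GFDTData.Sfun S j lam ψ n t - S.gaugeTerm t lam * ψ n t := by
  rw [laxRhs, S.lax_time_eq, gaugeTerm]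
  congr 2
  · exact Finset.sum_congr rfl fun j _ => by
      rw [GFDTData.Sfun_eq S j (fun k => (hS k).adjoint_eigen j) (hlam j) hψ]
  · refine Finset.sum_congr rfl fun j _ => ?_
    rw [S.concomitant_const (fun k => (hS k).adjoint_eigen j) (fun k => (hS k).eigen j)]

theorem laxRhs_add (lam c : ℂ) (a b : LatticeFn) (n : ℤ) (t : ℝ) :
    S.laxRhs lam (fun n t => a n t + c * b n t) n t =
      S.laxRhs lam a n t + c * S.laxRhs lam b n t := by
  have h : ∑ j, 1 / (lam - S.ev j) * S.v (n + 1) t * S.φm j n t *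
      (S.φp j (n + 1) t * (a n t + c * b n t) - S.φp j n t * (a (n + 1) t + c * b (n + 1) t)) =
      ∑ j, 1 / (lam - S.ev j) * S.v (n + 1) t * S.φm j n t *
        (S.φp j (n + 1) t * a n t - S.φp j n t * a (n + 1) t) +
      c * ∑ j, 1 / (lam - S.ev j) * S.v (n + 1) t * S.φm j n t *
        (S.φp j (n + 1) t * b n t - S.φp j n t * b (n + 1) t) := by
    rw [Finset.mul_sum, ← Finset.sum_add_distrib]
    exact Finset.sum_congr rfl fun j _ => by ring
  simp only [laxRhs]
  rw [h]
  ring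

variable {S}

theorem IsEigenfunction.add {lam : ℂ} {a b : LatticeFn} (ha : S.IsEigenfunction lam a)
    (hb : S.IsEigenfunction lam b) : S.IsEigenfunction lam (fun n t => a n t + b n t) := by
  refine ⟨ha.ne, fun n t => ⟨?_, ?_⟩⟩
  · have h1 := (ha.lax n t).space
    have h2 := (hb.lax n t).space
    unfold TodaFields.L at h1 h2 ⊢
    linear_combination h1 + h2
  · have h := S.laxRhs_add lam 1 a b n t
    simp only [one_mul] at h
    exact ((ha.lax n t).time.fun_add (hb.lax n t).time).congr_deriv h.symm

end TodaFields

/-- An analytic family of eigenfunctions. -/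
structure EigenFamily {ι : Type} [Fintype ι] (S : TodaFields ι) (W : Set ℂ) (lam : ℂ → ℂ)
    (b : ℂ → LatticeFn) : Prop where
  isOpen : IsOpen W
  lam_analytic : AnalyticOnNhd ℂ lam W
  eigen : ∀ w ∈ W, S.IsEigenfunction (lam w) (b w)
  analytic : ∀ n t, AnalyticOnNhd ℂ (fun w => b w n t) W
  cont : ∀ n, ContinuousOn (fun z : ℝ × ℂ => b z.2 n z.1) (Set.univ ×ˢ W)

namespace EigenFamily

variable {ι : Type} [Fintype ι] {S : TodaFields ι} {W : Set ℂ} {lam : ℂ → ℂ} {b : ℂ → LatticeFn}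

theorem add {b' : ℂ → LatticeFn} (h : EigenFamily S W lam b) (h' : EigenFamily S W lam b') :
    EigenFamily S W lam (fun w n t => b w n t + b' w n t) where
  isOpen := h.isOpen
  lam_analytic := h.lam_analytic
  eigen w hw := (h.eigen w hw).add (h'.eigen w hw)
  analytic n t := (h.analytic n t).add (h'.analytic n t)
  cont n := (h.cont n).add (h'.cont n)

theorem eventually_mem (h : EigenFamily S W lam b) {ω : ℂ} (hω : ω ∈ W) : ∀ᶠ w in 𝓝 ω, w ∈ W :=
  h.isOpen.mem_nhds hω

theorem analyticAt_inv (h : EigenFamily S W lam b) (j : ι) :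
    AnalyticOnNhd ℂ (fun w => (lam w - S.ev j)⁻¹) W := fun w hw =>
  ((h.lam_analytic w hw).sub analyticAt_const).fun_inv
    (sub_ne_zero.mpr ((h.eigen w hw).ne j))

theorem Sfun_eq (h : EigenFamily S W lam b) {t : ℝ} (hS : ∀ n, S.TLSCSAt n t) (j : ι) {w : ℂ}
    (hw : w ∈ W) (n : ℤ) : GFDTData.Sfun S j (lam w) (b w) n t =
      S.v (n + 1) t * S.φm j n t * ((lam w - S.ev j)⁻¹ * b w (n + 1) t)
        - S.φm j (n + 1) t * ((lam w - S.ev j)⁻¹ * b w n t) := by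
  rw [GFDTData.Sfun_eq S j (fun k => (hS k).adjoint_eigen j) ((h.eigen w hw).ne j)
    (fun k => ((h.eigen w hw).lax k t).space), concomitant_apply]
  simp only [slice_apply]
  ring

theorem analyticOnNhd_Sfun (h : EigenFamily S W lam b) {t : ℝ} (hS : ∀ n, S.TLSCSAt n t) (j : ι)
    (n : ℤ) : AnalyticOnNhd ℂ (fun w => GFDTData.Sfun S j (lam w) (b w) n t) W := by
  have h1 : AnalyticOnNhd ℂ (fun w =>
      S.v (n + 1) t * S.φm j n t * ((lam w - S.ev j)⁻¹ * b w (n + 1) t)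
        - S.φm j (n + 1) t * ((lam w - S.ev j)⁻¹ * b w n t)) W :=
    (analyticOnNhd_const.mul ((h.analyticAt_inv j).mul (h.analytic _ _))).sub
      (analyticOnNhd_const.mul ((h.analyticAt_inv j).mul (h.analytic _ _)))
  exact h1.congr h.isOpen fun w hw => (h.Sfun_eq hS j hw n).symm

theorem analyticOnNhd_gauge (h : EigenFamily S W lam b) (t : ℝ) :
    AnalyticOnNhd ℂ (fun w => S.gaugeTerm t (lam w)) W :=
  Finset.univ.analyticOnNhd_fun_sum fun j _ => (h.analyticAt_inv j).mul analyticOnNhd_const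

theorem analyticOnNhd_laxRhs (h : EigenFamily S W lam b) (n : ℤ) (t : ℝ) :
    AnalyticOnNhd ℂ (fun w => S.laxRhs (lam w) (b w) n t) W := by
  unfold TodaFields.laxRhs
  refine ((analyticOnNhd_const.mul (h.analytic _ _)).add
    (Finset.univ.analyticOnNhd_fun_sum fun j _ => ?_)).neg
  simp only [one_div]
  exact (((h.analyticAt_inv j).mul analyticOnNhd_const).mul analyticOnNhd_const).mul
    ((analyticOnNhd_const.mul (h.analytic _ _)).sub
      (analyticOnNhd_const.mul (h.analytic _ _)))

theorem continuousOn_laxRhs (h : EigenFamily S W lam b) (hv : ∀ n, Continuous (S.v n))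
    (hφp : ∀ i n, Continuous (S.φp i n)) (hφm : ∀ i n, Continuous (S.φm i n)) (n : ℤ) :
    ContinuousOn (fun z : ℝ × ℂ => S.laxRhs (lam z.2) (b z.2) n z.1) (Set.univ ×ˢ W) := by
  have hc : ∀ {f : ℝ → ℂ}, Continuous f →
      ContinuousOn (fun z : ℝ × ℂ => f z.1) (Set.univ ×ˢ W) := fun hf =>
    (hf.comp continuous_fst).continuousOn
  unfold TodaFields.laxRhs
  refine (((hc (hv _)).mul (h.cont _)).add (continuousOn_finsetSum _ fun j _ => ?_)).neg
  simp only [one_div]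
  have hinv : ContinuousOn (fun z : ℝ × ℂ => (lam z.2 - S.ev j)⁻¹) (Set.univ ×ˢ W) :=
    (h.analyticAt_inv j).continuousOn.comp continuousOn_snd fun z hz => hz.2
  exact ((hinv.mul (hc (hv _))).mul (hc (hφm _ _))).mul
    (((hc (hφp _ _)).mul (h.cont _)).sub ((hc (hφp _ _)).mul (h.cont _)))

/-- The `ω`-derivatives of an analytic family of eigenfunctions are differentiable in time. -/
theorem hasDerivAt_iteratedDeriv (h : EigenFamily S W lam b) (hv : ∀ n, Continuous (S.v n))
    (hφp : ∀ i n, Continuous (S.φp i n)) (hφm : ∀ i n, Continuous (S.φm i n))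
    {ρ : ℂ → ℂ} (hρ : AnalyticOnNhd ℂ ρ W) {ω : ℂ} (hω : ω ∈ W) (k : ℕ) (n : ℤ) (t : ℝ) :
    HasDerivAt (fun τ => iteratedDeriv k (fun w => ρ w * b w n τ) ω)
      (iteratedDeriv k (fun w => ρ w * S.laxRhs (lam w) (b w) n t) ω) t := by
  refine _root_.hasDerivAt_iteratedDeriv (H := fun τ w => ρ w * b w n τ)
    (H' := fun τ w => ρ w * S.laxRhs (lam w) (b w) n τ) h.isOpen hω
    (fun τ => (hρ.mul (h.analytic n τ)).differentiableOn)
    ((hρ.mul (h.analyticOnNhd_laxRhs n t)).differentiableOn) ?_ ?_ k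
  · exact (hρ.continuousOn.comp continuousOn_snd fun z hz => hz.2).mul
      (h.continuousOn_laxRhs hv hφp hφm n)
  · intro τ w hw
    exact ((h.eigen w hw).lax n τ).time.const_mul (ρ w)

end EigenFamily

/-! ### The columns of the transformation, with the new sources added in advance. -/

theorem DarbouxColumnsAt.of_equiv {m : ℕ} {X κ : Type} [Fintype X] [Fintype κ]
    {S : TodaFields κ} (e : X ≃ Fin (m + 1)) {U : X → LatticeFn} {s : κ → X → ℤ → ℂ} {t : ℝ}
    (hsum : ∀ j x n, s j x (n + 1) = s j x n + S.φm j (n + 1) t * U x (n + 1) t)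
    (hrow : ∀ x, ∃ c : X → ℂ,
      (∀ n, S.L (U x) n t = ∑ y, c y * U y n t) ∧
      ∀ j n, ∑ y, c y * s j y n - S.ev j * s j x n =
        concomitant (slice S.v t) (slice (S.φm j) t) n (slice (U x) t))
    (htime : ∀ x, ∃ c : X → ℂ, ∀ n, HasDerivAt (U x n)
      (-(S.v (n + 1) t * U x (n + 1) t) + ∑ j, S.φp j n t * s j x n - ∑ y, c y * U y n t) t) :
    DarbouxColumnsAt S (fun a => U (e.symm a)) (fun j a => s j (e.symm a)) t where
  sum j a n := hsum j (e.symm a) n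
  row a := by
    obtain ⟨c, h1, h2⟩ := hrow (e.symm a)
    refine ⟨fun b => c (e.symm b), fun n => ?_, fun j n => ?_⟩
    · rw [h1, ← e.symm.sum_comp]
    · rw [← h2, ← e.symm.sum_comp]
  time a := by
    obtain ⟨c, h⟩ := htime (e.symm a)
    refine ⟨fun b => c (e.symm b), fun n => (h n).congr_deriv ?_⟩
    rw [← e.symm.sum_comp (fun y => c y * U y n t)]

theorem sum_ite_family {X ι' : Type} [Fintype X] [DecidableEq X] [Fintype ι'] (f : ι' → X)
    (θ : ι' → ℂ) (Y : X → ℂ) :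
    ∑ y, (∑ i, if y = f i then θ i else 0) * Y y = ∑ i, θ i * Y (f i) := by
  simp only [Finset.sum_mul]
  rw [Finset.sum_comm]
  refine Finset.sum_congr rfl fun i _ => ?_
  rw [Finset.sum_eq_single (f i)]
  · simp
  · intro y _ hy
    rw [if_neg hy, zero_mul]
  · simp

namespace GFDTData

variable {l I : ℕ} {ι : Type} [Fintype ι]

/-- The hypotheses under which the transformation is made. -/
structure IsAdmissible (D : GFDTData l I) (S : TodaFields ι) (W : Fin I → Set ℂ) : Prop where
  tlscs : ∀ n t, S.TLSCSAt n t
  φp_diff : ∀ i n, Differentiable ℝ (S.φp i n)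
  φm_diff : ∀ i n, Differentiable ℝ (S.φm i n)
  F_eigen : ∀ j, S.IsEigenfunction (D.Λ j) (D.F j)
  G_eigen : ∀ j, S.IsEigenfunction (D.Λ j) (D.G j)
  α_diff : ∀ j, Differentiable ℝ (D.α j)
  cd_eq : ∀ (j : Fin l) t,
    D.c j t * D.d j t * D.α j t = (-1) ^ ((j : ℕ) + 1) * deriv (D.α j) t
  ω_mem : ∀ r, D.ω r ∈ W r
  f_family : ∀ r, EigenFamily S (W r) (D.lam r) (D.f r)
  g_family : ∀ r, EigenFamily S (W r) (D.lam r) (D.g r)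
  two_le : ∀ r, 2 ≤ D.m r
  β_diff : ∀ r, Differentiable ℝ (D.β r)

/-- The given system with the new eigenvalues added, as sources with `φ_- = 0`. -/
def extend (D : GFDTData l I) (S : TodaFields ι) : TodaFields (ι ⊕ (Fin l ⊕ Fin I)) where
  v := S.v
  p := S.p
  φp := Sum.elim S.φp (Sum.elim (fun j n t => D.c j t * D.F j n t)
    (fun r n t => -D.f r (D.ω r) n t))
  φm := Sum.elim S.φm fun _ _ _ => 0
  ev := Sum.elim S.ev (Sum.elim D.Λ (fun r => D.lam r (D.ω r)))

/-- The constant rows of the added sources. -/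
def newRow (D : GFDTData l I) (t : ℝ) : Fin l ⊕ Fin I → D.Idx → ℂ
  | Sum.inl j, Sum.inl j' => if j = j' then (-1) ^ (j : ℕ) * D.d j t else 0
  | Sum.inl _, Sum.inr _ => 0
  | Sum.inr _, Sum.inl _ => 0
  | Sum.inr r, Sum.inr x =>
    if r = x.1 ∧ (x.2 : ℕ) + 1 = D.m x.1 then (-1) ^ (D.m r - 1) * deriv (D.β r) t else 0

/-- The rows of all sources. -/
def allRows (D : GFDTData l I) (S : TodaFields ι) (t : ℝ) :
    ι ⊕ (Fin l ⊕ Fin I) → D.Idx → ℤ → ℂ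
  | Sum.inl i, x => fun n => D.column (fun j => Sfun S i (D.Λ j) (D.q j))
      (fun r w => Sfun S i (D.lam r w) (D.h r w)) (fun r w => Sfun S i (D.lam r w) (D.g r w)) x n t
  | Sum.inr y, x => fun _ => D.newRow t y x

omit [Fintype ι] in
theorem extend_L (D : GFDTData l I) (S : TodaFields ι) (ψ : LatticeFn) :
    (D.extend S).L ψ = S.L ψ := rfl

theorem extend_src (D : GFDTData l I) (S : TodaFields ι) (a b : ℤ) (t : ℝ) :
    (D.extend S).src a b t = S.src a b t := by
  simp [TodaFields.src, extend, Fintype.sum_sum_type]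

variable {D : GFDTData l I} {S : TodaFields ι} {W : Fin I → Set ℂ}

namespace IsAdmissible

theorem h_family (hD : D.IsAdmissible S W) (r : Fin I) :
    EigenFamily S (W r) (D.lam r) (D.h r) := (hD.f_family r).add (hD.g_family r)

theorem lam_analyticAt (hD : D.IsAdmissible S W) (r : Fin I) :
    AnalyticAt ℂ (D.lam r) (D.ω r) := (hD.f_family r).lam_analytic _ (hD.ω_mem r)

theorem h_analyticAt (hD : D.IsAdmissible S W) (r : Fin I) (n : ℤ) (t : ℝ) :
    AnalyticAt ℂ (fun w => D.h r w n t) (D.ω r) := (hD.h_family r).analytic n t _ (hD.ω_mem r)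

theorem Sfun_analyticAt (hD : D.IsAdmissible S W) (r : Fin I) (i : ι) (n : ℤ) (t : ℝ) :
    AnalyticAt ℂ (fun w => Sfun S i (D.lam r w) (D.h r w) n t) (D.ω r) :=
  (hD.h_family r).analyticOnNhd_Sfun (fun k => hD.tlscs k t) i n _ (hD.ω_mem r)

theorem q_L (hD : D.IsAdmissible S W) (j : Fin l) (n : ℤ) (t : ℝ) :
    S.L (D.q j) n t = D.Λ j * D.q j n t := by
  have h1 := ((hD.F_eigen j).lax n t).space
  have h2 := ((hD.G_eigen j).lax n t).space
  unfold TodaFields.L at h1 h2 ⊢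
  simp only [q]
  linear_combination h1 + D.α j t * h2

/-- The given system with the added sources is a solution. -/
theorem extend_tlscs (hD : D.IsAdmissible S W) (n : ℤ) (t : ℝ) : (D.extend S).TLSCSAt n t where
  v_eq := by
    rw [D.extend_src, D.extend_src]
    exact (hD.tlscs n t).v_eq
  p_eq := by
    rw [D.extend_src, D.extend_src]
    exact (hD.tlscs n t).p_eq
  eigen := by
    rintro (i | j | r)
    · exact (hD.tlscs n t).eigen i
    · have h := ((hD.F_eigen j).lax n t).space
      rw [extend_L]
      unfold TodaFields.L at h ⊢
      simp only [extend, Sum.elim_inr, Sum.elim_inl]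
      linear_combination D.c j t * h
    · have h := (((hD.f_family r).eigen _ (hD.ω_mem r)).lax n t).space
      rw [extend_L]
      unfold TodaFields.L at h ⊢
      simp only [extend, Sum.elim_inr]
      linear_combination -h
  adjoint_eigen := by
    rintro (i | y)
    · exact (hD.tlscs n t).adjoint_eigen i
    · simp [TodaFields.Lstar, extend]

/-- The relation between the rows and the columns in the blocks. -/
theorem lam_mul_Sfun {V : Set ℂ} {lam : ℂ → ℂ} {b : ℂ → LatticeFn}
    (h : EigenFamily S V lam b) {t : ℝ} (hS : ∀ n, S.TLSCSAt n t) (i : ι)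
    {w : ℂ} (hw : w ∈ V) (n : ℤ) :
    lam w * Sfun S i (lam w) (b w) n t = S.ev i * Sfun S i (lam w) (b w) n t +
      (S.v (n + 1) t * S.φm i n t * b w (n + 1) t - S.φm i (n + 1) t * b w n t) := by
  have hne : lam w - S.ev i ≠ 0 := sub_ne_zero.mpr ((h.eigen w hw).ne i)
  rw [h.Sfun_eq hS i hw]
  field_simp
  ring

theorem allRows_succ (hD : D.IsAdmissible S W) (t : ℝ) (j : ι ⊕ (Fin l ⊕ Fin I)) (x : D.Idx)
    (n : ℤ) : D.allRows S t j x (n + 1) = D.allRows S t j x n +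
      (D.extend S).φm j (n + 1) t * D.column D.q D.h D.g x (n + 1) t := by
  rcases j with i | y
  · rcases x with j | ⟨r, k⟩
    · exact Sfun_succ S i _ _ n t
    · simp only [allRows, column, extend, Sum.elim_inl, Sfun_succ]
      rw [blockEntry_add (hD.Sfun_analyticAt r i n t)
        (analyticAt_const.fun_mul (hD.h_analyticAt r _ t)), blockEntry_const_mul]
  · simp [allRows, extend]

/-- The matrix of multiplication by functions `c_j`, `θ_r(ω)` on the columns. -/
def actCoeff (D : GFDTData l I) (c : Fin l → ℂ) (θ : Fin I → ℂ → ℂ) (x : D.Idx) (y : D.Idx) : ℂ :=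
  match x with
  | Sum.inl j => ∑ _i : Unit, if y = Sum.inl j then c j else 0
  | Sum.inr x => ∑ i : Fin (D.m x.1), if y = Sum.inr ⟨x.1, i⟩ then
      leibnizCoeff (θ x.1) (D.ω x.1) (x.2 : ℕ) i else 0

theorem sum_actCoeff_inl (D : GFDTData l I) (c : Fin l → ℂ) (θ : Fin I → ℂ → ℂ) (j : Fin l)
    (Y : D.Idx → ℂ) : ∑ y, actCoeff D c θ (Sum.inl j) y * Y y = c j * Y (Sum.inl j) := by
  simp only [actCoeff]
  rw [sum_ite_family (fun _ : Unit => (Sum.inl j : D.Idx)) (fun _ => c j) Y]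
  simp

theorem sum_actCoeff_inr (D : GFDTData l I) (c : Fin l → ℂ) (θ : Fin I → ℂ → ℂ) (r : Fin I)
    (k : Fin (D.m r)) (Y : D.Idx → ℂ) : ∑ y, actCoeff D c θ (Sum.inr ⟨r, k⟩) y * Y y =
      ∑ i : Fin (D.m r), leibnizCoeff (θ r) (D.ω r) k i * Y (Sum.inr ⟨r, i⟩) := by
  simp only [actCoeff]
  rw [sum_ite_family (fun i : Fin (D.m r) => (Sum.inr ⟨r, i⟩ : D.Idx))
    (fun i => leibnizCoeff (θ r) (D.ω r) k i) Y]

/-- Multiplication by the eigenvalue acts on the columns by one matrix. For an old source the rows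
follow it up to the concomitant because `(λ - λ_i) S_i` is the concomitant, an identity that
survives `ω`-derivatives. For a new source the concomitant is zero, so its constant row must satisfy
the eigenvector equation of that matrix. -/
theorem column_row (hD : D.IsAdmissible S W) (t : ℝ) (x : D.Idx) : ∃ c : D.Idx → ℂ,
    (∀ n, (D.extend S).L (D.column D.q D.h D.g x) n t =
      ∑ y, c y * D.column D.q D.h D.g y n t) ∧
    ∀ j n, ∑ y, c y * D.allRows S t j y n - (D.extend S).ev j * D.allRows S t j x n =
      concomitant (slice (D.extend S).v t) (slice ((D.extend S).φm j) t) n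
        (slice (D.column D.q D.h D.g x) t) := by
  have hS : ∀ n, S.TLSCSAt n t := fun n => hD.tlscs n t
  refine ⟨actCoeff D D.Λ D.lam x, ?_, ?_⟩
  · intro n
    rw [extend_L]
    rcases x with j | ⟨r, k⟩
    · rw [sum_actCoeff_inl]
      exact hD.q_L j n t
    · rw [sum_actCoeff_inr]
      simp only [column, TodaFields.L]
      rw [← blockEntry_mul (hD.lam_analyticAt r) (hD.h_analyticAt r n t) k.2]
      have e1 : blockEntry (D.m r) (D.β r t) (D.ω r) k
          (fun w => D.lam r w * D.h r w n t) (D.lam r (D.ω r) * D.g r (D.ω r) n t) =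
          blockEntry (D.m r) (D.β r t) (D.ω r) k
          (fun w => S.v (n + 1) t * D.h r w (n + 1) t + S.p n t * D.h r w n t + D.h r w (n - 1) t)
          (S.v (n + 1) t * D.g r (D.ω r) (n + 1) t + S.p n t * D.g r (D.ω r) n t
            + D.g r (D.ω r) (n - 1) t) := by
        refine blockEntry_congr ?_ ?_
        · filter_upwards [(hD.h_family r).eventually_mem (hD.ω_mem r)] with w hw
          exact ((((hD.h_family r).eigen w hw).lax n t).space).symm
        · exact ((((hD.g_family r).eigen _ (hD.ω_mem r)).lax n t).space).symm
      rw [e1, blockEntry_add ((analyticAt_const.fun_mul (hD.h_analyticAt r _ t)).fun_add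
        (analyticAt_const.fun_mul (hD.h_analyticAt r _ t))) (hD.h_analyticAt r _ t),
        blockEntry_add (analyticAt_const.fun_mul (hD.h_analyticAt r _ t))
        (analyticAt_const.fun_mul (hD.h_analyticAt r _ t)), blockEntry_const_mul,
        blockEntry_const_mul]
  · intro j n
    rcases x with j' | ⟨r, k⟩
    · rw [sum_actCoeff_inl]
      rcases j with i | j | r
      · simp only [allRows, column, extend, Sum.elim_inl]
        have hne : D.Λ j' - S.ev i ≠ 0 := sub_ne_zero.mpr ((hD.F_eigen j').ne i)
        rw [Sfun_eq S i (fun k => (hS k).adjoint_eigen i) ((hD.F_eigen j').ne i)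
          (fun k => hD.q_L j' k t)]
        field_simp
      · simp only [allRows, newRow, extend, Sum.elim_inl, Sum.elim_inr, concomitant_apply,
          slice_apply]
        split_ifs with h
        · rw [h]
          ring
        · ring
      · simp [allRows, newRow, extend, concomitant_apply, slice_apply]
    · rw [sum_actCoeff_inr]
      rcases j with i | j | r'
      · simp only [allRows, column, extend, Sum.elim_inl, concomitant_apply, slice_apply]
        rw [← blockEntry_mul (hD.lam_analyticAt r) (hD.Sfun_analyticAt r i n t) k.2]
        have e1 : blockEntry (D.m r) (D.β r t) (D.ω r) k
            (fun w => D.lam r w * Sfun S i (D.lam r w) (D.h r w) n t)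
            (D.lam r (D.ω r) * Sfun S i (D.lam r (D.ω r)) (D.g r (D.ω r)) n t) =
            blockEntry (D.m r) (D.β r t) (D.ω r) k
            (fun w => S.ev i * Sfun S i (D.lam r w) (D.h r w) n t +
              (S.v (n + 1) t * S.φm i n t * D.h r w (n + 1) t - S.φm i (n + 1) t * D.h r w n t))
            (S.ev i * Sfun S i (D.lam r (D.ω r)) (D.g r (D.ω r)) n t +
              (S.v (n + 1) t * S.φm i n t * D.g r (D.ω r) (n + 1) t
                - S.φm i (n + 1) t * D.g r (D.ω r) n t)) := by
          refine blockEntry_congr ?_ ?_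
          · filter_upwards [(hD.h_family r).eventually_mem (hD.ω_mem r)] with w hw
            exact lam_mul_Sfun (hD.h_family r) hS i hw n
          · exact lam_mul_Sfun (hD.g_family r) hS i (hD.ω_mem r) n
        rw [e1, blockEntry_add (analyticAt_const.fun_mul (hD.Sfun_analyticAt r i n t))
          ((analyticAt_const.fun_mul (hD.h_analyticAt r _ t)).fun_sub
            (analyticAt_const.fun_mul (hD.h_analyticAt r _ t))), blockEntry_const_mul,
          blockEntry_sub (analyticAt_const.fun_mul (hD.h_analyticAt r _ t))
            (analyticAt_const.fun_mul (hD.h_analyticAt r _ t)), blockEntry_const_mul,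
          blockEntry_const_mul]
        ring
      · simp [allRows, newRow, extend, concomitant_apply, slice_apply]
      · simp only [allRows, newRow, extend, Sum.elim_inr, concomitant_apply, slice_apply]
        -- The row is supported on the last column of a block, which the triangular matrix reaches
        -- only from itself, with coefficient `λ(ω_r)`.
        have hsum : ∑ i : Fin (D.m r), leibnizCoeff (D.lam r) (D.ω r) k i *
            (if r' = r ∧ (i : ℕ) + 1 = D.m r then
              (-1) ^ (D.m r' - 1) * deriv (D.β r') t else 0) =
            D.lam r (D.ω r) * (if r' = r ∧ (k : ℕ) + 1 = D.m r then
              (-1) ^ (D.m r' - 1) * deriv (D.β r') t else 0) := by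
          rw [Finset.sum_eq_single k]
          · rw [leibnizCoeff_self]
          · intro i _ hi
            split_ifs with h
            · rw [leibnizCoeff_of_lt, zero_mul]
              have := k.2
              have hik : (i : ℕ) ≠ k := fun h => hi (Fin.ext h)
              omega
            · rw [mul_zero]
          · simp
        rw [hsum]
        split_ifs with h
        · rw [h.1]
          ring
        · ring

end IsAdmissible

end GFDTData

namespace GFDTData

variable {l I : ℕ} {ι : Type} [Fintype ι] {D : GFDTData l I} {S : TodaFields ι}
  {W : Fin I → Set ℂ}

namespace IsAdmissible

theorem v_continuous (hD : D.IsAdmissible S W) (n : ℤ) : Continuous (S.v n) :=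
  continuous_iff_continuousAt.mpr fun t => (hD.tlscs n t).v_eq.continuousAt

theorem v_differentiable (hD : D.IsAdmissible S W) (n : ℤ) : Differentiable ℝ (S.v n) :=
  fun t => (hD.tlscs n t).v_eq.differentiableAt

theorem hasDerivAt_h (hD : D.IsAdmissible S W) (r : Fin I) {ρ : ℂ → ℂ}
    (hρ : AnalyticOnNhd ℂ ρ (W r)) (k : ℕ) (n : ℤ) (t : ℝ) :
    HasDerivAt (fun τ => iteratedDeriv k (fun w => ρ w * D.h r w n τ) (D.ω r))
      (iteratedDeriv k (fun w => ρ w * S.laxRhs (D.lam r w) (D.h r w) n t) (D.ω r)) t :=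
  (hD.h_family r).hasDerivAt_iteratedDeriv hD.v_continuous
    (fun i n => (hD.φp_diff i n).continuous) (fun i n => (hD.φm_diff i n).continuous) hρ
    (hD.ω_mem r) k n t

theorem gauge_analyticAt (hD : D.IsAdmissible S W) (r : Fin I) (t : ℝ) :
    AnalyticAt ℂ (fun w => S.gaugeTerm t (D.lam r w)) (D.ω r) :=
  (hD.h_family r).analyticOnNhd_gauge t _ (hD.ω_mem r)

theorem blockEntry_laxRhs (hD : D.IsAdmissible S W) (r : Fin I) (k : Fin (D.m r)) (n : ℤ)
    (t : ℝ) :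
    blockEntry (D.m r) (D.β r t) (D.ω r) k (fun w => S.laxRhs (D.lam r w) (D.h r w) n t)
      (S.laxRhs (D.lam r (D.ω r)) (D.g r (D.ω r)) n t) =
    -(S.v (n + 1) t * D.column D.q D.h D.g (Sum.inr ⟨r, k⟩) (n + 1) t)
      + ∑ i, S.φp i n t * D.allRows S t (Sum.inl i) (Sum.inr ⟨r, k⟩) n
      - ∑ i : Fin (D.m r), leibnizCoeff (fun w => S.gaugeTerm t (D.lam r w)) (D.ω r) k i *
        D.column D.q D.h D.g (Sum.inr ⟨r, i⟩) n t := by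
  have hS : ∀ n, S.TLSCSAt n t := fun n => hD.tlscs n t
  have e1 : blockEntry (D.m r) (D.β r t) (D.ω r) k
      (fun w => S.laxRhs (D.lam r w) (D.h r w) n t)
      (S.laxRhs (D.lam r (D.ω r)) (D.g r (D.ω r)) n t) =
      blockEntry (D.m r) (D.β r t) (D.ω r) k
      (fun w => -S.v (n + 1) t * D.h r w (n + 1) t +
        ∑ i, S.φp i n t * Sfun S i (D.lam r w) (D.h r w) n t
        - S.gaugeTerm t (D.lam r w) * D.h r w n t)
      (-S.v (n + 1) t * D.g r (D.ω r) (n + 1) t +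
        ∑ i, S.φp i n t * Sfun S i (D.lam r (D.ω r)) (D.g r (D.ω r)) n t
        - S.gaugeTerm t (D.lam r (D.ω r)) * D.g r (D.ω r) n t) := by
    refine blockEntry_congr ?_ ?_
    · filter_upwards [(hD.h_family r).eventually_mem (hD.ω_mem r)] with w hw
      have he := (hD.h_family r).eigen w hw
      rw [S.laxRhs_eq hS he.ne (fun k => (he.lax k t).space), neg_mul]
    · have he := (hD.g_family r).eigen _ (hD.ω_mem r)
      rw [S.laxRhs_eq hS he.ne (fun k => (he.lax k t).space), neg_mul]
  have hsum : AnalyticAt ℂ (fun w => ∑ i, S.φp i n t * Sfun S i (D.lam r w) (D.h r w) n t)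
      (D.ω r) :=
    Finset.univ.analyticAt_fun_sum fun i _ =>
      analyticAt_const.fun_mul (hD.Sfun_analyticAt r i n t)
  rw [e1, blockEntry_sub ((analyticAt_const.fun_mul (hD.h_analyticAt r _ t)).fun_add hsum)
    ((hD.gauge_analyticAt r t).fun_mul (hD.h_analyticAt r n t)),
    blockEntry_add (analyticAt_const.fun_mul (hD.h_analyticAt r _ t)) hsum,
    blockEntry_const_mul,
    blockEntry_sum _ fun i => analyticAt_const.fun_mul (hD.Sfun_analyticAt r i n t),
    blockEntry_mul (θ := fun w => S.gaugeTerm t (D.lam r w)) (hD.gauge_analyticAt r t)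
      (hD.h_analyticAt r n t) k.2]
  simp only [blockEntry_const_mul]
  rw [neg_mul]
  rfl

theorem hasDerivAt_block (hD : D.IsAdmissible S W) (r : Fin I) (k : Fin (D.m r)) (n : ℤ)
    (t : ℝ) :
    HasDerivAt (D.column D.q D.h D.g (Sum.inr ⟨r, k⟩) n)
      (blockEntry (D.m r) (D.β r t) (D.ω r) k (fun w => S.laxRhs (D.lam r w) (D.h r w) n t)
        (S.laxRhs (D.lam r (D.ω r)) (D.g r (D.ω r)) n t)
      + if (k : ℕ) + 1 = D.m r then
          (-1) ^ (D.m r - 1) * deriv (D.β r) t * D.g r (D.ω r) n t else 0) t := by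
  have h1 := hD.hasDerivAt_h r (ρ := fun _ => 1) analyticOnNhd_const k n t
  simp only [one_mul] at h1
  have h2 : HasDerivAt (D.g r (D.ω r) n) (S.laxRhs (D.lam r (D.ω r)) (D.g r (D.ω r)) n t) t :=
    (((hD.g_family r).eigen _ (hD.ω_mem r)).lax n t).time
  have h3 : HasDerivAt (D.β r) (deriv (D.β r) t) t := (hD.β_diff r t).hasDerivAt
  by_cases hk : (k : ℕ) + 1 = D.m r
  · have h4 := h1.fun_add ((h3.const_mul ((-1 : ℂ) ^ (D.m r - 1))).fun_mul h2)
    have hfun : D.column D.q D.h D.g (Sum.inr ⟨r, k⟩) n = fun τ =>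
        iteratedDeriv k (fun w => D.h r w n τ) (D.ω r) +
          (-1) ^ (D.m r - 1) * D.β r τ * D.g r (D.ω r) n τ := by
      funext τ
      simp only [column, blockEntry, if_pos hk]
    rw [hfun]
    refine h4.congr_deriv ?_
    simp only [blockEntry, if_pos hk]
    ring
  · have hfun : D.column D.q D.h D.g (Sum.inr ⟨r, k⟩) n = fun τ =>
        iteratedDeriv k (fun w => D.h r w n τ) (D.ω r) := by
      funext τ
      simp only [column, blockEntry, if_neg hk, add_zero]
    rw [hfun]
    refine h1.congr_deriv ?_
    simp only [blockEntry, if_neg hk, add_zero]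

theorem hasDerivAt_q (hD : D.IsAdmissible S W) (j : Fin l) (n : ℤ) (t : ℝ) :
    HasDerivAt (D.q j n)
      (S.laxRhs (D.Λ j) (D.q j) n t + deriv (D.α j) t * D.G j n t) t := by
  have h1 : HasDerivAt (D.F j n) (S.laxRhs (D.Λ j) (D.F j) n t) t := ((hD.F_eigen j).lax n t).time
  have h2 : HasDerivAt (D.G j n) (S.laxRhs (D.Λ j) (D.G j) n t) t := ((hD.G_eigen j).lax n t).time
  have h3 : HasDerivAt (D.α j) (deriv (D.α j) t) t := (hD.α_diff j t).hasDerivAt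
  have h4 : S.laxRhs (D.Λ j) (D.q j) n t =
      S.laxRhs (D.Λ j) (D.F j) n t + D.α j t * S.laxRhs (D.Λ j) (D.G j) n t :=
    S.laxRhs_add (D.Λ j) (D.α j t) (D.F j) (D.G j) n t
  rw [h4]
  exact (h1.fun_add (h3.fun_mul h2)).congr_deriv (by ring)

theorem column_time (hD : D.IsAdmissible S W) (t : ℝ) (x : D.Idx) : ∃ c : D.Idx → ℂ, ∀ n,
    HasDerivAt (D.column D.q D.h D.g x n)
    (-((D.extend S).v (n + 1) t * D.column D.q D.h D.g x (n + 1) t)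
      + ∑ j, (D.extend S).φp j n t * D.allRows S t j x n
      - ∑ y, c y * D.column D.q D.h D.g y n t) t := by
  have hS : ∀ n, S.TLSCSAt n t := fun n => hD.tlscs n t
  rcases x with j | ⟨r, k⟩
  -- The new source with its row contributes `(-1)^j c_j d_j F_j = (-1)^j c_j d_j (q_j - α_j G_j)`.
  -- By the condition on `c_j d_j α_j` the second part is `α̇_j G_j`; the added coefficient removes
  -- the multiple of the column `q_j`.
  · refine ⟨fun y => actCoeff D (fun j => S.gaugeTerm t (D.Λ j))
      (fun r w => S.gaugeTerm t (D.lam r w)) (Sum.inl j) y +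
        ∑ _i : Unit, if y = Sum.inl j then (-1) ^ (j : ℕ) * (D.c j t * D.d j t) else 0,
      fun n => ?_⟩
    refine (hD.hasDerivAt_q j n t).congr_deriv ?_
    rw [S.laxRhs_eq hS (hD.F_eigen j).ne (fun k => hD.q_L j k t)]
    simp only [add_mul, Finset.sum_add_distrib]
    rw [sum_actCoeff_inl, sum_ite_family (fun _ : Unit => (Sum.inl j : D.Idx))
      (fun _ => (-1) ^ (j : ℕ) * (D.c j t * D.d j t))]
    simp only [Fintype.sum_sum_type, extend, Sum.elim_inl, Sum.elim_inr, allRows, newRow, column,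
      mul_ite, mul_zero, Finset.sum_ite_eq', Finset.mem_univ, if_true, Finset.sum_const_zero,
      Finset.univ_unique, Finset.sum_singleton]
    have hcd := hD.cd_eq j t
    rw [pow_succ] at hcd
    have hsq : ((-1 : ℂ) ^ (j : ℕ)) * (-1) ^ (j : ℕ) = 1 := by
      rw [← mul_pow]
      simp
    simp only [q]
    linear_combination D.G j n t * ((-1) ^ (j : ℕ)) * hcd
      + D.G j n t * deriv (D.α j) t * (-hsq)
  · have hk0 : 0 < D.m r := lt_of_lt_of_le two_pos (hD.two_le r)
    -- Here `β̇ g = β̇ (h - f)` up to sign: the part with `f` is the new source with its row, and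
    -- the part with `h` is a multiple of the first column of the block, hence the added coefficient
    -- at index 0.
    refine ⟨fun y => actCoeff D (fun j => S.gaugeTerm t (D.Λ j))
      (fun r w => S.gaugeTerm t (D.lam r w)) (Sum.inr ⟨r, k⟩) y +
        ∑ _i : Unit, if y = Sum.inr ⟨r, ⟨0, hk0⟩⟩ then
          (if (k : ℕ) + 1 = D.m r then -((-1) ^ (D.m r - 1) * deriv (D.β r) t) else 0) else 0,
      fun n => ?_⟩
    refine (hD.hasDerivAt_block r k n t).congr_deriv ?_
    rw [hD.blockEntry_laxRhs]
    simp only [add_mul, Finset.sum_add_distrib]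
    rw [sum_actCoeff_inr, sum_ite_family (fun _ : Unit => (Sum.inr ⟨r, ⟨0, hk0⟩⟩ : D.Idx))
      (fun _ => if (k : ℕ) + 1 = D.m r then -((-1) ^ (D.m r - 1) * deriv (D.β r) t) else 0)]
    -- As `m_r ≥ 2`, the first column of the block is not the last one and carries no `β` term.
    have h0 : D.column D.q D.h D.g (Sum.inr ⟨r, ⟨0, hk0⟩⟩) n t =
        D.f r (D.ω r) n t + D.g r (D.ω r) n t := by
      have := hD.two_le r
      simp only [column, blockEntry]
      rw [if_neg (by omega), add_zero, iteratedDeriv_zero]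
      rfl
    have hnew : ∑ y : Fin l ⊕ Fin I, (D.extend S).φp (Sum.inr y) n t *
        D.allRows S t (Sum.inr y) (Sum.inr ⟨r, k⟩) n =
        -D.f r (D.ω r) n t * (if (k : ℕ) + 1 = D.m r then
          (-1) ^ (D.m r - 1) * deriv (D.β r) t else 0) := by
      rw [Fintype.sum_sum_type]
      simp only [allRows, newRow, extend, Sum.elim_inr, Sum.elim_inl, mul_zero,
        Finset.sum_const_zero, zero_add]
      rw [Finset.sum_eq_single r]
      · simp
      · intro r' _ hr'
        rw [if_neg (fun h => hr' h.1), mul_zero]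
      · simp
    rw [Fintype.sum_sum_type, hnew]
    simp only [Finset.univ_unique, Finset.sum_singleton, h0]
    simp only [extend, Sum.elim_inl]
    split_ifs <;> ring

theorem darbouxColumnsAt (hD : D.IsAdmissible S W) {m : ℕ} (hm : D.order = m + 1) (t : ℝ) :
    DarbouxColumnsAt (D.extend S) (D.colFamily hm)
      (fun j a => D.allRows S t j ((D.idx hm).symm a)) t :=
  DarbouxColumnsAt.of_equiv (D.idx hm) (hD.allRows_succ t) (hD.column_row t) (hD.column_time t)

end IsAdmissible

/-! ### The new sources, and the identification with the Darboux transform. -/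

omit [Fintype ι] in
/-- The determinants of the new sources. -/
theorem rowTransform_newRow_inl {m : ℕ} (hm : D.order = m + 1) (j : Fin l) (n : ℤ) (t : ℝ) :
    rowTransform (slices (D.colFamily hm) t)
      (fun a => D.allRows S t (Sum.inr (Sum.inl j)) ((D.idx hm).symm a)) n =
      D.d j t * (D.DelHat j (n + 1) t / D.Del n t) := by
  rw [rowTransform, rowDet_eq, D.Del_eq hm, D.DelHat_eq hm,
    Finset.sum_eq_single (D.idx hm (Sum.inl j))]
  · have hsq : ((-1 : ℂ) ^ (j : ℕ)) * (-1) ^ (j : ℕ) = 1 := by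
      rw [← mul_pow]
      simp
    simp only [allRows, newRow, Equiv.symm_apply_apply, if_true, idx_val, position]
    rw [← mul_assoc ((-1 : ℂ) ^ (j : ℕ)), hsq, one_mul, mul_div_assoc]
  · intro a _ ha
    have hx : (D.idx hm).symm a ≠ Sum.inl j := fun h => ha (by rw [← h, Equiv.apply_symm_apply])
    generalize (D.idx hm).symm a = x at hx
    rcases x with j' | x
    · simp only [allRows, newRow]
      rw [if_neg fun h => hx (by rw [h])]
      ring
    · simp [allRows, newRow]
  · simp

-- The first row has a single nonzero entry, at position `offset + m_r - 1`. The sign of the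
-- position and the sign in `newRow` leave `(-1)^offset`.
omit [Fintype ι] in
theorem rowTransform_newRow_inr {m : ℕ} (hm : D.order = m + 1) (h2 : ∀ r, 2 ≤ D.m r) (r : Fin I)
    (n : ℤ) (t : ℝ) :
    rowTransform (slices (D.colFamily hm) t)
      (fun a => D.allRows S t (Sum.inr (Sum.inr r)) ((D.idx hm).symm a)) n =
      (-1) ^ D.offset r * deriv (D.β r) t * (D.DelHatGen r (n + 1) t / D.Del n t) := by
  have hlt : D.m r - 1 < D.m r := by have := h2 r; omega
  have hlast : D.m r - 1 + 1 = D.m r := by have := h2 r; omega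
  rw [rowTransform, rowDet_eq, D.Del_eq hm, D.DelHatGen_eq hm r ⟨D.m r - 1, hlt⟩ hlast,
    Finset.sum_eq_single (D.idx hm (Sum.inr ⟨r, ⟨D.m r - 1, hlt⟩⟩))]
  · have hsq : ((-1 : ℂ) ^ (D.m r - 1)) * (-1) ^ (D.m r - 1) = 1 := by
      rw [← mul_pow]
      simp
    simp only [allRows, newRow, Equiv.symm_apply_apply, hlast, and_self, if_true, idx_val,
      position, pow_add]
    linear_combination (-1) ^ D.offset r * deriv (D.β r) t *
      (casorati (fun i => slices (D.colFamily hm) t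
        ((D.idx hm (Sum.inr ⟨r, ⟨D.m r - 1, hlt⟩⟩)).succAbove i)) (n + 1) /
        casorati (slices (D.colFamily hm) t) n) * hsq
  · intro a _ ha
    have hx : (D.idx hm).symm a ≠ Sum.inr ⟨r, ⟨D.m r - 1, hlt⟩⟩ :=
      fun h => ha (by rw [← h, Equiv.apply_symm_apply])
    generalize (D.idx hm).symm a = x at hx
    rcases x with j' | ⟨r', k⟩
    · simp [allRows, newRow]
    · simp only [allRows, newRow]
      rw [if_neg]
      · ring
      · rintro ⟨rfl, hk⟩
        apply hx
        congr 2
        ext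
        simp only at hk ⊢
        omega
  · simp

theorem IsAdmissible.isDarbouxTransformAt (hD : D.IsAdmissible S W) {m : ℕ}
    (hm : D.order = m + 1) {n : ℤ} {t : ℝ} (hreg : D.RegularAt n t) :
    IsDarbouxTransformAt (D.extend S) (D.apply S) (D.colFamily hm)
      (fun j a => D.allRows S t j ((D.idx hm).symm a)) n t where
  ne k h1 h2 := by
    rw [← D.Del_eq hm]
    exact hreg k (Finset.mem_Icc.mpr ⟨h1, h2⟩)
  ev j := rfl
  v k τ := by
    simp only [apply, D.Del_eq hm, hm]
    push_cast
    rfl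
  p k τ := by
    rw [darbouxCoeff_zero, darbouxCoeff_zero, sub_add_cancel, ← D.Del_eq hm, ← D.Del_eq hm,
      ← D.DelTilde_eq hm, ← D.DelTilde_eq hm]
    simp only [apply, extend]
    ring
  -- `T` keeps the leading term `ψ(k)` even where the denominator is zero, so this agreement needs
  -- `D(k+1) ≠ 0`. The formulas for `v`, `p` and `φ_-` agree without such a condition.
  φp j k h1 h2 := by
    have hne : casorati (slices (D.colFamily hm) t) (k + 1) ≠ 0 := by
      rw [← D.Del_eq hm]
      exact hreg _ (Finset.mem_Icc.mpr ⟨by omega, by omega⟩)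
    rcases j with i | j | r
    · exact D.transform_eq hm _ hne
    · simp only [apply, extend, Sum.elim_inr, Sum.elim_inl]
      rw [D.transform_eq hm _ hne, ← smul_eq_mul, ← Pi.smul_apply, ← map_smul]
      rfl
    · simp only [apply, extend, Sum.elim_inr]
      rw [D.transform_eq hm _ hne, ← Pi.neg_apply, ← map_neg]
      rfl
  φm j k := by
    rcases j with i | j | r
    · rw [rowTransform, ← D.Del_eq hm]
      simp only [apply, Sum.elim_inl]
      rw [D.DelBar_eq hm]
      rfl
    · rw [rowTransform_newRow_inl hm]
      rfl
    · rw [rowTransform_newRow_inr hm hD.two_le]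
      rfl

end GFDTData

/-! ### Continuous logarithms and the relations between `x`, `v` and `p`. -/

/-- A continuous function without zeros on an open set of reals has a continuous logarithm. -/
theorem exists_continuousOn_log {O : Set ℝ} (hO : IsOpen O) {f : ℝ → ℂ} (hf : ContinuousOn f O)
    (h0 : ∀ s ∈ O, f s ≠ 0) :
    ∃ X : ℝ → ℂ, ContinuousOn X O ∧ ∀ s ∈ O, Complex.exp (X s) = f s := by
  -- The branch is chosen as a function of the component as a set, so all points of one component
  -- share it. A component is an interval, hence simply connected.
  have h1 : ∀ C : Set ℝ, ∃ Y : ℝ → ℂ, (∃ s ∈ O, C = connectedComponentIn O s) →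
      ContinuousOn Y C ∧ ∀ s ∈ C, Complex.exp (Y s) = f s := by
    intro C
    by_cases hC : ∃ s ∈ O, C = connectedComponentIn O s
    · obtain ⟨s, hs, rfl⟩ := hC
      have hsub := connectedComponentIn_subset O s
      have hconv : Convex ℝ (connectedComponentIn O s) :=
        (isPreconnected_connectedComponentIn (x := s) (F := O)).ordConnected.convex
      have hcontr : ContractibleSpace (connectedComponentIn O s) :=
        hconv.contractibleSpace ⟨s, mem_connectedComponentIn hs⟩
      have hsimply : IsSimplyConnected (connectedComponentIn O s) :=
        inferInstanceAs (SimplyConnectedSpace (connectedComponentIn O s))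
      obtain ⟨Y, hY1, hY2⟩ := Complex.exists_continuousOn_eqOn_exp_comp hsimply hO.connectedComponentIn
        (hf.mono hsub) (by
          rintro ⟨s, hs, hs'⟩
          exact h0 s (hsub hs) hs')
      exact ⟨Y, fun _ => ⟨hY1, hY2⟩⟩
    · exact ⟨0, fun h => (hC h).elim⟩
  choose Y hY using h1
  refine ⟨fun s => Y (connectedComponentIn O s) s, fun s hs => ?_, fun s hs => ?_⟩
  · have hc := (hY _ ⟨s, hs, rfl⟩).1
    have hmem : connectedComponentIn O s ∈ 𝓝 s :=
      hO.connectedComponentIn.mem_nhds (mem_connectedComponentIn hs)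
    refine ((hc.continuousAt hmem).congr ?_).continuousWithinAt
    filter_upwards [hmem] with τ hτ
    rw [connectedComponentIn_eq hτ]
  · exact (hY _ ⟨s, hs, rfl⟩).2 s (mem_connectedComponentIn hs)

/-- The derivative of a continuous logarithm. -/
theorem hasDerivAt_of_exp_eq {X f : ℝ → ℂ} {t : ℝ} {c : ℂ} (hX : ContinuousAt X t)
    (hexp : ∀ᶠ s in 𝓝 t, Complex.exp (X s) = f s) (hf : HasDerivAt f (f t * c) t) :
    HasDerivAt X c t := by
  have hft : Complex.exp (X t) = f t := hexp.self_of_nhds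
  have hne : f t ≠ 0 := hft ▸ Complex.exp_ne_zero _
  have h1 : HasDerivAt (fun s => X t + Complex.log (f s / f t)) c t := by
    have h2 := (hf.div_const (f t)).clog_real (by
      rw [div_self hne]
      exact Complex.one_mem_slitPlane)
    refine (h2.const_add (X t)).congr_deriv ?_
    field_simp
  refine h1.congr_of_eventuallyEq ?_
  have hnear : ∀ᶠ s in 𝓝 t, ‖X s - X t‖ < 1 := by
    filter_upwards [hX (Metric.ball_mem_nhds _ one_pos)] with s hs
    exact mem_ball_iff_norm.mp hs
  filter_upwards [hexp, hnear] with s hs hn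
  -- The increment stays inside the strip where the principal logarithm inverts the exponential.
  have him : |(X s - X t).im| < 1 := lt_of_le_of_lt (Complex.abs_im_le_norm _) hn
  have hpi := Real.pi_gt_three
  rw [abs_lt] at him
  rw [← hs, ← hft, ← Complex.exp_sub, Complex.log_exp (by linarith) (by linarith)]
  ring

namespace GFDTData

variable {l I : ℕ} {ι : Type} [Fintype ι] {D : GFDTData l I} {S : TodaFields ι}
  {W : Fin I → Set ℂ}

namespace IsAdmissible

variable {m : ℕ}

theorem col_differentiableAt (hD : D.IsAdmissible S W) (hm : D.order = m + 1) (a : Fin (m + 1))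
    (n : ℤ) (t : ℝ) : DifferentiableAt ℝ (D.colFamily hm a n) t :=
  (hD.darbouxColumnsAt hm t).differentiableAt a n

theorem Del_differentiableAt (hD : D.IsAdmissible S W) (hm : D.order = m + 1) (n : ℤ) (t : ℝ) :
    DifferentiableAt ℝ (D.Del n) t := by
  have : D.Del n = fun τ => casorati (slices (D.colFamily hm) τ) n := funext fun τ => D.Del_eq hm n τ
  rw [this]
  exact differentiableAt_casorati (fun a n => hD.col_differentiableAt hm a n t) n

theorem DelOf_differentiableAt (hD : D.IsAdmissible S W) (hm : D.order = m + 1) {ψ : LatticeFn}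
    {t : ℝ} (hψ : ∀ n, DifferentiableAt ℝ (ψ n) t) (n : ℤ) :
    DifferentiableAt ℝ (D.DelOf ψ n) t := by
  have : D.DelOf ψ n = fun τ => casorati
      (slices (Fin.cons ψ (D.colFamily hm) : Fin (m + 2) → LatticeFn) τ) n := by
    funext τ
    rw [D.DelOf_eq hm]
    congr 1
    funext i
    refine Fin.cases ?_ (fun i => ?_) i <;> rfl
  rw [this]
  refine differentiableAt_casorati (fun a n => ?_) n
  refine Fin.cases ?_ (fun i => ?_) a
  · exact hψ n
  · exact hD.col_differentiableAt hm i n t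

theorem regularAt_eventually (hD : D.IsAdmissible S W) (hm : D.order = m + 1) {n : ℤ} {t : ℝ}
    (h : D.RegularAt n t) : ∀ᶠ s in 𝓝 t, D.RegularAt n s := by
  unfold RegularAt
  rw [Filter.eventually_all_finset]
  intro k hk
  exact (hD.Del_differentiableAt hm k t).continuousAt.eventually_ne (h k hk)

theorem exists_halfLogSq (hD : D.IsAdmissible S W) (hm : D.order = m + 1) :
    ∃ X : LatticeFn, ∀ n t, D.RegularAt n t → D.IsHalfLogSqAt X n t := by
  have hcont : ∀ k, Continuous (D.Del k) := fun k =>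
    continuous_iff_continuousAt.mpr fun t => (hD.Del_differentiableAt hm k t).continuousAt
  have hO : ∀ k, IsOpen {s | D.Del k s ≠ 0 ∧ D.Del (k + 1) s ≠ 0} := fun k =>
    (isOpen_ne_fun (hcont k) continuous_const).inter
      (isOpen_ne_fun (hcont (k + 1)) continuous_const)
  have hX : ∀ k, ∃ X : ℝ → ℂ, ContinuousOn X {s | D.Del k s ≠ 0 ∧ D.Del (k + 1) s ≠ 0} ∧
      ∀ s ∈ {s | D.Del k s ≠ 0 ∧ D.Del (k + 1) s ≠ 0},
        Complex.exp (X s) = D.Del k s / D.Del (k + 1) s := fun k =>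
    exists_continuousOn_log (hO k)
      ((hcont k).continuousOn.div (hcont (k + 1)).continuousOn fun s hs => hs.2)
      fun s hs => div_ne_zero hs.1 hs.2
  choose X hX1 hX2 using hX
  refine ⟨X, fun n t h => ⟨1, Or.inl rfl, fun k hk => ?_⟩⟩
  rw [Finset.mem_Icc] at hk
  have hmem : t ∈ {s | D.Del k s ≠ 0 ∧ D.Del (k + 1) s ≠ 0} :=
    ⟨h k (Finset.mem_Icc.mpr ⟨by omega, by omega⟩),
      h (k + 1) (Finset.mem_Icc.mpr ⟨by omega, by omega⟩)⟩
  filter_upwards [(hO k).mem_nhds hmem] with s hs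
  exact ⟨(hX1 k).continuousAt ((hO k).mem_nhds hs), by rw [hX2 k s hs, one_mul]⟩

theorem apply_tlscsAt (hD : D.IsAdmissible S W) (hm : D.order = m + 1) {n : ℤ} {t : ℝ}
    (h : D.RegularAt n t) : (D.apply S).TLSCSAt n t :=
  (hD.isDarbouxTransformAt hm h).tlscsAt (hD.darbouxColumnsAt hm t) fun k => hD.extend_tlscs k t

/-- An eigenfunction of the given system is one of the extended system as well, since the added
sources have `φ_- = 0`. -/
theorem apply_laxAt (hD : D.IsAdmissible S W) (hm : D.order = m + 1) {μ : ℂ} {ψ : LatticeFn}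
    (hψ : S.IsEigenfunction μ ψ) (hμ : ∀ j, μ ≠ (D.apply S).ev j) {n : ℤ} {t : ℝ}
    (h : D.RegularAt n t) : (D.apply S).LaxAt μ (D.transform ψ) n t := by
  refine (hD.isDarbouxTransformAt hm h).laxAt (hD.darbouxColumnsAt hm t)
    (fun k => hD.extend_tlscs k t) hμ (ψ := ψ) (fun k => ⟨(hψ.lax k t).space, ?_⟩)
    fun k τ hk => D.transform_eq hm ψ hk
  refine (hψ.lax k t).time.congr_deriv ?_
  rw [Fintype.sum_sum_type]
  simp [extend]

/-- The common sign `σ` cancels in the quotient of neighbouring sites. The second order form needs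
the relation also at `n + 1`. -/
theorem v_eq_exp {x X : LatticeFn} (hx : ∀ n t, S.PotentialAt x n t)
    {n : ℤ} {t : ℝ} (h : D.RegularAt n t) (hX : D.IsHalfLogSqAt X n t) {k : ℤ} (hk : n ≤ k)
    (hk' : k ≤ n + 1) :
    (D.apply S).v k t = Complex.exp (D.newX x X (k - 1) t - D.newX x X k t) := by
  obtain ⟨σ, hσ, hX⟩ := hX
  have h0 := (hX (k - 1) (Finset.mem_Icc.mpr ⟨by omega, by omega⟩)).self_of_nhds.2
  have h1 := (hX k (Finset.mem_Icc.mpr ⟨by omega, by omega⟩)).self_of_nhds.2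
  have d0 : D.Del (k - 1) t ≠ 0 := h _ (Finset.mem_Icc.mpr ⟨by omega, by omega⟩)
  have d1 : D.Del k t ≠ 0 := h _ (Finset.mem_Icc.mpr ⟨by omega, by omega⟩)
  have d2 : D.Del (k + 1) t ≠ 0 := h _ (Finset.mem_Icc.mpr ⟨by omega, by omega⟩)
  have hσ0 : σ ≠ 0 := by rcases hσ with rfl | rfl <;> simp
  rw [sub_add_cancel] at h0
  have hv := (hx (k + D.order) t).v_eq
  have hsplit : D.newX x X (k - 1) t - D.newX x X k t =
      (x (k + D.order - 1) t - x (k + D.order) t) + (X (k - 1) t - X k t) := by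
    simp only [newX]
    rw [show k - 1 + (D.order : ℤ) = k + D.order - 1 by ring]
    ring
  rw [hsplit, Complex.exp_add, ← hv, Complex.exp_sub, h0, h1]
  simp only [apply]
  field_simp

/-- Up to sign, `D/D^{(1)}` is the last coefficient of `T`, so the derivative of `X` is its
logarithmic derivative. The old terms in it, at the site `n + 1 + m = n + M`, cancel the derivative
of `x^{(M)}`. -/
theorem potentialAt (hD : D.IsAdmissible S W) (hm : D.order = m + 1) {x X : LatticeFn}
    (hx : ∀ n t, S.PotentialAt x n t) {n : ℤ} {t : ℝ} (h : D.RegularAt n t)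
    (hX : D.IsHalfLogSqAt X n t) : (D.apply S).PotentialAt (D.newX x X) n t := by
  refine ⟨v_eq_exp hx h hX le_rfl (by omega), ?_⟩
  obtain ⟨σ, hσ, hX⟩ := hX
  have hXn := hX n (Finset.mem_Icc.mpr ⟨by omega, by omega⟩)
  have hd := (hD.isDarbouxTransformAt hm h).coeff_last_deriv (hD.darbouxColumnsAt hm t)
    (i := n) (by omega) le_rfl
  rw [D.extend_src] at hd
  have hsq : ((-1 : ℂ) ^ (m + 1)) * (-1) ^ (m + 1) = 1 := by
    rw [← mul_pow]
    simp
  have hfun : ∀ τ, σ * (D.Del n τ / D.Del (n + 1) τ) =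
      σ * (-1) ^ (m + 1) * darbouxCoeff (slices (D.colFamily hm) τ) n (Fin.last m) := fun τ => by
    rw [darbouxCoeff_last, ← D.Del_eq hm, ← D.Del_eq hm]
    linear_combination -σ * (D.Del n τ / D.Del (n + 1) τ) * hsq
  have hXd := hasDerivAt_of_exp_eq (c := ((D.apply S).p n t + (D.apply S).src n n t)
      - (S.p (n + 1 + m) t + S.src (n + 1 + m) (n + 1 + m) t))
    hXn.self_of_nhds.1
    (hXn.mono fun s hs => hs.2.trans (hfun s))
    ((hd.const_mul (σ * (-1) ^ (m + 1))).congr_deriv (by simp only [extend]; ring))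
  have hxd := (hx (n + D.order) t).x_deriv
  have hidx : n + (D.order : ℤ) = n + 1 + m := by
    rw [hm]
    push_cast
    ring
  refine (hxd.fun_add hXd).congr_deriv ?_
  rw [hidx]
  ring

end IsAdmissible

end GFDTData

/-! ### Differentiability of the new sources and the second order form. -/

namespace GFDTData

variable {l I : ℕ} {ι : Type} [Fintype ι] {D : GFDTData l I} {S : TodaFields ι}
  {W : Fin I → Set ℂ}

namespace IsAdmissible

variable {m : ℕ}

theorem q_differentiableAt (hD : D.IsAdmissible S W) (j : Fin l) (n : ℤ) (t : ℝ) :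
    DifferentiableAt ℝ (D.q j n) t := (hD.hasDerivAt_q j n t).differentiableAt

theorem eigenfunction_differentiableAt {lam : ℂ} {ψ : LatticeFn} (h : S.IsEigenfunction lam ψ)
    (n : ℤ) (t : ℝ) : DifferentiableAt ℝ (ψ n) t := (h.lax n t).time.differentiableAt

theorem Sfun_differentiableAt (hD : D.IsAdmissible S W) (i : ι) {μ : ℂ} (hμ : μ ≠ S.ev i)
    {ψ : LatticeFn} (hψ : ∀ n t, S.L ψ n t = μ * ψ n t)
    (hψd : ∀ n t, DifferentiableAt ℝ (ψ n) t) (n : ℤ) (t : ℝ) :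
    DifferentiableAt ℝ (Sfun S i μ ψ n) t := by
  have : Sfun S i μ ψ n = fun τ => (μ - S.ev i)⁻¹ *
      (S.v (n + 1) τ * ψ (n + 1) τ * S.φm i n τ - ψ n τ * S.φm i (n + 1) τ) :=
    funext fun τ => Sfun_eq S i (fun k => (hD.tlscs k τ).adjoint_eigen i) hμ (fun k => hψ k τ) n
  rw [this]
  exact (((((hD.v_differentiable _ t).fun_mul (hψd _ t)).fun_mul (hD.φm_diff i _ t)).fun_sub
    ((hψd _ t).fun_mul (hD.φm_diff i _ t)))).const_mul _

/-- The closed form of `S_i` separates the factors in `t` from the family `(λ(ω) - λ_i)⁻¹ h(ω)`, to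
which `hasDerivAt_h` applies with this multiplier. -/
theorem rowFamily_differentiableAt (hD : D.IsAdmissible S W) (hm : D.order = m + 1) (i : ι)
    (a : Fin (m + 1)) (n : ℤ) (t : ℝ) : DifferentiableAt ℝ (D.rowFamily hm S i a n) t := by
  unfold rowFamily family
  generalize (D.idx hm).symm a = x
  rcases x with j | ⟨r, k⟩
  · exact hD.Sfun_differentiableAt i ((hD.F_eigen j).ne i) (hD.q_L j)
      (hD.q_differentiableAt j) n t
  · have hfam := hD.h_family r
    have hρ : AnalyticOnNhd ℂ (fun w => (D.lam r w - S.ev i)⁻¹) (W r) := hfam.analyticAt_inv i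
    have h1 : ∀ τ, iteratedDeriv k (fun w => Sfun S i (D.lam r w) (D.h r w) n τ) (D.ω r) =
        S.v (n + 1) τ * S.φm i n τ *
          iteratedDeriv k (fun w => (D.lam r w - S.ev i)⁻¹ * D.h r w (n + 1) τ) (D.ω r)
        - S.φm i (n + 1) τ *
          iteratedDeriv k (fun w => (D.lam r w - S.ev i)⁻¹ * D.h r w n τ) (D.ω r) := fun τ => by
      have e : (fun w => Sfun S i (D.lam r w) (D.h r w) n τ) =ᶠ[𝓝 (D.ω r)] fun w =>
          S.v (n + 1) τ * S.φm i n τ * ((D.lam r w - S.ev i)⁻¹ * D.h r w (n + 1) τ)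
            - S.φm i (n + 1) τ * ((D.lam r w - S.ev i)⁻¹ * D.h r w n τ) := by
        filter_upwards [hfam.eventually_mem (hD.ω_mem r)] with w hw
        exact hfam.Sfun_eq (fun k => hD.tlscs k τ) i hw n
      have ha : ∀ k, AnalyticAt ℂ (fun w => (D.lam r w - S.ev i)⁻¹ * D.h r w k τ) (D.ω r) :=
        fun k => (hρ _ (hD.ω_mem r)).fun_mul (hD.h_analyticAt r k τ)
      rw [e.iteratedDeriv_eq,
        iteratedDeriv_fun_sub (analyticAt_const.fun_mul (ha _)).contDiffAt
          (analyticAt_const.fun_mul (ha _)).contDiffAt,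
        iteratedDeriv_const_mul_field, iteratedDeriv_const_mul_field]
    have h2 := fun k' => (hD.hasDerivAt_h r hρ k k' t).differentiableAt
    have hg := (hD.g_family r).eigen _ (hD.ω_mem r)
    have h3 : DifferentiableAt ℝ (Sfun S i (D.lam r (D.ω r)) (D.g r (D.ω r)) n) t :=
      hD.Sfun_differentiableAt i (hg.ne i) (fun n t => (hg.lax n t).space)
        (eigenfunction_differentiableAt hg) n t
    simp only [column, blockEntry, h1]
    refine DifferentiableAt.fun_add ((((hD.v_differentiable _ t).fun_mul
      (hD.φm_diff i _ t)).fun_mul (h2 _)).fun_sub ((hD.φm_diff i _ t).fun_mul (h2 _))) ?_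
    split_ifs
    · exact ((hD.β_diff r t).const_mul _).fun_mul h3
    · exact differentiableAt_const 0

theorem DelBar_differentiableAt (hD : D.IsAdmissible S W) (hm : D.order = m + 1) (i : ι) (n : ℤ)
    (t : ℝ) : DifferentiableAt ℝ (D.DelBar S i n) t := by
  have : D.DelBar S i n = fun τ =>
      rowDet (slices (D.colFamily hm) τ) (fun a => D.rowFamily hm S i a n τ) n :=
    funext fun τ => D.DelBar_eq hm S i n τ
  rw [this]
  refine differentiableAt_det fun k a => ?_
  simp only [Matrix.of_apply]
  split_ifs
  · exact hD.rowFamily_differentiableAt hm i a n t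
  · exact hD.col_differentiableAt hm a _ t

-- `D(q_j) = 0` by a repeated column. This brings the factor `α_j` into the product of the two new
-- sources, which then depends on `c_j` and `d_j` only through `c_j d_j α_j`; separately they need
-- not even be continuous.
omit [Fintype ι] in
theorem _root_.GFDTData.DelOf_F_eq (hm : D.order = m + 1) (j : Fin l) (n : ℤ) (t : ℝ) :
    D.DelOf (D.F j) n t = -(D.α j t * D.DelOf (D.G j) n t) := by
  have h0 : D.DelOf (D.q j) n t = 0 := by
    rw [D.DelOf_eq hm]
    refine Matrix.det_zero_of_column_eq (i := 0) (j := (D.idx hm (Sum.inl j)).succ)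
      (Fin.succ_ne_zero _).symm fun k => ?_
    simp only [Matrix.of_apply, Fin.cons_zero, Fin.cons_succ, slices_apply, colFamily, family,
      Equiv.symm_apply_apply, column, slice_apply]
  rw [D.DelOf_eq hm, casorati_cons] at h0 ⊢
  rw [D.DelOf_eq hm, casorati_cons, eq_neg_iff_add_eq_zero, ← h0, Finset.mul_sum,
    ← Finset.sum_add_distrib]
  refine Finset.sum_congr rfl fun k _ => ?_
  simp only [slice_apply, q]
  ring

theorem src_differentiableAt (hD : D.IsAdmissible S W) (hm : D.order = m + 1)
    (hα : ∀ j, Differentiable ℝ (deriv (D.α j))) (hβ : ∀ r, Differentiable ℝ (deriv (D.β r)))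
    {n : ℤ} {t : ℝ} (h : D.RegularAt n t) :
    DifferentiableAt ℝ ((D.apply S).src n n) t := by
  have d0 : D.Del n t ≠ 0 := h _ (Finset.mem_Icc.mpr ⟨by omega, by omega⟩)
  have d1 : D.Del (n + 1) t ≠ 0 := h _ (Finset.mem_Icc.mpr ⟨by omega, by omega⟩)
  have hDel := fun k => hD.Del_differentiableAt hm k t
  unfold TodaFields.src
  refine DifferentiableAt.fun_sum fun j _ => ?_
  rcases j with i | j | r
  · exact ((hD.DelBar_differentiableAt hm i n t).fun_div (hDel n) d0).fun_mul
      ((hD.DelOf_differentiableAt hm (fun k => hD.φp_diff i k t) n).fun_div (hDel _) d1)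
  · have hfun : (fun τ => (D.apply S).φm (Sum.inr (Sum.inl j)) n τ *
        (D.apply S).φp (Sum.inr (Sum.inl j)) n τ) = fun τ =>
        (-((-1) ^ ((j : ℕ) + 1) * deriv (D.α j) τ)) * (D.DelHat j (n + 1) τ / D.Del n τ) *
          (D.DelOf (D.G j) n τ / D.Del (n + 1) τ) := by
      funext τ
      simp only [apply, Sum.elim_inr, Sum.elim_inl, transform]
      rw [DelOf_F_eq hm, ← hD.cd_eq j τ]
      ring
    rw [hfun]
    have hHat : DifferentiableAt ℝ (D.DelHat j (n + 1)) t := by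
      have : D.DelHat j (n + 1) = fun τ => casorati (slices
          (fun i => D.colFamily hm ((D.idx hm (Sum.inl j)).succAbove i)) τ) (n + 1) :=
        funext fun τ => D.DelHat_eq hm j (n + 1) τ
      rw [this]
      exact differentiableAt_casorati (fun a k => hD.col_differentiableAt hm _ k t) _
    exact ((((hα j t).const_mul _).fun_neg).fun_mul (hHat.fun_div (hDel n) d0)).fun_mul
      ((hD.DelOf_differentiableAt hm
        (fun k => eigenfunction_differentiableAt (hD.G_eigen j) k t) n).fun_div (hDel _) d1)
  · have hlt : D.m r - 1 < D.m r := by have := hD.two_le r; omega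
    have hHat : DifferentiableAt ℝ (D.DelHatGen r (n + 1)) t := by
      have : D.DelHatGen r (n + 1) = fun τ => casorati (slices (fun i => D.colFamily hm
          ((D.idx hm (Sum.inr ⟨r, ⟨D.m r - 1, hlt⟩⟩)).succAbove i)) τ) (n + 1) :=
        funext fun τ => D.DelHatGen_eq hm r ⟨D.m r - 1, hlt⟩
          (by have := hD.two_le r; simp only; omega) (n + 1) τ
      rw [this]
      exact differentiableAt_casorati (fun a k => hD.col_differentiableAt hm _ k t) _
    have hf := (hD.f_family r).eigen _ (hD.ω_mem r)
    exact (((hβ r t).const_mul _).fun_mul (hHat.fun_div (hDel n) d0)).fun_mul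
      ((hD.DelOf_differentiableAt hm
        (fun k => eigenfunction_differentiableAt hf k t) n).fun_div (hDel _) d1).fun_neg

/-- Regularity and the choice of the determination persist near `t`, so `x_t = p + ∑ φ_+ φ_-` can be
differentiated: `p_t` comes from the new Toda equation, and `v` is rewritten by `v_eq_exp`. -/
theorem secondOrderAt (hD : D.IsAdmissible S W) (hm : D.order = m + 1) {x X : LatticeFn}
    (hx : ∀ n t, S.PotentialAt x n t)
    (hα : ∀ j, Differentiable ℝ (deriv (D.α j))) (hβ : ∀ r, Differentiable ℝ (deriv (D.β r)))
    {n : ℤ} {t : ℝ} (h : D.RegularAt n t) (hX : D.IsHalfLogSqAt X n t) :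
    (D.apply S).SecondOrderAt (D.newX x X) n t := by
  have hev : ∀ᶠ s in 𝓝 t, HasDerivAt (D.newX x X n)
      ((D.apply S).p n s + (D.apply S).src n n s) s := by
    have hXev : ∀ᶠ s in 𝓝 t, D.IsHalfLogSqAt X n s := by
      obtain ⟨σ, hσ, hX⟩ := hX
      have : ∀ᶠ s in 𝓝 t, ∀ k ∈ Finset.Icc (n - 1) (n + 1), ∀ᶠ s' in 𝓝 s,
          ContinuousAt (X k) s' ∧ Complex.exp (X k s') = σ * (D.Del k s' / D.Del (k + 1) s') := by
        rw [Filter.eventually_all_finset]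
        exact fun k hk => eventually_eventually_nhds.mpr (hX k hk)
      exact this.mono fun s hs => ⟨σ, hσ, hs⟩
    filter_upwards [hXev, hD.regularAt_eventually hm h] with s hs hr
    exact (hD.potentialAt hm hx hr hs).x_deriv
  have hsrc := hD.src_differentiableAt hm hα hβ h
  refine ⟨hev.mono fun s hs => hs.differentiableAt, hsrc, ?_⟩
  have hderiv : deriv (D.newX x X n) =ᶠ[𝓝 t]
      fun s => (D.apply S).p n s + (D.apply S).src n n s := hev.mono fun s hs => hs.deriv
  refine HasDerivAt.congr_of_eventuallyEq ?_ hderiv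
  refine ((hD.apply_tlscsAt hm h).p_eq.fun_add hsrc.hasDerivAt).congr_deriv ?_
  have e0 := v_eq_exp hx h hX (k := n) le_rfl (by omega)
  have e1 := v_eq_exp hx h hX (k := n + 1) (by omega) le_rfl
  rw [add_sub_cancel_right] at e1
  rw [e0, e1]

end IsAdmissible

end GFDTData

end

theorem theorem3 {N l I : ℕ} (hlI : 0 < l + I)
    (S : TodaFields (Fin N)) (x : LatticeFn) (D : GFDTData l I)
    -- the given solution with `N` sources; the sources are differentiable in `t`
    (hS : S.IsSolution x)
    (hφp : ∀ i n, Differentiable ℝ (S.φp i n))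
    (hφm : ∀ i n, Differentiable ℝ (S.φm i n))
    -- the ordinary steps
    (hF : ∀ j, S.IsEigenfunction (D.Λ j) (D.F j))
    (hG : ∀ j, S.IsEigenfunction (D.Λ j) (D.G j))
    (hFG : ∀ j, IndependentPair (D.F j) (D.G j))
    (hΛ : Function.Injective D.Λ)
    (hα : ∀ j, Differentiable ℝ (D.α j))
    (hcd : ∀ (j : Fin l) t,
      D.c j t * D.d j t * D.α j t = (-1) ^ ((j : ℕ) + 1) * deriv (D.α j) t)
    -- the generalized steps: analytic families, with the parameter in an open set `W r`
    (W : Fin I → Set ℂ) (hW : ∀ r, IsOpen (W r)) (hω : ∀ r, D.ω r ∈ W r)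
    (hlam : ∀ r, AnalyticOnNhd ℂ (D.lam r) (W r))
    (hf : ∀ r, ∀ w ∈ W r, S.IsEigenfunction (D.lam r w) (D.f r w))
    (hg : ∀ r, ∀ w ∈ W r, S.IsEigenfunction (D.lam r w) (D.g r w))
    (hfan : ∀ r n t, AnalyticOnNhd ℂ (fun w => D.f r w n t) (W r))
    (hgan : ∀ r n t, AnalyticOnNhd ℂ (fun w => D.g r w n t) (W r))
    (hfcont : ∀ r n, ContinuousOn (fun z : ℝ × ℂ => D.f r z.2 n z.1) (Set.univ ×ˢ W r))
    (hgcont : ∀ r n, ContinuousOn (fun z : ℝ × ℂ => D.g r z.2 n z.1) (Set.univ ×ˢ W r))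
    (hfg : ∀ r, IndependentPair (D.f r (D.ω r)) (D.g r (D.ω r)))
    (hm : ∀ r, 2 ≤ D.m r)
    (hβ : ∀ r, Differentiable ℝ (D.β r)) :
    -- the new fields solve the system with `N + l + I` sources
    (∀ n t, D.RegularAt n t → (D.apply S).TLSCSAt n t) ∧
    -- every eigenfunction is transformed to an eigenfunction of the new Lax pair
    (∀ (μ : ℂ) (ψ : LatticeFn), S.IsEigenfunction μ ψ → (∀ j, μ ≠ (D.apply S).ev j) →
      ∀ n t, D.RegularAt n t → (D.apply S).LaxAt μ (D.transform ψ) n t) ∧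
    -- the new `x`, for every determination of the logarithm; a determination exists
    (∃ X : LatticeFn, ∀ n t, D.RegularAt n t → D.IsHalfLogSqAt X n t) ∧
    (∀ (X : LatticeFn) (n : ℤ) (t : ℝ), D.RegularAt n t → D.IsHalfLogSqAt X n t →
      (D.apply S).PotentialAt (D.newX x X) n t ∧
      ((∀ j, Differentiable ℝ (deriv (D.α j))) → (∀ r, Differentiable ℝ (deriv (D.β r))) →
        (D.apply S).SecondOrderAt (D.newX x X) n t)) := by
  have hD : D.IsAdmissible S W :=
    { tlscs := hS.tlscs
      φp_diff := hφp
      φm_diff := hφm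
      F_eigen := hF
      G_eigen := hG
      α_diff := hα
      cd_eq := hcd
      ω_mem := hω
      f_family := fun r => ⟨hW r, hlam r, hf r, hfan r, hfcont r⟩
      g_family := fun r => ⟨hW r, hlam r, hg r, hgan r, hgcont r⟩
      two_le := hm
      β_diff := hβ }
  obtain ⟨k, hk⟩ : ∃ k, D.order = k + 1 := by
    refine Nat.exists_eq_add_one.mpr ?_
    rcases Nat.eq_zero_or_pos l with hl | hl
    · exact Nat.add_pos_right _ (Finset.sum_pos (fun r _ => lt_of_lt_of_le two_pos (hm r))
        ⟨⟨0, by omega⟩, Finset.mem_univ _⟩)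
    · exact Nat.add_pos_left hl _
  refine ⟨fun n t h => hD.apply_tlscsAt hk h,
    fun μ ψ hψ hμ n t h => hD.apply_laxAt hk hψ hμ h, hD.exists_halfLogSq hk,
    fun X n t h hX => ⟨hD.potentialAt hk hS.potential h hX,
      fun hα2 hβ2 => hD.secondOrderAt hk hS.potential hα2 hβ2 h hX⟩⟩
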